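/- A PEL-datum is a tuple $(B,*,V,\langle\ ,\ \rangle,h)$ where $B$ is a finite-dimensional semisimple $\mathbb{Q}$-algebra, $*$ is a positive involution of $B$ (a $\mathbb{Q}$-linear map with $(ab)^*=b^*a^*$, $b^{**}=b$, and $\operatorname{tr}_{B_{\mathbb{R}}/\mathbb{R}}(bb^*)>0$ for all $0\neq b\in B_{\mathbb{R}}=B\otimes_{\mathbb{Q}}\mathbb{R}$), $V$ is a finite-dimensional $B$-module, $\langle\ ,\ \rangle$ is a non-degenerate alternating $\mathbb{Q}$-bilinear form on $V$ with $\langle bu,v\rangle=\langle u,b^*v\rangle$ for all $b\in B$, $u,v\in V$, and $h\colon\mathbb{C}\to\operatorname{End}_{B_{\mathbb{R}}}(V_{\mathbb{R}})$ is an $\mathbb{R}$-algebra homomorphism such that $\langle h(z)u,v\rangle=\langle u,h(\bar z)v\rangle$ for all $z\in\mathbb{C}$, $u,v\in V_{\mathbb{R}}$, and $\langle u,h(i)u\rangle>0$ for all $0\ne u\in V_{\mathbb{R}}$. Its algebraic group $G$ over $\mathbb{Q}$ is given, for commutative $\mathbb{Q}$-algebras $R$, by \[ G(R)=\{g\in\operatorname{Aut}_{B_R}(V_R)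 \mid \exists\,\mu\in R^\times\ \forall u,v\in V_R:\ \langle gu,gv\rangle=\mu\langle u,v\rangle\}, \] so that $h(z)\in G(\mathbb{R})$ for $z\in\mathbb{C}^\times$; its tautological representation on $V$ is called standard. **Lemma.** Let $(B,*,V,\langle\ ,\ \rangle,h)$ be a PEL-datum with group $G$ such that $B_{\mathbb{R}}$ only has factors of symplectic type, i.e. $(B_{\mathbb{R}},*)$ is isomorphic, as an $\mathbb{R}$-algebra with involution, to a finite product of algebras $(M_n(\mathbb{R}),A\mapsto A^t)$. Let $W$ be a finite-dimensional algebraic representation of $G$ over $\mathbb{Q}$ whose Hodge type is contained in $\{(-1,0),(0,-1)\}$, i.e. $W\otimes_{\mathbb{Q}}\mathbb{C}$ is a direct sum of complex lines, on each of which either every $h(z)$, $z\in\mathbb{C}^\times$, acts as multiplication by $z$, or every $h(z)$ acts as multiplication by $\bar z$. Then there is an integer $k\ge 0$ such that $W$ is isomorphic, as a representation of $G$, to a direct summand of $V^{\oplus k}$. -/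

import Mathlib

open scoped TensorProduct ComplexConjugate

noncomputable section

namespace PEL

/-! ### Extension of scalars of endomorphisms and the group functor `GL_W` -/

section Extend

variable {R S T : Type} [CommRing R] [Algebra ℚ R] [CommRing S] [Algebra ℚ S]
  {W : Type*} [AddCommGroup W] [Module ℚ W]

/-- Along `φ : R → S`, an `R`-linear endomorphism `f` of `W_R = R ⊗ W` extends to an `S`-linear
endomorphism of `W_S = S ⊗ W`: the one sending `s ⊗ w` to `s • (φ ⊗ 1) (f (1 ⊗ w))`. -/
def extendFun (φ : R →ₐ[ℚ] S) (f : Module.End R (R ⊗[ℚ] W)) : Module.End S (S ⊗[ℚ] W) :=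
  LinearMap.liftBaseChange S
    ((φ.toLinearMap.rTensor W) ∘ₗ (f.restrictScalars ℚ) ∘ₗ (TensorProduct.mk ℚ R W 1))

theorem rTensor_smul (φ : R →ₐ[ℚ] S) (r : R) (x : R ⊗[ℚ] W) :
    φ.toLinearMap.rTensor W (r • x) = φ r • φ.toLinearMap.rTensor W x := by
  induction x with
  | zero => simp
  | tmul s w => simp [TensorProduct.smul_tmul']
  | add x y hx hy => simp [hx, hy]

/-- `extendFun φ f` is characterised by its compatibility with `f` along `φ ⊗ 1`. -/
theorem extendFun_rTensor (φ : R →ₐ[ℚ] S) (f : Module.End R (R ⊗[ℚ] W)) (x : R ⊗[ℚ] W) :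
    extendFun φ f (φ.toLinearMap.rTensor W x) = φ.toLinearMap.rTensor W (f x) := by
  induction x with
  | zero => simp
  | tmul r w =>
    have h : r ⊗ₜ[ℚ] w = r • ((1 : R) ⊗ₜ[ℚ] w) := by simp [TensorProduct.smul_tmul']
    rw [h, rTensor_smul, map_smul, map_smul, rTensor_smul]
    simp [extendFun]
  | add x y hx hy => simp [hx, hy]

theorem extend_ext (φ : R →ₐ[ℚ] S) {f g : S ⊗[ℚ] W →ₗ[S] S ⊗[ℚ] W}
    (h : ∀ x : R ⊗[ℚ] W, f (φ.toLinearMap.rTensor W x) = g (φ.toLinearMap.rTensor W x)) :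
    f = g := by
  ext w
  simpa using h (1 ⊗ₜ w)

/-- Extension of scalars of endomorphisms, `End_R(W_R) → End_S(W_S)`, as a monoid
homomorphism. -/
def extendEnd (φ : R →ₐ[ℚ] S) : Module.End R (R ⊗[ℚ] W) →* Module.End S (S ⊗[ℚ] W) where
  toFun := extendFun φ
  map_one' := extend_ext φ fun x => by simp [extendFun_rTensor]
  map_mul' f g := extend_ext φ fun x => by simp [extendFun_rTensor]

/-- The map `GL_W(R) → GL_W(S)` induced by `φ : R → S`. -/
def extendGL (φ : R →ₐ[ℚ] S) :
    LinearMap.GeneralLinearGroup R (R ⊗[ℚ] W) →* LinearMap.GeneralLinearGroup S (S ⊗[ℚ] W) :=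
  Units.map (extendEnd φ)

end Extend

/-! ### PEL-data -/

/-- The action of `b ∈ B` on `V_R = R ⊗ V`. -/
def actB {B V : Type*} [Ring B] [Algebra ℚ B] [AddCommGroup V] [Module ℚ V] [Module B V]
    [IsScalarTower ℚ B V] (R : Type) [CommRing R] [Algebra ℚ R] (b : B) :
    Module.End R (R ⊗[ℚ] V) :=
  (Algebra.lsmul ℚ ℚ V b).baseChange R

/-- A PEL-datum `(B, *, V, ⟨ , ⟩, h)`, with `B` a finite-dimensional semisimple `ℚ`-algebra and
`V` a finite-dimensional `B`-module. Being `B_R`-linear on `V_R` is spelled out as being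
`R`-linear and commuting with the action of every `b ∈ B`. -/
structure Datum (B V : Type*) [Ring B] [Algebra ℚ B] [Module.Finite ℚ B] [IsSemisimpleRing B]
    [AddCommGroup V] [Module ℚ V] [Module B V] [IsScalarTower ℚ B V] [Module.Finite ℚ V] where
  /-- the involution `*` of `B` -/
  invol : B →ₗ[ℚ] B
  invol_mul : ∀ a b : B, invol (a * b) = invol b * invol a
  invol_invol : ∀ b : B, invol (invol b) = b
  /-- positivity of the involution: the trace `tr_{B_ℝ/ℝ} (b b*)` of multiplication by `b b*` on
  `B_ℝ` is positive for all `0 ≠ b` in `B_ℝ` -/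
  invol_pos : ∀ b : ℝ ⊗[ℚ] B, b ≠ 0 →
    0 < LinearMap.trace ℝ (ℝ ⊗[ℚ] B) (LinearMap.mulLeft ℝ (b * invol.baseChange ℝ b))
  /-- the pairing `⟨ , ⟩` on `V` -/
  form : LinearMap.BilinForm ℚ V
  form_alt : form.IsAlt
  form_nondegenerate : form.Nondegenerate
  form_smul : ∀ (b : B) (u v : V), form (b • u) v = form u (invol b • v)
  /-- the homomorphism `h : ℂ → End_{B_ℝ}(V_ℝ)` of `ℝ`-algebras -/
  h : ℂ →ₐ[ℝ] Module.End ℝ (ℝ ⊗[ℚ] V)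
  h_comm : ∀ (z : ℂ) (b : B), Commute (h z) (actB ℝ b)
  h_adjoint : ∀ (z : ℂ) (u v : ℝ ⊗[ℚ] V),
    form.baseChange ℝ (h z u) v = form.baseChange ℝ u (h (conj z) v)
  h_pos : ∀ u : ℝ ⊗[ℚ] V, u ≠ 0 → 0 < form.baseChange ℝ u (h Complex.I u)

namespace Datum

variable {B V : Type*} [Ring B] [Algebra ℚ B] [Module.Finite ℚ B] [IsSemisimpleRing B]
  [AddCommGroup V] [Module ℚ V] [Module B V] [IsScalarTower ℚ B V] [Module.Finite ℚ V]

/-- `B_ℝ` has only factors of symplectic type: as an `ℝ`-algebra with involution, `(B_ℝ, *)` is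
isomorphic to a finite product of matrix algebras `M_n(ℝ)` with transposition. -/
def OnlySymplecticFactors (D : Datum B V) : Prop :=
  ∃ (r : ℕ) (n : Fin r → ℕ)
    (e : (ℝ ⊗[ℚ] B) ≃ₐ[ℝ] ((i : Fin r) → Matrix (Fin (n i)) (Fin (n i)) ℝ)),
    (∀ i, 0 < n i) ∧
    ∀ (b : ℝ ⊗[ℚ] B) (i : Fin r), e (D.invol.baseChange ℝ b) i = (e b i).transpose

/-! ### The algebraic group `G` as a functor of points -/

/-- `G(R)`: the `B_R`-linear automorphisms of `V_R` preserving the pairing up to a unit of `R`. -/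
def points (D : Datum B V) (R : Type) [CommRing R] [Algebra ℚ R] :
    Subgroup (LinearMap.GeneralLinearGroup R (R ⊗[ℚ] V)) where
  carrier := {g | (∀ b : B, Commute (g : Module.End R (R ⊗[ℚ] V)) (actB R b)) ∧
    ∃ μ : Rˣ, ∀ u v : R ⊗[ℚ] V,
      D.form.baseChange R ((g : Module.End R (R ⊗[ℚ] V)) u)
        ((g : Module.End R (R ⊗[ℚ] V)) v) = (μ : R) * D.form.baseChange R u v}
  one_mem' := ⟨fun _ => Commute.one_left _, 1, fun _ _ => by simp⟩
  mul_mem' := by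
    rintro g g' ⟨hg, μ, hμ⟩ ⟨hg', μ', hμ'⟩
    refine ⟨fun b => ?_, μ * μ', fun u v => ?_⟩
    · simpa using (hg b).mul_left (hg' b)
    · simp only [Units.val_mul, Module.End.mul_apply]
      rw [hμ, hμ', mul_assoc]
  inv_mem' := by
    rintro g ⟨hg, μ, hμ⟩
    refine ⟨fun b => (hg b).units_inv_left, μ⁻¹, fun u v => ?_⟩
    have key : ∀ x, (g : Module.End R (R ⊗[ℚ] V))
        (((g⁻¹ : LinearMap.GeneralLinearGroup R (R ⊗[ℚ] V)) : Module.End R (R ⊗[ℚ] V)) x) = x :=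
      fun x => by rw [← Module.End.mul_apply, Units.mul_inv, Module.End.one_apply]
    have := hμ (((g⁻¹ : LinearMap.GeneralLinearGroup R (R ⊗[ℚ] V)) : Module.End R (R ⊗[ℚ] V)) u)
      (((g⁻¹ : LinearMap.GeneralLinearGroup R (R ⊗[ℚ] V)) : Module.End R (R ⊗[ℚ] V)) v)
    rw [key, key] at this
    rw [this, Units.inv_mul_cancel_left]

theorem extendGL_mem (D : Datum B V) {R S : Type} [CommRing R] [Algebra ℚ R] [CommRing S]
    [Algebra ℚ S] (φ : R →ₐ[ℚ] S) {g : LinearMap.GeneralLinearGroup R (R ⊗[ℚ] V)}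
    (hg : g ∈ D.points R) : extendGL φ g ∈ D.points S := by
  have ext_apply : ∀ x : R ⊗[ℚ] V,
      ((extendGL φ g : LinearMap.GeneralLinearGroup S (S ⊗[ℚ] V)) : Module.End S (S ⊗[ℚ] V))
        (φ.toLinearMap.rTensor V x) =
      φ.toLinearMap.rTensor V ((g : Module.End R (R ⊗[ℚ] V)) x) :=
    fun x => extendFun_rTensor φ _ x
  have form_apply : ∀ x y : R ⊗[ℚ] V,
      D.form.baseChange S (φ.toLinearMap.rTensor V x) (φ.toLinearMap.rTensor V y) =
        φ (D.form.baseChange R x y) := by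
    intro x y
    induction x with
    | zero => simp
    | add x x' hx hx' => simp [hx, hx']
    | tmul r u =>
      induction y with
      | zero => simp
      | add y y' hy hy' => rw [map_add, map_add, map_add, map_add, hy, hy']
      | tmul s v => simp
  have act_apply : ∀ (b : B) (x : R ⊗[ℚ] V),
      actB S b (φ.toLinearMap.rTensor V x) = φ.toLinearMap.rTensor V (actB R b x) := by
    intro b x
    induction x with
    | zero => simp
    | add x x' hx hx' => simp [hx, hx']
    | tmul r u => simp [actB]
  obtain ⟨hb, μ, hμ⟩ := hg
  refine ⟨fun b => extend_ext φ fun x => ?_, Units.map (φ : R →* S) μ, fun u v => ?_⟩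
  · have := LinearMap.congr_fun (hb b).eq x
    simp only [Module.End.mul_apply] at this ⊢
    rw [act_apply, ext_apply, ext_apply, act_apply, this]
  · have tm : ∀ (s : S) (v : V), s ⊗ₜ[ℚ] v = s • φ.toLinearMap.rTensor V ((1 : R) ⊗ₜ[ℚ] v) := by
      intro s v
      simp [TensorProduct.smul_tmul']
    induction u with
    | zero => simp
    | add u u' hu hu' => simp only [map_add, LinearMap.add_apply, hu, hu', mul_add]
    | tmul s u =>
      induction v with
      | zero => simp
      | add v v' hv hv' => simp only [map_add, hv, hv', mul_add]
      | tmul t v =>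
        rw [tm s u, tm t v]
        simp only [map_smul, LinearMap.smul_apply, smul_eq_mul]
        rw [ext_apply, ext_apply, form_apply, form_apply, hμ, map_mul]
        simp only [Units.coe_map, MonoidHom.coe_coe]
        ring

/-- The map `G(R) → G(S)` induced by a homomorphism `φ : R → S` of `ℚ`-algebras. -/
def pointsMap (D : Datum B V) {R S : Type} [CommRing R] [Algebra ℚ R] [CommRing S]
    [Algebra ℚ S] (φ : R →ₐ[ℚ] S) : D.points R →* D.points S :=
  ((extendGL φ).comp (D.points R).subtype).codRestrict (D.points S)
    fun g => D.extendGL_mem φ g.2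

/-- The homomorphism `ℂˣ → G(ℝ)` given by `h`, that is, `h : 𝕊 → G_ℝ` on real points. -/
def hPoint (D : Datum B V) : ℂˣ →* D.points ℝ :=
  (Units.map (D.h : ℂ →* Module.End ℝ (ℝ ⊗[ℚ] V))).codRestrict (D.points ℝ) fun z => by
    refine ⟨fun b => D.h_comm z b,
      Units.mk0 (Complex.normSq z) (by simp), fun u v => ?_⟩
    change D.form.baseChange ℝ (D.h z u) (D.h z v) = Complex.normSq z * _
    rw [D.h_adjoint, ← Module.End.mul_apply, ← map_mul, mul_comm, Complex.mul_conj,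
      ← Complex.coe_algebraMap, AlgHom.commutes, Module.algebraMap_end_apply, map_smul, smul_eq_mul]

/-! ### Representations of `G` -/

/-- A representation of `G` on the `ℚ`-vector space `W`: a morphism `G → GL_W` of group functors
on commutative `ℚ`-algebras. (As `G` is affine of finite type over `ℚ`, algebras in `Type`
suffice.) -/
structure Rep (D : Datum B V) (W : Type*) [AddCommGroup W] [Module ℚ W] where
  toHom : ∀ (R : Type) [CommRing R] [Algebra ℚ R],
    D.points R →* LinearMap.GeneralLinearGroup R (R ⊗[ℚ] W)
  natural : ∀ (R S : Type) [CommRing R] [Algebra ℚ R] [CommRing S] [Algebra ℚ S]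
    (φ : R →ₐ[ℚ] S) (g : D.points R), toHom S (D.pointsMap φ g) = extendGL φ (toHom R g)

/-- The standard representation of `G` on `V`. -/
def std (D : Datum B V) : D.Rep V where
  toHom R _ _ := (D.points R).subtype
  natural _ _ _ _ _ _ _ _ := rfl

namespace Rep

variable {D : Datum B V} {W W' : Type*} [AddCommGroup W] [Module ℚ W]
  [AddCommGroup W'] [Module ℚ W']

/-- The diagonal action `f ⊕ ⋯ ⊕ f` on `R ⊗ W^k = (R ⊗ W)^k`. -/
def diagEnd (k : ℕ) (R : Type) [CommRing R] [Algebra ℚ R] :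
    Module.End R (R ⊗[ℚ] W) →* Module.End R (R ⊗[ℚ] (Fin k → W)) where
  toFun f := (TensorProduct.piRight ℚ R R (fun _ : Fin k => W)).symm.toLinearMap ∘ₗ
    (LinearMap.pi fun j => f ∘ₗ LinearMap.proj j) ∘ₗ
    (TensorProduct.piRight ℚ R R (fun _ : Fin k => W)).toLinearMap
  map_one' := by
    ext x
    simp [Module.End.one_eq_id]
  map_mul' f g := by
    refine LinearMap.ext fun x => ?_
    simp only [LinearMap.comp_apply, Module.End.mul_apply, LinearEquiv.coe_coe,
      LinearEquiv.apply_symm_apply]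
    rfl

theorem piRight_rTensor {k : ℕ} {R S : Type} [CommRing R] [Algebra ℚ R] [CommRing S]
    [Algebra ℚ S] (φ : R →ₐ[ℚ] S) (x : R ⊗[ℚ] (Fin k → W)) (j : Fin k) :
    TensorProduct.piRight ℚ S S (fun _ : Fin k => W) (φ.toLinearMap.rTensor _ x) j =
      φ.toLinearMap.rTensor W (TensorProduct.piRight ℚ R R (fun _ : Fin k => W) x j) := by
  induction x with
  | zero => simp
  | tmul r w => simp
  | add x y hx hy => simp only [map_add, Pi.add_apply, hx, hy]

theorem diagEnd_extendEnd (k : ℕ) {R S : Type} [CommRing R] [Algebra ℚ R] [CommRing S]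
    [Algebra ℚ S] (φ : R →ₐ[ℚ] S) (f : Module.End R (R ⊗[ℚ] W)) :
    diagEnd k S (extendEnd φ f) = extendEnd φ (diagEnd k R f) := by
  refine extend_ext φ fun x => ?_
  have h1 : extendEnd φ (diagEnd k R f) (φ.toLinearMap.rTensor _ x) =
      φ.toLinearMap.rTensor _ (diagEnd k R f x) := extendFun_rTensor φ _ x
  rw [h1]
  apply (TensorProduct.piRight ℚ S S (fun _ : Fin k => W)).injective
  funext j
  rw [piRight_rTensor]
  simp only [diagEnd, MonoidHom.coe_mk, OneHom.coe_mk, LinearMap.comp_apply,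
    LinearEquiv.coe_coe, LinearEquiv.apply_symm_apply, LinearMap.pi_apply, LinearMap.proj_apply]
  rw [piRight_rTensor]
  exact extendFun_rTensor φ f _

/-- The direct sum `W^{⊕ k}` of `k` copies of a representation. -/
def copies (ρ : D.Rep W) (k : ℕ) : D.Rep (Fin k → W) where
  toHom R _ _ := (Units.map (diagEnd k R)).comp (ρ.toHom R)
  natural R S _ _ _ _ φ g := by
    apply Units.ext
    have := congrArg (fun t : LinearMap.GeneralLinearGroup S (S ⊗[ℚ] W) =>
      diagEnd k S (t : Module.End S (S ⊗[ℚ] W))) (ρ.natural R S φ g)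
    exact this.trans (diagEnd_extendEnd k φ _)

/-- A `ℚ`-linear map is a morphism of representations if it commutes with the action of `G(R)`
after base change to any `R`. -/
def IsMorphism (ρ : D.Rep W) (σ : D.Rep W') (f : W →ₗ[ℚ] W') : Prop :=
  ∀ (R : Type) [CommRing R] [Algebra ℚ R] (g : D.points R) (x : R ⊗[ℚ] W),
    f.baseChange R ((ρ.toHom R g : Module.End R (R ⊗[ℚ] W)) x) =
      (σ.toHom R g : Module.End R (R ⊗[ℚ] W')) (f.baseChange R x)

/-- `ρ` is (isomorphic to) a direct summand of `σ`: there are morphisms of representations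
`W → W' → W` composing to the identity. -/
def IsDirectSummand (ρ : D.Rep W) (σ : D.Rep W') : Prop :=
  ∃ (i : W →ₗ[ℚ] W') (p : W' →ₗ[ℚ] W),
    IsMorphism ρ σ i ∧ IsMorphism σ ρ p ∧ p ∘ₗ i = LinearMap.id

/-- The Hodge type of `W` is contained in the set `s`: the space `W_ℂ` has a basis of vectors, on
each of which every `z ∈ 𝕊(ℝ) = ℂˣ` acts through `h` as multiplication by `z^{-p} z̄^{-q}` for some
`(p, q) ∈ s`. -/
def HodgeTypeIn (ρ : D.Rep W) (s : Set (ℤ × ℤ)) : Prop :=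
  ∃ (n : ℕ) (e : Module.Basis (Fin n) ℂ (ℂ ⊗[ℝ] (ℝ ⊗[ℚ] W))) (pq : Fin n → ℤ × ℤ),
    ∀ j, pq j ∈ s ∧ ∀ z : ℂˣ,
      (ρ.toHom ℝ (D.hPoint z) : Module.End ℝ (ℝ ⊗[ℚ] W)).baseChange ℂ (e j) =
        ((z : ℂ) ^ (-(pq j).1) * (conj (z : ℂ)) ^ (-(pq j).2)) • e j

end Rep

end Datum

end PEL

end

/-!
Write `W_ℂ`, `V_ℂ` for the representations over the complex numbers. The point is that the Hodge
type of `W` alone determines `W_ℂ` as a representation of `G_ℂ`.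

The matrix units of `B_ℝ` split `V_ℂ` into standard symplectic spaces `ℂ^{2 g_i}`, the `i`-th one
occurring with some multiplicity `n_i > 0`, and they can be given symplectic bases adapted to the
eigenspaces of `h(i)` (`exists_symplectic_frame`, `Datum.OnlySymplecticFactors.exists_hodgeFrame`).
Thus `G_ℂ` is the group of families `(x_i)` of symplectic similitudes in `GSp(2 g_i)` with a common
multiplier (`Datum.HodgeFrame.exists_act`), and over the complex numbers the image of `h` consists
of the products of scalars and of elements of the cocharacter `t ↦ (diag(t, 1))_i`. The condition
on the Hodge type says that scalars act on `W_ℂ` as scalars and that the cocharacter acts with the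
weights `0` and `1` only (`Datum.HodgeFrame.hasWeights`); passing from the real points of the torus
to all points uses Zariski density (`Datum.Rep.matRep_add_smul_cplx`).

Over any field of characteristic zero, a representation of this group with the two weights is the
restriction of a representation of the algebra `∏ M_{2 g_i}` (`SimRep.toFun_eq_ext`). Indeed,
conjugation by the cocharacter shows that upper unipotent elements `1 + S` act by `1 + up S`, with
`up` linear (`SimRep.toFun_upper_smul`), and likewise for lower unipotent elements. A computation
with dual numbers gives `up S * down T * up S = up (S * T * S)` (`SimRep.up_down_up`), so that
`S ↦ up S * down 1` is a homomorphism of Jordan algebras on symmetric matrices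
(`SimRep.isJordanHom_jordanMap`). Its values on the diagonal matrix units and on the matrix with all
entries `1` produce matrix units in `End(W_ℂ)` (`IsJordanHom.isMatrixUnits`), hence the homomorphism
of algebras. It agrees with the representation on unipotent elements and on the cocharacter, and
these generate the group, locally on the base.

Modules over a product of matrix algebras are sums of the standard ones, so that the identity of
`W_ℂ` is a sum of endomorphisms that factor through `V_ℂ`
(`Datum.HodgeFrame.exists_sum_eq_one`). Applying `ℚ`-linear forms `ℂ → ℚ` to the entries of
intertwining operators gives intertwining operators over `ℚ` (`Datum.Rep.Intertwines.map_linear`).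
In this way the identity of `W` becomes a sum of endomorphisms that factor through `V`
(`Datum.Rep.exists_sum_eq_one_rat`), and this makes `W` a direct summand of copies of `V`.
-/

noncomputable section

set_option linter.unusedSectionVars false

namespace PEL

section

/-! ### Families of square matrices in blocks -/

section Families

variable {ι : Type} {l : ι → Type}

/-- Families of square matrices over `R`, the `i`-th one with index type `m i`. -/
abbrev MatFam (m : ι → Type) (R : Type) : Type := ∀ i, Matrix (m i) (m i) R

/-- Families of square matrices of even size, written in four blocks indexed by `l i`. -/
abbrev BlockFam (l : ι → Type) (R : Type) : Type := MatFam (fun i => l i ⊕ l i) R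

variable {R S : Type} [CommRing R] [CommRing S]

/-- Entrywise application of a ring homomorphism to a family of matrices. -/
def mapFam {m : ι → Type} [∀ i, Fintype (m i)] [∀ i, DecidableEq (m i)] (φ : R →+* S) :
    MatFam m R →+* MatFam m S where
  toFun x i := (x i).map φ
  map_one' := by funext i; simp
  map_zero' := by funext i; simp
  map_mul' x y := by funext i; simp [Matrix.map_mul]
  map_add' x y := by funext i; simp [Matrix.map_add]

@[simp]
theorem mapFam_apply {m : ι → Type} [∀ i, Fintype (m i)] [∀ i, DecidableEq (m i)] (φ : R →+* S)
    (x : MatFam m R) (i : ι) : mapFam φ x i = (x i).map φ := rfl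

@[simp]
theorem mapFam_smul {m : ι → Type} [∀ i, Fintype (m i)] [∀ i, DecidableEq (m i)] (φ : R →+* S)
    (r : R) (x : MatFam m R) : mapFam φ (r • x) = φ r • mapFam φ x := by
  funext i; ext a b; simp

/-- The transpose of a family of matrices. -/
def tr {m : ι → Type} (x : MatFam m R) : MatFam m R := fun i => (x i).transpose

section tr

variable {m : ι → Type}

@[simp] theorem tr_apply (x : MatFam m R) (i : ι) : tr x i = (x i).transpose := rfl

@[simp] theorem tr_tr (x : MatFam m R) : tr (tr x) = x := rfl

@[simp] theorem tr_zero : tr (0 : MatFam m R) = 0 := rfl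

@[simp] theorem tr_add (x y : MatFam m R) : tr (x + y) = tr x + tr y := rfl

@[simp] theorem tr_neg (x : MatFam m R) : tr (-x) = -tr x := rfl

@[simp] theorem tr_sub (x y : MatFam m R) : tr (x - y) = tr x - tr y := rfl

@[simp] theorem tr_smul (r : R) (x : MatFam m R) : tr (r • x) = r • tr x := rfl

variable [∀ i, Fintype (m i)] [∀ i, DecidableEq (m i)]

@[simp] theorem tr_one : tr (1 : MatFam m R) = 1 := by
  funext i; simp

@[simp] theorem tr_mul (x y : MatFam m R) : tr (x * y) = tr y * tr x := by
  funext i; simp [Matrix.transpose_mul]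

theorem tr_mapFam (φ : R →+* S) (x : MatFam m R) : tr (mapFam φ x) = mapFam φ (tr x) := rfl

end tr

/-- The family of block matrices with the four given blocks. -/
def blk (A B C D : MatFam l R) : BlockFam l R := fun i => Matrix.fromBlocks (A i) (B i) (C i) (D i)

theorem eq_blk (x : BlockFam l R) :
    x = blk (fun i => (x i).toBlocks₁₁) (fun i => (x i).toBlocks₁₂) (fun i => (x i).toBlocks₂₁)
      (fun i => (x i).toBlocks₂₂) := by
  funext i; exact (Matrix.fromBlocks_toBlocks (x i)).symm

theorem blk_smul (r : R) (A B C D : MatFam l R) :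
    r • blk A B C D = blk (r • A) (r • B) (r • C) (r • D) := by
  funext i; simp [blk, Matrix.fromBlocks_smul]

theorem blk_add (A B C D A' B' C' D' : MatFam l R) :
    blk A B C D + blk A' B' C' D' = blk (A + A') (B + B') (C + C') (D + D') := by
  funext i; simp [blk, Matrix.fromBlocks_add]

variable [∀ i, Fintype (l i)] [∀ i, DecidableEq (l i)]

theorem blk_one : (1 : BlockFam l R) = blk 1 0 0 1 := by
  funext i; simp [blk]

theorem blk_mul (A B C D A' B' C' D' : MatFam l R) :
    blk A B C D * blk A' B' C' D' =
      blk (A * A' + B * C') (A * B' + B * D') (C * A' + D * C') (C * B' + D * D') := by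
  funext i; simp [blk, Matrix.fromBlocks_multiply]

theorem mapFam_blk (φ : R →+* S) (A B C D : MatFam l R) :
    mapFam φ (blk A B C D) = blk (mapFam φ A) (mapFam φ B) (mapFam φ C) (mapFam φ D) := by
  funext i; simp [blk, Matrix.fromBlocks_map]

/-! ### Families of symplectic similitudes -/

/-- All members of the family `x` are symplectic similitudes with the same multiplier `μ`. -/
def IsSim (x : BlockFam l R) (μ : R) : Prop :=
  ∀ i, (x i).transpose * Matrix.J (l i) R * x i = μ • Matrix.J (l i) R

/-- The families of symplectic similitudes with a common invertible multiplier. -/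
def IsGSp (x : BlockFam l R) : Prop := ∃ μ : R, IsUnit μ ∧ IsSim x μ

theorem isSim_blk {A B C D : MatFam l R} {μ : R} (h₁ : tr A * C = tr C * A)
    (h₂ : tr B * D = tr D * B) (h₃ : tr A * D = tr C * B + μ • 1) : IsSim (blk A B C D) μ := by
  intro i
  have h₁ := congrFun h₁ i
  have h₂ := congrFun h₂ i
  have h₃' := congrArg Matrix.transpose (congrFun h₃ i)
  have h₃ := congrFun h₃ i
  simp only [Pi.mul_apply, tr_apply, Pi.add_apply, Pi.smul_apply, Pi.one_apply,
    Matrix.transpose_add, Matrix.transpose_mul, Matrix.transpose_transpose,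
    Matrix.transpose_smul, Matrix.transpose_one] at h₁ h₂ h₃ h₃'
  simp only [blk, Matrix.J, Matrix.fromBlocks_transpose, Matrix.fromBlocks_multiply,
    Matrix.fromBlocks_smul, Matrix.mul_zero, Matrix.mul_one, Matrix.mul_neg, zero_add, add_zero,
    smul_zero, smul_neg, Matrix.neg_mul]
  rw [h₁, h₂, h₃, h₃']
  congr 1 <;> abel

theorem IsSim.blk {A B C D : MatFam l R} {μ : R} (h : IsSim (blk A B C D) μ) :
    tr A * C = tr C * A ∧ tr B * D = tr D * B ∧ tr A * D = tr C * B + μ • 1 := by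
  have key : ∀ i, (C i).transpose * A i + -((A i).transpose * C i) = 0 ∧
      (C i).transpose * B i + -((A i).transpose * D i) = -(μ • (1 : Matrix (l i) (l i) R)) ∧
      (D i).transpose * B i + -((B i).transpose * D i) = 0 := by
    intro i
    have := h i
    simp only [PEL.blk, Matrix.J, Matrix.fromBlocks_transpose, Matrix.fromBlocks_multiply,
      Matrix.fromBlocks_smul, Matrix.mul_zero, Matrix.mul_one, Matrix.mul_neg, zero_add, add_zero,
      smul_zero, smul_neg, Matrix.neg_mul] at this
    rw [Matrix.fromBlocks_inj] at this
    exact ⟨this.1, this.2.1, this.2.2.2⟩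
  refine ⟨funext fun i => ?_, funext fun i => ?_, funext fun i => ?_⟩
  · have := (key i).1
    rw [← sub_eq_add_neg, sub_eq_zero] at this
    exact this.symm
  · have := (key i).2.2
    rw [← sub_eq_add_neg, sub_eq_zero] at this
    exact this.symm
  · have := (key i).2.1
    rw [← sub_eq_add_neg, sub_eq_iff_eq_add, neg_add_eq_sub, eq_sub_iff_add_eq] at this
    exact this.symm

theorem IsSim.mul {x y : BlockFam l R} {μ ν : R} (hx : IsSim x μ) (hy : IsSim y ν) :
    IsSim (x * y) (μ * ν) := fun i => by
  have h : (x i * y i).transpose * Matrix.J (l i) R * (x i * y i) =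
      (y i).transpose * ((x i).transpose * Matrix.J (l i) R * x i) * y i := by
    simp only [Matrix.transpose_mul, Matrix.mul_assoc]
  rw [Pi.mul_apply, h, hx i, Matrix.mul_smul, Matrix.smul_mul, hy i, smul_smul]

theorem IsSim.mapFam {x : BlockFam l R} {μ : R} (hx : IsSim x μ) (φ : R →+* S) :
    IsSim (mapFam φ x) (φ μ) := fun i => by
  have hJ : (Matrix.J (l i) R).map φ = Matrix.J (l i) S := by
    simp [Matrix.J, Matrix.fromBlocks_map, Matrix.map_neg]
  have := congrArg (fun M => M.map φ) (hx i)
  simp only [Matrix.map_mul, Matrix.transpose_map, hJ] at this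
  rw [Matrix.map_smul' _ _ _ (map_mul φ), hJ] at this
  exact this

theorem IsGSp.mul {x y : BlockFam l R} : IsGSp x → IsGSp y → IsGSp (x * y)
  | ⟨μ, hμ, hx⟩, ⟨ν, hν, hy⟩ => ⟨μ * ν, hμ.mul hν, hx.mul hy⟩

/-- The upper unipotent family with upper right blocks `S`. -/
def upper (S : MatFam l R) : BlockFam l R := blk 1 S 0 1

/-- The lower unipotent family with lower left blocks `S`. -/
def lower (S : MatFam l R) : BlockFam l R := blk 1 0 S 1

/-- The block diagonal family with blocks `A` and `A'ᵀ`. It is meant for `A' = A⁻¹`. -/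
def levi (A A' : MatFam l R) : BlockFam l R := blk A 0 0 (tr A')

/-- The cocharacter `t ↦ diag(t, 1)` of the group of families of similitudes. -/
def cochar (t : R) : BlockFam l R := blk (t • 1) 0 0 1

theorem isGSp_upper {S : MatFam l R} (hS : tr S = S) : IsGSp (upper S) :=
  ⟨1, isUnit_one, isSim_blk (by simp) (by simp [hS]) (by simp)⟩

theorem isGSp_lower {S : MatFam l R} (hS : tr S = S) : IsGSp (lower S) :=
  ⟨1, isUnit_one, isSim_blk (by simp [hS]) (by simp) (by simp)⟩

theorem isGSp_levi {A A' : MatFam l R} (h : A' * A = 1) : IsGSp (levi A A') :=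
  ⟨1, isUnit_one, isSim_blk (by simp) (by simp) (by rw [← tr_mul, h]; simp)⟩

theorem isGSp_cochar {t : R} (ht : IsUnit t) : IsGSp (cochar t : BlockFam l R) :=
  ⟨t, ht, isSim_blk (by simp) (by simp) (by simp)⟩

theorem isGSp_smul_one {t : R} (ht : IsUnit t) : IsGSp (t • 1 : BlockFam l R) := by
  rw [blk_one, blk_smul]
  refine ⟨t * t, ht.mul ht, isSim_blk (by simp) (by simp) ?_⟩
  simp only [tr_smul, tr_one, smul_zero, tr_zero, zero_mul, zero_add, smul_mul_assoc, one_mul,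
    smul_smul]

@[simp] theorem mapFam_upper (φ : R →+* S) (A : MatFam l R) :
    mapFam φ (upper A) = upper (mapFam φ A) := by simp [upper, mapFam_blk]

@[simp] theorem mapFam_lower (φ : R →+* S) (A : MatFam l R) :
    mapFam φ (lower A) = lower (mapFam φ A) := by simp [lower, mapFam_blk]

@[simp] theorem mapFam_levi (φ : R →+* S) (A A' : MatFam l R) :
    mapFam φ (levi A A') = levi (mapFam φ A) (mapFam φ A') := by
  simp [levi, mapFam_blk, tr_mapFam]

theorem upper_zero : upper (0 : MatFam l R) = 1 := blk_one.symm

theorem upper_mul (A B : MatFam l R) : upper A * upper B = upper (A + B) := by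
  simp [upper, blk_mul, add_comm]

theorem levi_mul (A A' B B' : MatFam l R) :
    levi A A' * levi B B' = levi (A * B) (B' * A') := by simp [levi, blk_mul]

theorem cochar_mul (s t : R) : (cochar s * cochar t : BlockFam l R) = cochar (s * t) := by
  simp [cochar, blk_mul, smul_smul, mul_comm]

theorem cochar_one : (cochar 1 : BlockFam l R) = 1 := by simp [cochar, blk_one]

theorem cochar_mul_upper (t : R) (S : MatFam l R) :
    cochar t * upper S = upper (t • S) * cochar t := by simp [cochar, upper, blk_mul]

theorem cochar_mul_levi (t : R) (A A' : MatFam l R) :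
    cochar t * levi A A' = levi A A' * cochar t := by simp [cochar, levi, blk_mul]

end Families

end

section

/-! ### Representations of the group of families of similitudes -/

variable {k : Type} [Field k] {ι : Type} {l : ι → Type}
  [∀ i, Fintype (l i)] [∀ i, DecidableEq (l i)] {n : Type} [Fintype n] [DecidableEq n]

/-- The matrix over the `k`-algebra `R` given by a matrix over `k`. -/
abbrev scal (R : Type) [CommRing R] [Algebra k R] : Matrix n n k →+* Matrix n n R :=
  (algebraMap k R).mapMatrix

/-- A matrix representation of the group scheme over `k` of families of symplectic similitudes
with a common multiplier, as a natural family of maps on `R`-points that are multiplicative on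
the similitudes. The values outside of the group play no role. -/
structure SimRep (k : Type) [Field k] {ι : Type} (l : ι → Type)
    [∀ i, Fintype (l i)] [∀ i, DecidableEq (l i)] (n : Type) [Fintype n] [DecidableEq n] where
  toFun : ∀ (R : Type) [CommRing R] [Algebra k R], BlockFam l R → Matrix n n R
  one : ∀ (R : Type) [CommRing R] [Algebra k R], toFun R 1 = 1
  mul : ∀ {R : Type} [CommRing R] [Algebra k R] {x y : BlockFam l R}, IsGSp x → IsGSp y →
    toFun R (x * y) = toFun R x * toFun R y
  natural : ∀ {R S : Type} [CommRing R] [Algebra k R] [CommRing S] [Algebra k S]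
    (φ : R →ₐ[k] S) {x : BlockFam l R}, IsGSp x →
    toFun S (mapFam (φ : R →+* S) x) = (toFun R x).map φ

namespace SimRep

variable (F : SimRep k l n)

theorem toFun_cst {x : BlockFam l k} (hx : IsGSp x) (R : Type) [CommRing R] [Algebra k R] :
    F.toFun R (mapFam (algebraMap k R) x) = scal R (F.toFun k x) :=
  F.natural (Algebra.ofId k R) hx

/-- The cocharacter `t ↦ diag(t, 1)` acts with weights `0` and `1` only: it acts by `t` on the
image of the idempotent `P` and trivially on its kernel, and scalars act as scalars. -/
structure HasWeights (P : Matrix n n k) : Prop where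
  idem : P * P = P
  cochar : ∀ {R : Type} [CommRing R] [Algebra k R] {t : R}, IsUnit t →
    F.toFun R (cochar t) = 1 - scal R P + t • scal R P
  scalar : ∀ {R : Type} [CommRing R] [Algebra k R] {t : R}, IsUnit t →
    F.toFun R (t • 1) = t • 1

variable {F} {P : Matrix n n k}

theorem mapMatrix_smul {R S : Type} [CommRing R] [CommRing S] (φ : R →+* S) (r : R)
    (A : Matrix n n R) : φ.mapMatrix (r • A) = φ r • φ.mapMatrix A := by
  ext a b; simp

/-- Conjugating `upper S` by the cocharacter scales `S`. As only the weights `0` and `1` occur,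
the representation is therefore affine along the ray spanned by `S`, and its linear term maps the
part of weight `0` to the part of weight `1`. The comparison is made over `R[X]`, which is
embedded in `R[X, X⁻¹]` to make the parameter invertible. -/
theorem toFun_upper_smul (hP : F.HasWeights P) {R : Type} [CommRing R] [Algebra k R]
    {S : MatFam l R} (hS : tr S = S) (r : R) :
    F.toFun R (upper (r • S)) = 1 + r • (scal R P * F.toFun R (upper S) * (1 - scal R P)) := by
  open Polynomial in
  set p := scal R P with hp
  set f := F.toFun R (upper S) with hf
  have hpp : p * p = p := by rw [hp, ← map_mul, hP.idem]
  set κ : Matrix n n R →+* Matrix n n R[X] := C.mapMatrix with hκ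
  -- the action of `upper (X • S)` over `R[X]`
  set XS : MatFam l R[X] := (X : R[X]) • mapFam (C : R →+* R[X]) S with hXS
  have hXS' : tr XS = XS := by rw [hXS, tr_smul, tr_mapFam, hS]
  set M := F.toFun R[X] (upper XS) with hM
  let c : R →ₐ[k] R[X] := Algebra.ofId R R[X] |>.restrictScalars k
  have hc : (c : R →+* R[X]) = C := rfl
  have hcS : F.toFun R[X] (upper (mapFam C S)) = κ f := by
    rw [← mapFam_upper, ← hc, F.natural c (isGSp_upper hS)]; rfl
  -- evaluation at `s`
  have hev : ∀ s : R, (evalRingHom s).mapMatrix M = F.toFun R (upper (s • S)) := by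
    intro s
    let φ : R[X] →ₐ[k] R := (aeval (R := R) s).restrictScalars k
    have h1 : mapFam (φ : R[X] →+* R) (upper XS) = upper (s • S) := by
      rw [mapFam_upper, hXS, mapFam_smul]
      congr 1
      funext i; ext a b
      simp [φ]
    rw [← h1, F.natural φ (isGSp_upper hXS'), hM]
    ext a b
    simp [φ]
  have hevκ : ∀ (s : R) (A : Matrix n n R), (evalRingHom s).mapMatrix (κ A) = A := by
    intro s A; ext a b; simp [hκ]
  -- conjugation by the cocharacter over `R[X, X⁻¹]`
  have key : (X : R[X]) • M =
      (1 - κ p + (X : R[X]) • κ p) * κ f * ((X : R[X]) • (1 - κ p) + κ p) := by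
    let ψ : R[X] →ₐ[k] LaurentPolynomial R := (toLaurentAlg (R := R)).restrictScalars k
    set Ψ : Matrix n n R[X] →+* Matrix n n (LaurentPolynomial R) :=
      (ψ : R[X] →+* LaurentPolynomial R).mapMatrix with hΨ
    have hψ : Function.Injective ψ := toLaurent_injective
    have hψm : Function.Injective Ψ := fun A B h => by
      ext a b
      rw [hψ (congrFun (congrFun h a) b)]
    set t : LaurentPolynomial R := LaurentPolynomial.T 1 with ht
    set t' : LaurentPolynomial R := LaurentPolynomial.T (-1) with ht'
    have htt : t * t' = 1 := by rw [ht, ht', ← LaurentPolynomial.T_add]; simp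
    have htt' : t' * t = 1 := by rw [mul_comm, htt]
    have hut : IsUnit t := IsUnit.of_mul_eq_one _ htt
    have hut' : IsUnit t' := IsUnit.of_mul_eq_one _ htt'
    have hψX : (ψ : R[X] →+* LaurentPolynomial R) X = t := by simp [ψ, ht]
    set S' : MatFam l (LaurentPolynomial R) := mapFam (ψ : R[X] →+* _) (mapFam C S) with hS'
    have hS'' : tr S' = S' := by rw [hS', tr_mapFam, tr_mapFam, hS]
    have e1 : (cochar t * upper S' * cochar t' : BlockFam l _) = upper (t • S') := by
      rw [cochar_mul_upper, mul_assoc, cochar_mul, htt, cochar_one, mul_one]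
    have e2 : upper (t • S') = mapFam (ψ : R[X] →+* _) (upper XS) := by
      rw [mapFam_upper, hXS, mapFam_smul, ← hψX]
    have e3 : F.toFun _ (upper S') = Ψ (κ f) := by
      rw [hS', ← mapFam_upper, F.natural ψ, hcS]
      · rfl
      · exact isGSp_upper (by rw [tr_mapFam, hS])
    have e4 : scal (LaurentPolynomial R) P = Ψ (κ p) := by
      refine Matrix.ext fun a b => ?_
      change algebraMap k _ (P a b) = ψ (c (algebraMap k R (P a b)))
      rw [AlgHom.commutes, AlgHom.commutes]
    have := congrArg (F.toFun _) (e1.trans e2)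
    rw [F.mul ((isGSp_cochar hut).mul (isGSp_upper hS'')) (isGSp_cochar hut'),
      F.mul (isGSp_cochar hut) (isGSp_upper hS''), hP.cochar hut, hP.cochar hut',
      F.natural ψ (isGSp_upper hXS'), e3, e4, ← hM] at this
    apply hψm
    simp only [map_mul, map_add, map_sub, map_one]
    rw [hΨ, mapMatrix_smul, mapMatrix_smul, mapMatrix_smul, hψX, ← hΨ, map_sub, map_one]
    change t • M.map ψ = _
    rw [← this, ← Matrix.mul_smul]
    congr 1
    rw [smul_add, smul_smul, htt, one_smul]
  -- comparison of the coefficients of the powers of `X`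
  have h0 : (1 - p) * f * p = 0 := by
    have := congrArg (evalRingHom (0 : R)).mapMatrix key
    simp only [map_mul, map_add, map_sub, map_one, mapMatrix_smul, hevκ, coe_evalRingHom, eval_X,
      zero_smul, zero_add, add_zero] at this
    exact this.symm
  have h0' : (1 - κ p) * κ f * κ p = 0 := by
    rw [← map_one κ, ← map_sub, ← map_mul, ← map_mul, h0, map_zero]
  have key2 : M = κ ((1 - p) * f * (1 - p) + p * f * p) +
      (X : R[X]) • κ (p * f * (1 - p)) := by
    have : (X : R[X]) • M = (X : R[X]) • (κ ((1 - p) * f * (1 - p) + p * f * p) +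
      (X : R[X]) • κ (p * f * (1 - p))) := by
      rw [key]
      simp only [map_mul, map_add, map_sub, map_one, add_mul _ _ (κ f), add_mul _ _ (_ + _),
        mul_add, Matrix.smul_mul, Matrix.mul_smul, smul_add, h0']
      abel
    refine Matrix.ext fun a b => ?_
    have := congrFun (congrFun this a) b
    simp only [Matrix.smul_apply, smul_eq_mul] at this
    exact (isRegular_iff.mp isRegular_X).1 this
  have hev2 : ∀ s : R, F.toFun R (upper (s • S)) =
      (1 - p) * f * (1 - p) + p * f * p + s • (p * f * (1 - p)) := by
    intro s
    rw [← hev, key2, map_add, mapMatrix_smul, hevκ, hevκ, coe_evalRingHom, eval_X]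
  have := hev2 0
  rw [zero_smul, upper_zero, F.one, zero_smul, add_zero] at this
  rw [hev2, ← this]

end SimRep

end

section

variable {k : Type} [Field k] {ι : Type} {l : ι → Type}
  [∀ i, Fintype (l i)] [∀ i, DecidableEq (l i)] {n : Type} [Fintype n] [DecidableEq n]

/-! ### The operators of unipotent elements -/

namespace SimRep

variable (F : SimRep k l n) {P : Matrix n n k}

/-- The nilpotent part of the action of `upper S`. -/
def up {R : Type} [CommRing R] [Algebra k R] (S : MatFam l R) : Matrix n n R :=
  F.toFun R (upper S) - 1

/-- The nilpotent part of the action of `lower S`. -/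
def down {R : Type} [CommRing R] [Algebra k R] (S : MatFam l R) : Matrix n n R :=
  F.toFun R (lower S) - 1

variable {F} {R : Type} [CommRing R] [Algebra k R] {S T : MatFam l R}

theorem toFun_upper : F.toFun R (upper S) = 1 + F.up S := by simp [up]

theorem toFun_lower : F.toFun R (lower S) = 1 + F.down S := by simp [down]

theorem scal_idem (hP : F.HasWeights P) : scal R P * scal R P = scal R P := by
  rw [← map_mul, hP.idem]

theorem up_eq (hP : F.HasWeights P) (hS : tr S = S) :
    F.up S = scal R P * F.toFun R (upper S) * (1 - scal R P) := by
  have := toFun_upper_smul hP hS 1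
  rw [one_smul, one_smul, toFun_upper] at this
  rw [toFun_upper]
  exact add_left_cancel this

theorem up_smul (hP : F.HasWeights P) (hS : tr S = S) (r : R) : F.up (r • S) = r • F.up S := by
  rw [up, toFun_upper_smul hP hS, ← up_eq hP hS, add_sub_cancel_left]

theorem mul_up (hP : F.HasWeights P) (hS : tr S = S) : scal R P * F.up S = F.up S := by
  rw [up_eq hP hS, ← mul_assoc, ← mul_assoc, scal_idem hP]

theorem up_mul (hP : F.HasWeights P) (hS : tr S = S) : F.up S * scal R P = 0 := by
  rw [up_eq hP hS, mul_assoc, sub_mul, one_mul, scal_idem hP, sub_self, mul_zero]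

theorem up_mul_up (hP : F.HasWeights P) (hS : tr S = S) (hT : tr T = T) :
    F.up S * F.up T = 0 := by
  rw [← mul_up hP hT, ← mul_assoc, up_mul hP hS, zero_mul]

theorem up_add (hP : F.HasWeights P) (hS : tr S = S) (hT : tr T = T) :
    F.up (S + T) = F.up S + F.up T := by
  rw [up, ← upper_mul, F.mul (isGSp_upper hS) (isGSp_upper hT), toFun_upper, toFun_upper, add_mul,
    mul_add, mul_add, up_mul_up hP hS hT]
  simp only [one_mul, mul_one, add_zero]
  abel

theorem up_neg (hP : F.HasWeights P) (hS : tr S = S) : F.up (-S) = -F.up S := by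
  rw [← neg_one_smul R S, up_smul hP hS, neg_one_smul]

theorem up_mapFam {S : MatFam l k} (hS : tr S = S) :
    F.up (mapFam (algebraMap k R) S) = scal R (F.up S) := by
  rw [up, up, ← mapFam_upper, F.toFun_cst (isGSp_upper hS), map_sub, map_one]

theorem down_mapFam {S : MatFam l k} (hS : tr S = S) :
    F.down (mapFam (algebraMap k R) S) = scal R (F.down S) := by
  rw [down, down, ← mapFam_lower, F.toFun_cst (isGSp_lower hS), map_sub, map_one]

/-! ### Exchange of the two halves of a symplectic basis -/

theorem isGSp_weyl : IsGSp (blk 0 1 (-1) 0 : BlockFam l R) :=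
  ⟨1, isUnit_one, isSim_blk (by simp) (by simp) (by simp)⟩

theorem isGSp_weyl' : IsGSp (blk 0 (-1) 1 0 : BlockFam l R) :=
  ⟨1, isUnit_one, isSim_blk (by simp) (by simp) (by simp)⟩

theorem weyl_mul : (blk 0 1 (-1) 0 * blk 0 (-1) 1 0 : BlockFam l R) = 1 := by
  simp [blk_mul, blk_one]

theorem weyl_mul' : (blk 0 (-1) 1 0 * blk 0 1 (-1) 0 : BlockFam l R) = 1 := by
  simp [blk_mul, blk_one]

variable (F) in
/-- The representation composed with the inner automorphism that exchanges the two halves of a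
symplectic basis, and hence upper and lower unipotent families. -/
def swap : SimRep k l n where
  toFun R _ _ x := F.toFun R (blk 0 1 (-1) 0 * x * blk 0 (-1) 1 0)
  one R _ _ := by rw [mul_one, weyl_mul, F.one]
  mul {R} _ _ {x y} hx hy := by
    rw [← F.mul ((isGSp_weyl.mul hx).mul isGSp_weyl') ((isGSp_weyl.mul hy).mul isGSp_weyl')]
    congr 1
    calc _ = blk 0 1 (-1) 0 * x * 1 * y * blk 0 (-1) 1 0 := by rw [mul_one, mul_assoc _ x y]
      _ = _ := by rw [← weyl_mul']; simp only [mul_assoc]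
  natural φ x hx := by
    rw [← F.natural φ ((isGSp_weyl.mul hx).mul isGSp_weyl')]
    simp [mapFam_blk]

theorem swap_up : F.swap.up S = F.down (-S) := by
  have : (blk 0 1 (-1) 0 * upper S * blk 0 (-1) 1 0 : BlockFam l R) = lower (-S) := by
    simp [upper, lower, blk_mul]
  change F.toFun R (blk 0 1 (-1) 0 * upper S * blk 0 (-1) 1 0) - 1 = _
  rw [this, down]

theorem swap_down : F.swap.down S = F.up (-S) := by
  have : (blk 0 1 (-1) 0 * lower S * blk 0 (-1) 1 0 : BlockFam l R) = upper (-S) := by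
    simp [upper, lower, blk_mul]
  change F.toFun R (blk 0 1 (-1) 0 * lower S * blk 0 (-1) 1 0) - 1 = _
  rw [this, up]

theorem HasWeights.swap (hP : F.HasWeights P) : F.swap.HasWeights (1 - P) where
  idem := by rw [mul_sub, sub_mul, sub_mul, hP.idem]; simp
  cochar {R} _ _ t ht := by
    obtain ⟨t', h'⟩ := ht.exists_right_inv
    have ht' : IsUnit t' := IsUnit.of_mul_eq_one _ ((mul_comm _ _).trans h')
    have : (blk 0 1 (-1) 0 * PEL.cochar t * blk 0 (-1) 1 0 : BlockFam l R) =
        (t • 1) * PEL.cochar t' := by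
      rw [PEL.cochar, PEL.cochar, smul_mul_assoc, one_mul, blk_smul]
      simp [blk_mul, smul_smul, h']
    change F.toFun R (blk 0 1 (-1) 0 * PEL.cochar t * blk 0 (-1) 1 0) = _
    rw [this, F.mul (isGSp_smul_one ht) (isGSp_cochar ht'), hP.scalar ht, hP.cochar ht', map_sub,
      map_one, smul_mul_assoc, one_mul, smul_add, smul_smul, h', one_smul]
    abel
  scalar {R} _ _ t ht := by
    have : (blk 0 1 (-1) 0 * (t • 1) * blk 0 (-1) 1 0 : BlockFam l R) = t • 1 := by
      rw [mul_smul_comm, mul_one, smul_mul_assoc, weyl_mul]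
    change F.toFun R (blk 0 1 (-1) 0 * (t • 1) * blk 0 (-1) 1 0) = _
    rw [this, hP.scalar ht]

theorem mul_down (hP : F.HasWeights P) (hS : tr S = S) : scal R P * F.down S = 0 := by
  have := mul_up hP.swap (S := -S) (by simp [hS])
  rw [swap_up, neg_neg, map_sub, map_one, sub_mul, one_mul, sub_eq_self] at this
  exact this

theorem down_mul (hP : F.HasWeights P) (hS : tr S = S) : F.down S * scal R P = F.down S := by
  have := up_mul hP.swap (S := -S) (by simp [hS])
  rw [swap_up, neg_neg, map_sub, map_one, mul_sub, mul_one, sub_eq_zero] at this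
  exact this.symm

theorem down_smul (hP : F.HasWeights P) (hS : tr S = S) (r : R) :
    F.down (r • S) = r • F.down S := by
  have := up_smul hP.swap (S := -S) (by simp [hS]) r
  rwa [swap_up, swap_up, neg_neg, smul_neg, neg_neg] at this

/-! ### The quadratic relations between upper and lower unipotents -/

theorem toFun_levi_comm [CharZero k] (hP : F.HasWeights P) {A A' : MatFam l R} (h : A' * A = 1) :
    scal R P * F.toFun R (levi A A') = F.toFun R (levi A A') * scal R P := by
  have h2 : IsUnit (2 : R) := by
    have := (IsUnit.mk0 (2 : k) two_ne_zero).map (algebraMap k R)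
    rwa [map_ofNat] at this
  have := congrArg (F.toFun R) (cochar_mul_levi (2 : R) A A')
  rw [F.mul (isGSp_cochar h2) (isGSp_levi h), F.mul (isGSp_levi h) (isGSp_cochar h2),
    hP.cochar h2, two_smul, ← add_assoc, sub_add_cancel, add_mul, mul_add, one_mul, mul_one] at this
  exact add_left_cancel this

/-- The comparison, on the part `p * _ * (1 - p)`, of the two sides of a factorisation of a
product of an upper and a lower unipotent element. -/
theorem eq_of_factorisation {A : Type*} [Ring A] {p X X' Y Z : A} (hp : p * p = p)
    (hpX : p * X = X) (hXp : X * p = 0) (hpX' : p * X' = X') (hX'p : X' * p = 0)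
    (hpY : p * Y = 0) (hYp : Y * p = Y) (hZ : p * Z = Z * p) (hYX' : Y * X' = 0)
    (h : (1 + X) * (1 + Y) * (1 - X + X') = (1 + Y) * Z) : X * Y * X = X' := by
  have hXX : X * X = 0 := by
    calc X * X = X * (p * X) := by rw [hpX]
      _ = 0 := by rw [← mul_assoc, hXp, zero_mul]
  have hXX' : X * X' = 0 := by
    calc X * X' = X * (p * X') := by rw [hpX']
      _ = 0 := by rw [← mul_assoc, hXp, zero_mul]
  have h1 : p * ((1 + X) * (1 + Y) * (1 - X + X')) * (1 - p) = X' - X * Y * X := by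
    have : p * ((1 + X) * (1 + Y) * (1 - X + X')) = p + X' + X * Y - X * Y * X := by
      have e1 : p * ((1 + X) * (1 + Y)) = p + X + X * Y := by
        simp only [mul_add, add_mul, one_mul, mul_one, ← mul_assoc, hpX, hpY]
        abel
      rw [← mul_assoc, e1]
      simp only [mul_add, add_mul, mul_sub, mul_one, hpX, hpX', hXX, hXX', mul_assoc, hYX',
        mul_zero]
      abel
    rw [this]
    simp only [mul_sub, mul_one, sub_mul, add_mul, hp, hX'p, mul_assoc, hYp, hXp, mul_zero]
    abel
  have h2 : p * ((1 + Y) * Z) * (1 - p) = 0 := by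
    rw [add_mul, one_mul, mul_add, ← mul_assoc p Y, hpY, zero_mul, add_zero, hZ, mul_assoc, mul_sub,
      mul_one, hp, sub_self, mul_zero]
  rw [h, h2] at h1
  exact (sub_eq_zero.mp h1.symm).symm

/-- The quadratic relation in the Jordan pair of symmetric matrices. The proof compares
`upper S * lower (ε T)` over the dual numbers with its factorisation into a lower unipotent, a
block diagonal and an upper unipotent element. -/
theorem up_down_up [CharZero k] (hP : F.HasWeights P) {S T : MatFam l k} (hS : tr S = S)
    (hT : tr T = T) : F.up S * F.down T * F.up S = F.up (S * T * S) := by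
  set ε : DualNumber k := DualNumber.eps with hε
  have hεε : ε * ε = 0 := DualNumber.eps_mul_eps
  set a : k →+* DualNumber k := algebraMap k (DualNumber k) with ha
  set S₁ := mapFam a S with hS₁
  set T₁ := mapFam a T with hT₁
  have hS₁' : tr S₁ = S₁ := by rw [hS₁, tr_mapFam, hS]
  have hT₁' : tr T₁ = T₁ := by rw [hT₁, tr_mapFam, hT]
  have hSTS : tr (S * T * S) = S * T * S := by simp [hS, hT, mul_assoc]
  have hSTS₁ : tr (S₁ * T₁ * S₁) = S₁ * T₁ * S₁ := by simp [hS₁', hT₁', mul_assoc]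
  have hinv : (1 - ε • (S₁ * T₁)) * (1 + ε • (S₁ * T₁)) = 1 := by
    simp only [sub_mul, mul_add, one_mul, mul_one, smul_mul_smul_comm, hεε, zero_smul]
    abel
  have hfac : upper S₁ * lower (ε • T₁) * upper (-S₁ + ε • (S₁ * T₁ * S₁)) =
      lower (ε • T₁) * levi (1 + ε • (S₁ * T₁)) (1 - ε • (S₁ * T₁)) := by
    simp only [upper, lower, levi, blk_mul, tr_sub, tr_one, tr_smul, tr_mul, hS₁', hT₁', mul_zero,
      mul_one, one_mul, zero_mul, zero_add, add_zero, mul_add, add_mul, mul_neg, mul_smul_comm,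
      smul_mul_assoc, smul_add, smul_smul, hεε, zero_smul, mul_assoc]
    congr 1
    · abel
    · abel
  have hsymm1 : tr (ε • T₁) = ε • T₁ := by rw [tr_smul, hT₁']
  have hsymm2 : tr (ε • (S₁ * T₁ * S₁)) = ε • (S₁ * T₁ * S₁) := by rw [tr_smul, hSTS₁]
  have hsymm3 : tr (-S₁) = -S₁ := by rw [tr_neg, hS₁']
  have := congrArg (F.toFun _) hfac
  rw [F.mul ((isGSp_upper hS₁').mul (isGSp_lower hsymm1)) (isGSp_upper (by
      rw [tr_add, hsymm2, hsymm3])), F.mul (isGSp_upper hS₁') (isGSp_lower hsymm1),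
    F.mul (isGSp_lower hsymm1) (isGSp_levi hinv), toFun_upper, toFun_upper, toFun_lower,
    up_add hP hsymm3 hsymm2, up_neg hP hS₁', ← add_assoc, ← sub_eq_add_neg] at this
  have := eq_of_factorisation (scal_idem hP) (mul_up hP hS₁') (up_mul hP hS₁') (mul_up hP hsymm2)
    (up_mul hP hsymm2) (mul_down hP hsymm1) (down_mul hP hsymm1) (toFun_levi_comm hP hinv)
    (by rw [down_smul hP hT₁', up_smul hP hSTS₁, smul_mul_smul_comm, hεε, zero_smul]) this
  rw [down_smul hP hT₁', up_smul hP hSTS₁, hS₁, hT₁, ← map_mul, ← map_mul, up_mapFam hS,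
    down_mapFam hT, up_mapFam hSTS, mul_smul_comm, smul_mul_assoc, ← map_mul, ← map_mul] at this
  refine Matrix.ext fun i j => ?_
  have := congrArg TrivSqZeroExt.snd (congrFun (congrFun this i) j)
  have h : ∀ A : Matrix n n k,
      TrivSqZeroExt.snd ((ε • scal (DualNumber k) A) i j) = A i j := fun A => by
    simp [hε]
    rfl
  rwa [h, h] at this

/-- `upper 1`, `lower 1` and the block scalar matrices generate a copy of `SL₂`, the torus of
which acts without the weight `0`. -/
theorem up_one_mul_down_one [CharZero k] (hP : F.HasWeights P) :
    F.up (1 : MatFam l k) * F.down 1 = P := by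
  have h1 : tr (1 : MatFam l k) = 1 := tr_one
  have h1' : tr ((-(1 / 2) : k) • (1 : MatFam l k)) = (-(1 / 2) : k) • 1 := by simp
  have h1'' : tr (((1 / 2) : k) • (1 : MatFam l k)) = ((1 / 2) : k) • 1 := by simp
  have hsc : IsUnit (1 / 2 : k) := IsUnit.mk0 _ (by norm_num)
  have h4 : IsUnit (4 : k) := IsUnit.mk0 _ (by norm_num)
  -- for `t = 2`, the torus element `diag(t, 1 / t)` of `SL₂` is `(1 / 2) • cochar 4`
  have hfac : (upper 1 * lower 1 * upper ((-(1 / 2) : k) • 1) : BlockFam l k) =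
      lower ((1 / 2 : k) • 1) * ((1 / 2 : k) • 1 * cochar 4) := by
    have e1 : (1 + 1 : MatFam l k) = (2 : k) • 1 := by rw [two_smul]
    simp only [upper, lower, cochar, blk_mul, smul_mul_assoc, one_mul, blk_smul, mul_one, mul_zero,
      add_zero, zero_add, smul_zero, smul_smul, mul_smul_comm, e1]
    have e2 : (-(1 / 2) * 2 : k) • (1 : MatFam l k) + 1 = 0 := by norm_num
    have e3 : (-(1 / 2) : k) • (1 : MatFam l k) + 1 = (1 / 2 : k) • 1 := by
      calc _ = (-(1 / 2) : k) • (1 : MatFam l k) + (1 : k) • 1 := by rw [one_smul]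
        _ = _ := by rw [← add_smul]; norm_num
    rw [e2, e3]
    norm_num
  have := congrArg (F.toFun _) hfac
  rw [F.mul ((isGSp_upper h1).mul (isGSp_lower h1)) (isGSp_upper h1'),
    F.mul (isGSp_upper h1) (isGSp_lower h1), F.mul (isGSp_lower h1'')
      ((isGSp_smul_one hsc).mul (isGSp_cochar h4)),
    F.mul (isGSp_smul_one hsc) (isGSp_cochar h4), toFun_upper, toFun_upper, toFun_lower,
    toFun_lower,
    up_smul hP h1, down_smul hP h1, hP.scalar hsc, hP.cochar h4] at this
  have hs : scal k P = P := by ext; simp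
  have hUp := up_mul hP h1
  have hpU := mul_up hP h1
  have hDp := down_mul hP h1
  have hpD := mul_down hP h1
  rw [hs] at this hUp hpU hDp hpD
  have := congrArg (fun A => P * A * P) this
  simp only [mul_add, add_mul, mul_one, one_mul, mul_smul_comm, smul_mul_assoc, ← mul_assoc, hpU,
    hpD, mul_sub, sub_mul] at this
  simp only [mul_assoc, hDp, hUp, hP.idem, mul_zero, smul_zero, add_zero, zero_mul,
    sub_self] at this
  have e : (4 : k) • (1 / 2 : k) • P = P + P := by
    rw [smul_smul, ← two_smul k]; norm_num
  simp only [e, zero_add] at this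
  exact add_left_cancel this

theorem down_one_mul_up_one [CharZero k] (hP : F.HasWeights P) :
    F.down (1 : MatFam l k) * F.up 1 = 1 - P := by
  have := up_one_mul_down_one hP.swap
  have h1 : tr (1 : MatFam l k) = 1 := tr_one
  rw [swap_up, swap_down, up_neg hP h1, ← neg_one_smul k (1 : MatFam l k), down_smul hP h1,
    neg_one_smul, neg_mul_neg] at this
  exact this

end SimRep

end

section

/-! ### Matrix units -/

section MatrixUnits

variable {ι : Type} [Fintype ι] [DecidableEq ι] {m : ι → Type} [∀ i, Fintype (m i)]
  [∀ i, DecidableEq (m i)] {A : Type} [Ring A]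

/-- A family of matrix units in a ring, as in a product of matrix rings. The sum of the diagonal
ones need not be `1`. -/
structure IsMatrixUnits (u : ∀ i, m i → m i → A) : Prop where
  mul_same : ∀ i a b c, u i a b * u i b c = u i a c
  mul_ne : ∀ i a b c d, b ≠ c → u i a b * u i c d = 0
  mul_block : ∀ i j, i ≠ j → ∀ a b c d, u i a b * u j c d = 0

variable (R : Type) [CommRing R] [Algebra R A]

/-- The linear map from families of matrices that takes the standard matrix units to `u`. -/
def unitsLin (u : ∀ i, m i → m i → A) : MatFam m R →ₗ[R] A where
  toFun x := ∑ i, ∑ a, ∑ b, x i a b • u i a b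
  map_add' x y := by simp [add_smul, Finset.sum_add_distrib]
  map_smul' r x := by simp [mul_smul, Finset.smul_sum]

variable {R}

theorem unitsLin_apply (u : ∀ i, m i → m i → A) (x : MatFam m R) :
    unitsLin R u x = ∑ i, ∑ a, ∑ b, x i a b • u i a b := rfl

theorem unitsLin_one (u : ∀ i, m i → m i → A) :
    unitsLin R u 1 = ∑ i, ∑ a, u i a a := by
  simp [unitsLin_apply, Matrix.one_apply]

theorem unitsLin_mul {u : ∀ i, m i → m i → A} (hu : IsMatrixUnits u) (x y : MatFam m R) :
    unitsLin R u (x * y) = unitsLin R u x * unitsLin R u y := by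
  have h1 : ∀ i j, i ≠ j → (∑ a, ∑ b, x i a b • u i a b) * (∑ a, ∑ b, y j a b • u j a b) = 0 := by
    intro i j hij
    simp [Finset.sum_mul, Finset.mul_sum, hu.mul_block i j hij]
  have h2 : ∀ i, (∑ a, ∑ b, x i a b • u i a b) * (∑ a, ∑ b, y i a b • u i a b) =
      ∑ a, ∑ b, (x i * y i) a b • u i a b := by
    intro i
    have h3 : ∀ a b, (x i a b • u i a b) * (∑ c, ∑ d, y i c d • u i c d) =
        ∑ d, (x i a b * y i b d) • u i a d := by
      intro a b
      rw [Finset.mul_sum, Finset.sum_eq_single b]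
      · simp [Finset.mul_sum, hu.mul_same, smul_smul]
        refine Finset.sum_congr rfl fun d _ => by rw [mul_comm]
      · intro c _ hc
        simp [Finset.mul_sum, hu.mul_ne i a b c _ hc.symm]
      · simp
    simp only [Finset.sum_mul, h3, Matrix.mul_apply, Finset.sum_smul]
    refine Finset.sum_congr rfl fun a _ => Finset.sum_comm
  simp only [unitsLin_apply]
  rw [Finset.sum_mul]
  refine Finset.sum_congr rfl fun i _ => ?_
  rw [Finset.mul_sum, Finset.sum_eq_single i (fun j _ hj => h1 i j hj.symm) (by simp), h2]
  rfl

/-- The standard matrix unit in a family of matrices. -/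
def unitFam (R : Type) [CommRing R] (i : ι) (a b : m i) : MatFam m R :=
  Pi.single i (Matrix.single a b 1)

theorem unitFam_same_mul (i : ι) (a b c d : m i) :
    unitFam R i a b * unitFam R i c d = if b = c then unitFam R i a d else 0 := by
  rw [unitFam, unitFam, ← Pi.single_mul]
  split_ifs with h
  · subst h; simp [unitFam]
  · simp [Matrix.single_mul_single_of_ne _ _ _ _ h]

theorem unitFam_mul_block {i j : ι} (h : i ≠ j) (a b : m i) (c d : m j) (x : MatFam m R) :
    unitFam R i a b * x * unitFam R j c d = 0 := by
  funext t
  rcases eq_or_ne t i with rfl | ht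
  · simp [unitFam, Pi.single_eq_of_ne h]
  · simp [unitFam, Pi.single_eq_of_ne ht]

theorem unitFam_mul_mul (i : ι) (a b c d : m i) (x : MatFam m R) :
    unitFam R i a b * x * unitFam R i c d = x i b c • unitFam R i a d := by
  funext t
  rcases eq_or_ne t i with rfl | ht
  · simp [unitFam, Matrix.smul_single]
  · simp [unitFam, Pi.single_eq_of_ne ht]

theorem tr_unitFam (i : ι) (a b : m i) : tr (unitFam R i a b) = unitFam R i b a := by
  funext t
  rcases eq_or_ne t i with rfl | ht
  · simp [unitFam]
  · simp [unitFam, Pi.single_eq_of_ne ht]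

theorem mapFam_unitFam {S : Type} [CommRing S] (φ : R →+* S) (i : ι) (a b : m i) :
    mapFam φ (unitFam R i a b) = unitFam S i a b := by
  funext t
  rcases eq_or_ne t i with rfl | ht
  · ext c d; simp [unitFam, Matrix.single_apply]
  · simp [unitFam, Pi.single_eq_of_ne ht]

theorem sum_unitFam : ∑ i, ∑ a, unitFam R i a a = (1 : MatFam m R) := by
  funext t
  rw [Finset.sum_apply, Finset.sum_eq_single t]
  · ext c d
    rw [Finset.sum_apply, Matrix.sum_apply, Finset.sum_eq_single c]
    · simp [unitFam, Matrix.single_apply, Matrix.one_apply]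
    · intro b _ hb
      simp [unitFam, hb]
    · simp
  · intro i _ hi
    simp [unitFam, Pi.single_eq_of_ne hi.symm]
  · simp

theorem mul_unitFam (x : MatFam m R) (i : ι) (a b : m i) :
    x * unitFam R i a b = ∑ a', x i a' a • unitFam R i a' b := by
  funext j
  rw [Finset.sum_apply]
  rcases eq_or_ne j i with rfl | hj
  · ext s t
    simp [unitFam, Matrix.sum_apply, Matrix.mul_apply, Matrix.single_apply, ite_and]
  · simp [unitFam, Pi.single_eq_of_ne hj]

theorem unitFam_mul (x : MatFam m R) (i : ι) (b a : m i) :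
    unitFam R i b a * x = ∑ a', x i a a' • unitFam R i b a' := by
  funext j
  rw [Finset.sum_apply]
  rcases eq_or_ne j i with rfl | hj
  · ext s t
    simp [unitFam, Matrix.sum_apply, Matrix.mul_apply, Matrix.single_apply, ite_and]
  · simp [unitFam, Pi.single_eq_of_ne hj]

theorem unitsLin_unitFam (u : ∀ i, m i → m i → A) (i : ι) (a b : m i) :
    unitsLin R u (unitFam R i a b) = u i a b := by
  rw [unitsLin_apply, Finset.sum_eq_single i]
  · simp only [unitFam, Pi.single_eq_same, Matrix.single_apply]
    rw [Finset.sum_eq_single a, Finset.sum_eq_single b] <;> simp +contextual [eq_comm]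
  · intro j _ hj
    simp [unitFam, Pi.single_eq_of_ne hj]
  · simp

theorem linearMap_ext_unitFam {M : Type*} [AddCommGroup M] [Module R M] {f g : MatFam m R →ₗ[R] M}
    (h : ∀ i a b, f (unitFam R i a b) = g (unitFam R i a b)) : f = g := by
  refine LinearMap.pi_ext' fun i => Matrix.ext_linearMap R fun a b => LinearMap.ext_ring ?_
  exact h i a b

end MatrixUnits

/-! ### Jordan homomorphisms from symmetric matrices -/

section Jordan

variable {k : Type} [Field k] {ι : Type} [Fintype ι] [DecidableEq ι] {l : ι → Type}
  [∀ i, Fintype (l i)] [∀ i, DecidableEq (l i)] {A : Type} [Ring A] [Algebra k A]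

/-- The linear map `a` is, on families of symmetric matrices, a homomorphism of Jordan algebras
into a ring, `a 1` being neutral for the image. -/
structure IsJordanHom (a : MatFam l k →ₗ[k] A) : Prop where
  unit_left : ∀ S, tr S = S → a 1 * a S = a S
  unit_right : ∀ S, tr S = S → a S * a 1 = a S
  quad : ∀ S T, tr S = S → tr T = T → a (S * T * S) = a S * a T * a S

/-- The family of matrices that vanishes off `i` and has all entries of index `i` equal to `1`. -/
def onesFam (k : Type) [Field k] (l : ι → Type) (i : ι) : MatFam l k :=
  Pi.single i (Matrix.of fun _ _ => 1)

theorem tr_onesFam (i : ι) : tr (onesFam k l i) = onesFam k l i := by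
  funext t
  rcases eq_or_ne t i with rfl | ht
  · ext; simp [onesFam]
  · simp [onesFam, Pi.single_eq_of_ne ht]

theorem onesFam_mul_unitFam_mul_onesFam (i : ι) (a : l i) :
    onesFam k l i * unitFam k i a a * onesFam k l i = onesFam k l i := by
  rw [onesFam, unitFam, ← Pi.single_mul, ← Pi.single_mul]
  congr 1
  ext c d
  rw [Matrix.mul_apply, Finset.sum_eq_single a, Matrix.mul_apply, Finset.sum_eq_single a]
  · simp
  · intro b _ hb
    simp [hb.symm]
  · simp
  · intro b _ hb
    simp [Matrix.mul_apply, hb.symm]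
  · simp

/-- The matrix units determined by a Jordan homomorphism on symmetric matrices: the Peirce
components of the image of the matrix all of whose entries are `1`. -/
def jordanUnit (a : MatFam l k →ₗ[k] A) (i : ι) (b c : l i) : A :=
  a (unitFam k i b b) * a (onesFam k l i) * a (unitFam k i c c)

variable {a : MatFam l k →ₗ[k] A}

theorem IsJordanHom.polar (ha : IsJordanHom a) {S S' T : MatFam l k} (hS : tr S = S)
    (hS' : tr S' = S') (hT : tr T = T) :
    a S * a T * a S' + a S' * a T * a S = a (S * T * S' + S' * T * S) := by
  have h := ha.quad (S + S') T (by rw [tr_add, hS, hS']) hT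
  simp only [map_add, add_mul, mul_add, ha.quad S T hS hT, ha.quad S' T hS' hT] at h
  rw [map_add]
  have h' := sub_eq_zero.mpr h
  rw [← sub_eq_zero]
  rw [← neg_eq_zero, ← h']
  abel

theorem IsJordanHom.unit_idem (ha : IsJordanHom a) (i : ι) (b : l i) :
    a (unitFam k i b b) * a (unitFam k i b b) = a (unitFam k i b b) := by
  have h := ha.quad (unitFam k i b b) 1 (tr_unitFam i b b) tr_one
  rw [mul_one, unitFam_same_mul, if_pos rfl, ha.unit_right _ (tr_unitFam i b b)] at h
  exact h.symm

/-- The Peirce components of the image of a symmetric matrix are controlled by polarisation. -/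
theorem IsJordanHom.peirce (ha : IsJordanHom a) {E E' : MatFam l k} (hE : tr E = E)
    (hE' : tr E' = E') (hi : a E * a E = a E) (ho : a E * a E' = 0) {S : MatFam l k}
    (hS : tr S = S) : a E * a S * a E' = a E * a (E * S * E' + E' * S * E) := by
  rw [← ha.polar hE hE' hS, mul_add, ← mul_assoc, ← mul_assoc, ← mul_assoc, ← mul_assoc, hi, ho,
    zero_mul, zero_mul, add_zero]

theorem IsJordanHom.orthogonal (ha : IsJordanHom a) {E E' : MatFam l k} (hE : tr E = E)
    (hE' : tr E' = E') (hi : a E * a E = a E) (h : E * E' = 0) (h' : E' * E = 0) :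
    a E * a E' = 0 := by
  have h1 := ha.polar hE hE' (tr_one (m := l))
  rw [ha.unit_right E hE, ha.unit_right E' hE', mul_one, mul_one, h, h', add_zero, map_zero] at h1
  have h2 := ha.quad E E' hE hE'
  rw [h, zero_mul, map_zero] at h2
  have h3 := congrArg (a E * ·) h1
  simp only [mul_add, ← mul_assoc, hi, ← h2, mul_zero, add_zero] at h3
  exact h3

theorem IsJordanHom.unit_mul_unit_ne (ha : IsJordanHom a) (i : ι) {b c : l i} (h : b ≠ c) :
    a (unitFam k i b b) * a (unitFam k i c c) = 0 :=
  ha.orthogonal (tr_unitFam i b b) (tr_unitFam i c c) (ha.unit_idem i b)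
    (by rw [unitFam_same_mul, if_neg h]) (by rw [unitFam_same_mul, if_neg h.symm])

theorem IsJordanHom.unit_mul_unit_block (ha : IsJordanHom a) {i j : ι} (h : i ≠ j) (b : l i)
    (c : l j) : a (unitFam k i b b) * a (unitFam k j c c) = 0 :=
  ha.orthogonal (tr_unitFam i b b) (tr_unitFam j c c) (ha.unit_idem i b)
    (by simpa using unitFam_mul_block h b b c c (1 : MatFam l k))
    (by simpa using unitFam_mul_block h.symm c c b b (1 : MatFam l k))

theorem IsJordanHom.unit_mul_mul_unit (ha : IsJordanHom a) (i : ι) (b c : l i) {S : MatFam l k}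
    (hS : tr S = S) :
    a (unitFam k i b b) * a S * a (unitFam k i c c) = S i b c • jordanUnit a i b c := by
  have ho : onesFam k l i i b c = 1 := by simp [onesFam]
  have hoc : onesFam k l i i c b = 1 := by simp [onesFam]
  rcases eq_or_ne b c with rfl | h
  · rw [jordanUnit, ← ha.quad _ _ (tr_unitFam i b b) hS,
      ← ha.quad _ _ (tr_unitFam i b b) (tr_onesFam i), unitFam_mul_mul, unitFam_mul_mul, ho,
      one_smul, map_smul]
  · have hs : S i c b = S i b c := by
      conv_rhs => rw [← hS]
      rfl
    have hp := fun {T : MatFam l k} (hT : tr T = T) =>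
      ha.peirce (tr_unitFam i b b) (tr_unitFam i c c) (ha.unit_idem i b)
        (ha.unit_mul_unit_ne i h) hT
    rw [jordanUnit, hp hS, hp (tr_onesFam i)]
    simp only [unitFam_mul_mul, ho, hoc, one_smul, hs]
    rw [← smul_add, map_smul, mul_smul_comm]

theorem IsJordanHom.unit_mul_mul_block (ha : IsJordanHom a) {i j : ι} (h : i ≠ j) (b : l i)
    (c : l j) {S : MatFam l k} (hS : tr S = S) :
    a (unitFam k i b b) * a S * a (unitFam k j c c) = 0 := by
  rw [ha.peirce (tr_unitFam i b b) (tr_unitFam j c c) (ha.unit_idem i b)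
    (ha.unit_mul_unit_block h b c) hS, unitFam_mul_block h, unitFam_mul_block h.symm, add_zero,
    map_zero, mul_zero]

/-- The products follow the rule for matrix units because the matrix `J` with all entries equal
to `1` satisfies `J * E * J = J` for each diagonal matrix unit `E`. -/
theorem IsJordanHom.isMatrixUnits (ha : IsJordanHom a) : IsMatrixUnits (jordanUnit a) where
  mul_same i b c d := by
    have : jordanUnit a i b c * jordanUnit a i c d = a (unitFam k i b b) *
        (a (onesFam k l i) * (a (unitFam k i c c) * a (unitFam k i c c)) * a (onesFam k l i)) *
          a (unitFam k i d d) := by simp only [jordanUnit, mul_assoc]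
    rw [this, ha.unit_idem, ← ha.quad _ _ (tr_onesFam i) (tr_unitFam i c c),
      onesFam_mul_unitFam_mul_onesFam, jordanUnit]
  mul_ne i b c d e h := by
    have : jordanUnit a i b c * jordanUnit a i d e = a (unitFam k i b b) * a (onesFam k l i) *
        (a (unitFam k i c c) * a (unitFam k i d d)) *
          (a (onesFam k l i) * a (unitFam k i e e)) := by
      simp only [jordanUnit, mul_assoc]
    rw [this, ha.unit_mul_unit_ne i h, mul_zero, zero_mul]
  mul_block i j h b c d e := by
    have : jordanUnit a i b c * jordanUnit a j d e = a (unitFam k i b b) * a (onesFam k l i) *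
        (a (unitFam k i c c) * a (unitFam k j d d)) *
          (a (onesFam k l j) * a (unitFam k j e e)) := by
      simp only [jordanUnit, mul_assoc]
    rw [this, ha.unit_mul_unit_block h, mul_zero, zero_mul]

theorem IsJordanHom.apply_eq (ha : IsJordanHom a) {S : MatFam l k} (hS : tr S = S) :
    a S = unitsLin k (jordanUnit a) S := by
  have h1 : a S = a 1 * a S * a 1 := by rw [ha.unit_left S hS, ha.unit_right S hS]
  rw [h1, ← sum_unitFam]
  simp only [map_sum, Finset.sum_mul, unitsLin_apply]
  refine Finset.sum_congr rfl fun i _ => Finset.sum_congr rfl fun b _ => ?_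
  rw [Finset.mul_sum, Finset.sum_eq_single i]
  · rw [Finset.mul_sum]
    exact Finset.sum_congr rfl fun c _ => ha.unit_mul_mul_unit i b c hS
  · intro j _ hj
    rw [Finset.mul_sum]
    exact Finset.sum_eq_zero fun c _ => ha.unit_mul_mul_block hj.symm b c hS
  · simp

end Jordan

end

section

/-! ### The linear extension of a representation with weights `0` and `1` -/

variable {k : Type} [Field k] {ι : Type} [Fintype ι] [DecidableEq ι] {l : ι → Type}
  [∀ i, Fintype (l i)] [∀ i, DecidableEq (l i)] {n : Type} [Fintype n] [DecidableEq n]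

/-- Two linear maps on families of matrices over `R` agree if they do so on families over `k`. -/
theorem linearMap_ext_scalars {R : Type} [CommRing R] [Algebra k R] {M : Type*} [AddCommGroup M]
    [Module R M] {f g : MatFam l R →ₗ[R] M}
    (h : ∀ S : MatFam l k, f (mapFam (algebraMap k R) S) = g (mapFam (algebraMap k R) S)) :
    f = g :=
  linearMap_ext_unitFam fun i a b => by simpa only [mapFam_unitFam] using h (unitFam k i a b)

theorem unitsLin_mapFam {R : Type} [CommRing R] [Algebra k R] {m : ι → Type} [∀ i, Fintype (m i)]
    [∀ i, DecidableEq (m i)] (u : ∀ i, m i → m i → Matrix n n k) (x : MatFam m k) :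
    unitsLin R (fun i a b => scal R (u i a b)) (mapFam (algebraMap k R) x) =
      scal R (unitsLin k u x) := by
  simp only [unitsLin_apply, map_sum, mapFam_apply, Matrix.map_apply, SimRep.mapMatrix_smul]

namespace SimRep

variable {F : SimRep k l n} {P : Matrix n n k}

variable (k) in
/-- The symmetric part of a family of matrices. -/
def symLin (R : Type) [CommRing R] [Algebra k R] : MatFam l R →ₗ[R] MatFam l R :=
  algebraMap k R 2⁻¹ • (LinearMap.id + ⟨⟨tr, tr_add⟩, tr_smul⟩)

theorem symLin_apply {R : Type} [CommRing R] [Algebra k R] (S : MatFam l R) :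
    symLin k R S = algebraMap k R 2⁻¹ • (S + tr S) := rfl

theorem tr_symLin {R : Type} [CommRing R] [Algebra k R] (S : MatFam l R) :
    tr (symLin k R S) = symLin k R S := by
  rw [symLin_apply, tr_smul, tr_add, tr_tr, add_comm]

theorem symLin_of_tr [CharZero k] {R : Type} [CommRing R] [Algebra k R] {S : MatFam l R}
    (hS : tr S = S) : symLin k R S = S := by
  rw [symLin_apply, hS, ← two_smul R S, smul_smul, ← map_ofNat (algebraMap k R) 2, ← map_mul,
    inv_mul_cancel₀ two_ne_zero, map_one, one_smul]

theorem symLin_mapFam {R : Type} [CommRing R] [Algebra k R] (S : MatFam l k) :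
    symLin k R (mapFam (algebraMap k R) S) = mapFam (algebraMap k R) (symLin k k S) := by
  rw [symLin_apply, symLin_apply, mapFam_smul, map_add, tr_mapFam]
  rfl

/-- The linear extension of `up` to families of matrices that need not be symmetric. -/
def upLin (hP : F.HasWeights P) (R : Type) [CommRing R] [Algebra k R] :
    MatFam l R →ₗ[R] Matrix n n R where
  toFun S := F.up (symLin k R S)
  map_add' S T := by rw [map_add, up_add hP (tr_symLin S) (tr_symLin T)]
  map_smul' r S := by rw [map_smul, up_smul hP (tr_symLin S), RingHom.id_apply]

theorem upLin_eq (hP : F.HasWeights P) {R : Type} [CommRing R] [Algebra k R] (S : MatFam l R) :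
    upLin hP R S = F.up (symLin k R S) := rfl

theorem upLin_apply [CharZero k] (hP : F.HasWeights P) {R : Type} [CommRing R] [Algebra k R]
    {S : MatFam l R} (hS : tr S = S) : upLin hP R S = F.up S := by
  rw [upLin_eq, symLin_of_tr hS]

theorem upLin_mapFam (hP : F.HasWeights P) (R : Type) [CommRing R] [Algebra k R]
    (S : MatFam l k) : upLin hP R (mapFam (algebraMap k R) S) = scal R (upLin hP k S) := by
  rw [upLin_eq, upLin_eq, symLin_mapFam, up_mapFam (tr_symLin S)]

/-- The linear map `S ↦ up S * down 1`, with values in the block of weight `1`. -/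
def jordanMap (hP : F.HasWeights P) : MatFam l k →ₗ[k] Matrix n n k :=
  (LinearMap.mulRight k (F.down 1)) ∘ₗ upLin hP k

theorem scal_self (A : Matrix n n k) : scal k A = A := by ext; simp

variable [CharZero k] (hP : F.HasWeights P)

include hP

theorem jordanMap_apply {S : MatFam l k} (hS : tr S = S) :
    jordanMap hP S = F.up S * F.down 1 := by
  simp [jordanMap, upLin_apply hP hS]

theorem jordanMap_one : jordanMap hP 1 = P := by
  rw [jordanMap_apply hP tr_one, up_one_mul_down_one hP]

theorem jordanMap_mul_up {S : MatFam l k} (hS : tr S = S) :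
    jordanMap hP S * F.up 1 = F.up S := by
  have := up_mul hP hS
  rw [scal_self] at this
  rw [jordanMap_apply hP hS, mul_assoc, down_one_mul_up_one hP, mul_sub, mul_one, this, sub_zero]

theorem up_mul_down {S : MatFam l k} (hS : tr S = S) :
    F.up 1 * F.down S = jordanMap hP S := by
  have h := up_down_up hP (tr_one (m := l)) hS
  have h' := down_mul hP hS
  rw [scal_self] at h'
  rw [one_mul, mul_one] at h
  rw [jordanMap_apply hP hS, ← h, mul_assoc, up_one_mul_down_one hP, mul_assoc, h']

theorem down_mul_jordanMap {S : MatFam l k} (hS : tr S = S) :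
    F.down 1 * jordanMap hP S = F.down S := by
  have := mul_down hP hS
  rw [scal_self] at this
  rw [← up_mul_down hP hS, ← mul_assoc, down_one_mul_up_one hP, sub_mul, one_mul, this, sub_zero]

theorem isJordanHom_jordanMap : IsJordanHom (jordanMap hP) where
  unit_left S hS := by
    have := mul_up hP hS
    rw [scal_self] at this
    rw [jordanMap_one hP, jordanMap_apply hP hS, ← mul_assoc, this]
  unit_right S hS := by
    have := down_mul hP (tr_one (m := l) (R := k))
    rw [scal_self] at this
    rw [jordanMap_one hP, jordanMap_apply hP hS, mul_assoc, this]
  quad S T hS hT := by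
    have h : tr (S * T * S) = S * T * S := by simp [hS, hT, mul_assoc]
    rw [jordanMap_apply hP h, ← up_down_up hP hS hT, ← up_mul_down hP hT, ← jordanMap_mul_up hP hS]
    have e1 : jordanMap hP S * P = jordanMap hP S := by
      have := down_mul hP (tr_one (m := l) (R := k))
      rw [scal_self] at this
      rw [jordanMap_apply hP hS, mul_assoc, this]
    have e2 : jordanMap hP S * F.up 1 * F.down T * (jordanMap hP S * F.up 1) * F.down 1 =
        jordanMap hP S * (F.up 1 * F.down T) * (jordanMap hP S * (F.up 1 * F.down 1)) := by
      simp only [mul_assoc]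
    rw [e2, up_one_mul_down_one hP, e1]

/-- The matrix units in the representation space that correspond to the standard matrix units of
families of block matrices. The blocks off the diagonal are moved into the block of weight `1` by
`up 1` and `down 1`, which are mutually inverse isomorphisms of the parts of weight `0` and `1`. -/
def units (i : ι) (a b : l i ⊕ l i) : Matrix n n k :=
  Sum.elim (fun _ => 1) (fun _ => F.down 1) a *
    jordanUnit (jordanMap hP) i (Sum.elim id id a) (Sum.elim id id b) *
      Sum.elim (fun _ => 1) (fun _ => F.up 1) b

theorem P_mul_jordanUnit (i : ι) (a b : l i) :
    P * jordanUnit (jordanMap hP) i a b = jordanUnit (jordanMap hP) i a b := by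
  rw [jordanUnit, ← mul_assoc, ← mul_assoc]
  congr 2
  have := (isJordanHom_jordanMap hP).unit_left _ (tr_unitFam i a a)
  rwa [jordanMap_one hP] at this

theorem jordanUnit_mul_P (i : ι) (a b : l i) :
    jordanUnit (jordanMap hP) i a b * P = jordanUnit (jordanMap hP) i a b := by
  rw [jordanUnit, mul_assoc]
  congr 1
  have := (isJordanHom_jordanMap hP).unit_right _ (tr_unitFam i b b)
  rwa [jordanMap_one hP] at this

/-- The inner factors in a product of two of the matrix units. -/
theorem units_middle {i j : ι} (b : l i ⊕ l i) (c : l j ⊕ l j) :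
    P * (Sum.elim (fun _ => 1) (fun _ => F.up 1) b *
        Sum.elim (fun _ => (1 : Matrix n n k)) (fun _ => F.down 1) c) * P =
      if b.isLeft = c.isLeft then P else 0 := by
  have h1 := mul_down hP (tr_one (m := l) (R := k))
  have h2 := up_mul hP (tr_one (m := l) (R := k))
  rw [scal_self] at h1 h2
  rcases b with b | b <;> rcases c with c | c
  · simp [hP.idem]
  · simp [h1]
  · simp [mul_assoc, h2]
  · simp [up_one_mul_down_one hP, hP.idem]

theorem units_mul {i j : ι} (a b : l i ⊕ l i) (c d : l j ⊕ l j) :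
    units hP i a b * units hP j c d = if b.isLeft = c.isLeft then
      Sum.elim (fun _ => 1) (fun _ => F.down 1) a *
        (jordanUnit (jordanMap hP) i (Sum.elim id id a) (Sum.elim id id b) *
          jordanUnit (jordanMap hP) j (Sum.elim id id c) (Sum.elim id id d)) *
        Sum.elim (fun _ => 1) (fun _ => F.up 1) d else 0 := by
  have : units hP i a b * units hP j c d = Sum.elim (fun _ => 1) (fun _ => F.down 1) a *
      (jordanUnit (jordanMap hP) i (Sum.elim id id a) (Sum.elim id id b) *
        (P * (Sum.elim (fun _ => 1) (fun _ => F.up 1) b *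
        Sum.elim (fun _ => 1) (fun _ => F.down 1) c) * P) *
        jordanUnit (jordanMap hP) j (Sum.elim id id c) (Sum.elim id id d)) *
      Sum.elim (fun _ => 1) (fun _ => F.up 1) d := by
    conv_lhs => rw [units, units, ← jordanUnit_mul_P hP i, ← P_mul_jordanUnit hP j]
    simp only [mul_assoc]
  rw [this, units_middle hP]
  split_ifs with h
  · rw [jordanUnit_mul_P hP]
  · simp

theorem isMatrixUnits_units : IsMatrixUnits (units hP) where
  mul_same i a b c := by
    rw [units_mul hP, if_pos rfl, (isJordanHom_jordanMap hP).isMatrixUnits.mul_same]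
    rfl
  mul_ne i a b c d h := by
    rw [units_mul hP]
    split_ifs with h'
    · rw [(isJordanHom_jordanMap hP).isMatrixUnits.mul_ne]
      · simp
      · rintro h''
        rcases b with b | b <;> rcases c with c | c <;> simp_all
    · rfl
  mul_block i j h a b c d := by
    rw [units_mul hP, (isJordanHom_jordanMap hP).isMatrixUnits.mul_block i j h]
    simp

/-- The extension of the representation to a linear map on all families of block matrices. -/
def ext (R : Type) [CommRing R] [Algebra k R] : BlockFam l R →ₗ[R] Matrix n n R :=
  unitsLin R fun i a b => scal R (units hP i a b)

theorem isMatrixUnits_scal (R : Type) [CommRing R] [Algebra k R] :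
    IsMatrixUnits (fun i a b => scal R (units hP i a b)) where
  mul_same i a b c := by rw [← map_mul, (isMatrixUnits_units hP).mul_same]
  mul_ne i a b c d h := by rw [← map_mul, (isMatrixUnits_units hP).mul_ne i a b c d h, map_zero]
  mul_block i j h a b c d := by
    rw [← map_mul, (isMatrixUnits_units hP).mul_block i j h, map_zero]

variable {R : Type} [CommRing R] [Algebra k R]

theorem ext_mul (x y : BlockFam l R) : ext hP R (x * y) = ext hP R x * ext hP R y :=
  unitsLin_mul (isMatrixUnits_scal hP R) x y

theorem ext_mapFam {S : Type} [CommRing S] [Algebra k S] (φ : R →ₐ[k] S) (x : BlockFam l R) :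
    ext hP S (mapFam (φ : R →+* S) x) = (ext hP R x).map φ := by
  change _ = (φ : R →+* S).mapMatrix _
  have h : ∀ A : Matrix n n k, (φ : R →+* S).mapMatrix (scal R A) = scal S A := fun A => by
    refine Matrix.ext fun i j => ?_
    exact φ.commutes _
  simp only [ext, unitsLin_apply, map_sum, mapMatrix_smul, h]
  rfl

/-- The linear extension of the Jordan homomorphism to all families of matrices. -/
def jordanLin (R : Type) [CommRing R] [Algebra k R] : MatFam l R →ₗ[R] Matrix n n R :=
  unitsLin R fun i a b => scal R (jordanUnit (jordanMap hP) i a b)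

theorem jordanLin_mapFam {S : MatFam l k} (hS : tr S = S) :
    jordanLin hP R (mapFam (algebraMap k R) S) = scal R (jordanMap hP S) := by
  rw [jordanLin, unitsLin_mapFam, ← (isJordanHom_jordanMap hP).apply_eq hS]

theorem ext_blk (A B C D : MatFam l R) :
    ext hP R (blk A B C D) = jordanLin hP R A +
      jordanLin hP R B * scal R (F.up (1 : MatFam l k)) +
      scal R (F.down (1 : MatFam l k)) * jordanLin hP R C +
      scal R (F.down (1 : MatFam l k)) * jordanLin hP R D * scal R (F.up (1 : MatFam l k)) := by
  simp only [ext, jordanLin, unitsLin_apply, Fintype.sum_sum_type, Finset.sum_mul, Finset.mul_sum,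
    ← Finset.sum_add_distrib]
  refine Finset.sum_congr rfl fun i _ => ?_
  simp only [blk, Matrix.fromBlocks_apply₁₁, Matrix.fromBlocks_apply₁₂, Matrix.fromBlocks_apply₂₁,
    Matrix.fromBlocks_apply₂₂, units, Sum.elim_inl, Sum.elim_inr, id, one_mul, mul_one, map_mul,
    smul_mul_assoc, mul_smul_comm, Finset.sum_add_distrib]
  abel

theorem jordanLin_one : jordanLin hP R 1 = scal R P := by
  rw [← map_one (mapFam (m := l) (algebraMap k R)), jordanLin_mapFam hP tr_one, jordanMap_one hP]

theorem ext_cochar (t : R) : ext hP R (cochar t) = 1 - scal R P + t • scal R P := by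
  have h1 := mul_up hP (tr_one (m := l) (R := k))
  rw [scal_self] at h1
  rw [cochar, ext_blk, map_smul, jordanLin_one hP, map_zero, zero_mul, mul_zero, mul_assoc,
    ← map_mul, ← map_mul, h1, down_one_mul_up_one hP, map_sub, map_one]
  abel

theorem ext_one : ext hP R 1 = 1 := by
  rw [← cochar_one, ext_cochar hP, one_smul, sub_add_cancel]

theorem up_eq_jordanLin_mul {S : MatFam l R} (hS : tr S = S) :
    F.up S = jordanLin hP R S * scal R (F.up (1 : MatFam l k)) := by
  have key : upLin hP R = (LinearMap.mulRight R (scal R (F.up (1 : MatFam l k)))) ∘ₗ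
      jordanLin hP R ∘ₗ symLin k R := by
    refine linearMap_ext_scalars (k := k) fun T => ?_
    rw [LinearMap.comp_apply, LinearMap.comp_apply, LinearMap.mulRight_apply, upLin_mapFam,
      symLin_mapFam, jordanLin_mapFam hP (tr_symLin T), ← map_mul,
      jordanMap_mul_up hP (tr_symLin T), upLin_eq]
  have := LinearMap.congr_fun key S
  rwa [LinearMap.comp_apply, LinearMap.comp_apply, LinearMap.mulRight_apply, symLin_of_tr hS,
    upLin_apply hP hS] at this

theorem upLin_swap {S : MatFam l R} (hS : tr S = S) : upLin hP.swap R S = -F.down S := by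
  rw [upLin_apply hP.swap hS, swap_up, ← neg_one_smul R S, down_smul hP hS, neg_one_smul]

theorem down_eq_mul_jordanLin {S : MatFam l R} (hS : tr S = S) :
    F.down S = scal R (F.down (1 : MatFam l k)) * jordanLin hP R S := by
  have key : -upLin hP.swap R = (LinearMap.mulLeft R (scal R (F.down (1 : MatFam l k)))) ∘ₗ
      jordanLin hP R ∘ₗ symLin k R := by
    refine linearMap_ext_scalars (k := k) fun T => ?_
    rw [LinearMap.comp_apply, LinearMap.comp_apply, LinearMap.mulLeft_apply, LinearMap.neg_apply,
      upLin_mapFam, symLin_mapFam, jordanLin_mapFam hP (tr_symLin T), ← map_mul,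
      down_mul_jordanMap hP (tr_symLin T), ← map_neg, upLin_eq, ← upLin_apply hP.swap (tr_symLin T),
      upLin_swap hP (tr_symLin T), neg_neg]
  have := LinearMap.congr_fun key S
  rwa [LinearMap.comp_apply, LinearMap.comp_apply, LinearMap.mulLeft_apply, symLin_of_tr hS,
    LinearMap.neg_apply, upLin_swap hP hS, neg_neg] at this

theorem ext_upper {S : MatFam l R} (hS : tr S = S) :
    ext hP R (upper S) = F.toFun R (upper S) := by
  have e : upper S = 1 + blk 0 S 0 0 := by rw [blk_one, blk_add]; simp [upper]
  rw [toFun_upper, up_eq_jordanLin_mul hP hS, e, map_add, ext_one, ext_blk]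
  simp

theorem ext_lower {S : MatFam l R} (hS : tr S = S) :
    ext hP R (lower S) = F.toFun R (lower S) := by
  have e : lower S = 1 + blk 0 0 S 0 := by rw [blk_one, blk_add]; simp [lower]
  rw [toFun_lower, down_eq_mul_jordanLin hP hS, e, map_add, ext_one, ext_blk]
  simp

end SimRep

end

section

/-! ### Generation of the symplectic group by unipotent elements -/

section FieldLemma

variable {K m : Type} [Field K] [Fintype m] [DecidableEq m]

/-- If the columns of `(a, c)` span a Lagrangian subspace, then it is transversal to the graph of
`-S` for a suitable symmetric matrix `S`. One can take for `S` a symmetric form which is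
nondegenerate on `c (ker a)` and has a complement of this space in its radical. -/
theorem exists_symm_det_ne_zero (a c : Matrix m m K) (h : a.transpose * c = c.transpose * a)
    (hinj : ∀ y, a.mulVec y = 0 → c.mulVec y = 0 → y = 0) :
    ∃ S : Matrix m m K, S.transpose = S ∧ (a + S * c).det ≠ 0 := by
  let U : Submodule K (m → K) := (LinearMap.ker a.mulVecLin).map c.mulVecLin
  let e : U ≃ₗ[K] (Fin (Module.finrank K U) → K) := (Module.finBasis K U).equivFun
  obtain ⟨g, hg⟩ := LinearMap.exists_extend e.toLinearMap
  have hg' : ∀ u : U, g u = e u := fun u => LinearMap.congr_fun hg u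
  let b := LinearMap.toMatrix' g
  have hb : ∀ v, b.mulVec v = g v := fun v => LinearMap.toMatrix'_mulVec g v
  refine ⟨b.transpose * b, by simp, fun hdet => ?_⟩
  obtain ⟨y, hy, hy0⟩ := Matrix.exists_mulVec_eq_zero_iff.mpr hdet
  apply hy
  have hsum : a.mulVec y + b.transpose.mulVec (b.mulVec (c.mulVec y)) = 0 := by
    rw [← hy0, Matrix.add_mulVec, Matrix.mulVec_mulVec, Matrix.mulVec_mulVec]
  -- the image of `a` is orthogonal to `c (ker a)`
  have horth : ∀ x, a.mulVec x = 0 → c.mulVec x ⬝ᵥ a.mulVec y = 0 := by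
    intro x hx
    rw [Matrix.dotProduct_mulVec, ← Matrix.mulVec_transpose, Matrix.mulVec_mulVec, h,
      ← Matrix.mulVec_mulVec, hx, Matrix.mulVec_zero, zero_dotProduct]
  have hgz : g (c.mulVec y) = 0 := by
    have key : ∀ w : Fin (Module.finrank K U) → K, w ⬝ᵥ g (c.mulVec y) = 0 := by
      intro w
      obtain ⟨x, hx, hxu⟩ := (e.symm w).2
      have hx0 : a.mulVec x = 0 := hx
      have hxw : b.mulVec (c.mulVec x) = w := by
        rw [hb, show c.mulVec x = (e.symm w : m → K) from hxu, hg', LinearEquiv.apply_symm_apply]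
      have := congrArg (c.mulVec x ⬝ᵥ ·) hsum
      simp only [dotProduct_add, horth x hx0, zero_add, dotProduct_zero] at this
      rw [Matrix.dotProduct_mulVec, Matrix.vecMul_transpose, hxw, hb] at this
      exact this
    exact dotProduct_eq_zero _ fun w => by rw [dotProduct_comm, key]
  have hay : a.mulVec y = 0 := by
    rw [hb, hgz, Matrix.mulVec_zero, add_zero] at hsum
    exact hsum
  refine hinj y hay ?_
  have hu : c.mulVec y ∈ U := ⟨y, hay, rfl⟩
  have := hg' ⟨_, hu⟩
  rw [hgz] at this
  have := (LinearEquiv.map_eq_zero_iff e).mp this.symm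
  exact congrArg Subtype.val this

end FieldLemma

variable {k : Type} [Field k] [CharZero k] {ι : Type} [Fintype ι] [DecidableEq ι] {l : ι → Type}
  [∀ i, Fintype (l i)] [∀ i, DecidableEq (l i)] {n : Type} [Fintype n] [DecidableEq n]

theorem tr_mulSingle {R : Type} [CommRing R] (i : ι) (A : Matrix (l i) (l i) R) :
    tr (Pi.mulSingle i A : MatFam l R) = Pi.mulSingle i A.transpose := by
  funext j
  rcases eq_or_ne j i with rfl | h
  · simp
  · simp [Pi.mulSingle_eq_of_ne h]

theorem mapFam_mulSingle {R S : Type} [CommRing R] [CommRing S] (φ : R →+* S) (i : ι)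
    (A : Matrix (l i) (l i) R) :
    mapFam φ (Pi.mulSingle i A) = Pi.mulSingle i (A.map φ) := by
  funext j
  rcases eq_or_ne j i with rfl | h
  · simp
  · simp [Pi.mulSingle_eq_of_ne h]

namespace SimRep

variable {F : SimRep k l n} {P : Matrix n n k} (hP : F.HasWeights P) {R : Type} [CommRing R]
  [Algebra k R]

/-- The representation and its linear extension agree on `x`. -/
def Agrees (x : BlockFam l R) : Prop := F.toFun R x = ext hP R x

variable {hP}

theorem Agrees.mul {x y : BlockFam l R} (hx : Agrees hP x) (hy : Agrees hP y) (hx' : IsGSp x)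
    (hy' : IsGSp y) : Agrees hP (x * y) := by
  rw [Agrees, F.mul hx' hy', ext_mul, hx, hy]

theorem Agrees.mapFam {x : BlockFam l R} (hx : Agrees hP x) (hx' : IsGSp x) {S : Type}
    [CommRing S] [Algebra k S] (φ : R →ₐ[k] S) : Agrees hP (mapFam (φ : R →+* S) x) := by
  rw [Agrees, F.natural φ hx', ext_mapFam, hx]

theorem Agrees.of_injective {x : BlockFam l R} (hx' : IsGSp x) {S : Type}
    [CommRing S] [Algebra k S] (φ : R →ₐ[k] S) (hφ : Function.Injective φ)
    (hx : Agrees hP (PEL.mapFam (φ : R →+* S) x)) : Agrees hP x := by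
  rw [Agrees, F.natural φ hx', ext_mapFam] at hx
  refine Matrix.ext fun i j => hφ ?_
  exact congrFun (congrFun hx i) j

theorem agrees_upper {S : MatFam l R} (hS : tr S = S) : Agrees hP (upper S) :=
  (ext_upper hP hS).symm

theorem agrees_lower {S : MatFam l R} (hS : tr S = S) : Agrees hP (lower S) :=
  (ext_lower hP hS).symm

theorem agrees_cochar {t : R} (ht : IsUnit t) : Agrees hP (cochar t : BlockFam l R) := by
  rw [Agrees, ext_cochar, hP.cochar ht]

/-- For symmetric `S`, the element `levi S S⁻¹` is the product of two Weyl group elements, each of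
which is a product of three unipotents. -/
theorem agrees_levi_of_symm {S S' : MatFam l R} (hS : tr S = S) (h : S * S' = 1)
    (h' : S' * S = 1) : Agrees hP (levi S S') := by
  have hS' : tr S' = S' := by
    have := congrArg tr h'
    rw [tr_mul, tr_one, hS] at this
    calc tr S' = S' * S * tr S' := by rw [h', one_mul]
      _ = S' := by rw [mul_assoc, this, mul_one]
  have weyl : ∀ T T' : MatFam l R, tr T = T → tr T' = T' → T * T' = 1 → T' * T = 1 →
      Agrees hP (blk 0 T (-T') 0) ∧ IsGSp (blk 0 T (-T') 0) := by
    intro T T' hT hT' hTT' hT'T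
    have e : blk 0 T (-T') 0 = upper T * lower (-T') * upper T := by
      simp [upper, lower, blk_mul, hTT', hT'T]
    have hu := isGSp_upper hT
    have hl := isGSp_lower (S := -T') (by rw [tr_neg, hT'])
    rw [e]
    exact ⟨((agrees_upper hT).mul (agrees_lower (by rw [tr_neg, hT'])) hu hl).mul
      (agrees_upper hT) (hu.mul hl) hu, (hu.mul hl).mul hu⟩
  have e : levi S S' = blk 0 S (-S') 0 * blk 0 (-1) (-(-1)) 0 := by
    simp [levi, blk_mul, hS']
  obtain ⟨h1, h2⟩ := weyl S S' hS hS' h h'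
  obtain ⟨h3, h4⟩ := weyl (-1) (-1) (by simp) (by simp) (by simp) (by simp)
  rw [e]
  exact h1.mul h3 h2 h4

theorem agrees_levi_single_of_symm (i : ι) {A A' : Matrix (l i) (l i) R} (hA : A.transpose = A)
    (h : A * A' = 1) : Agrees hP (levi (Pi.mulSingle i A) (Pi.mulSingle i A')) :=
  agrees_levi_of_symm (by rw [tr_mulSingle, hA]) (by rw [← Pi.mulSingle_mul, h, Pi.mulSingle_one])
    (by rw [← Pi.mulSingle_mul, mul_eq_one_comm.mp h, Pi.mulSingle_one])

/-- Over a field, an invertible matrix is a product of symmetric ones: this holds for transvections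
because the product of a transvection with a transposition matrix is symmetric. -/
theorem agrees_levi_single_field {K : Type} [Field K] [Algebra k K] (i : ι)
    {A A' : Matrix (l i) (l i) K} (h : A * A' = 1) :
    Agrees hP (levi (Pi.mulSingle i A) (Pi.mulSingle i A')) := by
  have hdet : A.det ≠ 0 := (Matrix.isUnit_det_of_right_inverse h).ne_zero
  rw [← Matrix.inv_eq_right_inv h]
  clear h A'
  have hmul : ∀ A B : Matrix (l i) (l i) K, A.det ≠ 0 → B.det ≠ 0 →
      Agrees hP (levi (Pi.mulSingle i A) (Pi.mulSingle i A⁻¹)) →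
      Agrees hP (levi (Pi.mulSingle i B) (Pi.mulSingle i B⁻¹)) →
      Agrees hP (levi (Pi.mulSingle i (A * B)) (Pi.mulSingle i (A * B)⁻¹)) := by
    intro A B hA hB h1 h2
    have hinv : ∀ {A : Matrix (l i) (l i) K}, A.det ≠ 0 →
        (Pi.mulSingle i A⁻¹ * Pi.mulSingle i A : MatFam l K) = 1 := fun {A} hA => by
      rw [← Pi.mulSingle_mul, Matrix.nonsing_inv_mul _ (IsUnit.mk0 _ hA), Pi.mulSingle_one]
    rw [Matrix.mul_inv_rev, Pi.mulSingle_mul, Pi.mulSingle_mul, ← levi_mul]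
    exact h1.mul h2 (isGSp_levi (hinv hA)) (isGSp_levi (hinv hB))
  have hsymm : ∀ A : Matrix (l i) (l i) K, A.det ≠ 0 → A.transpose = A →
      Agrees hP (levi (Pi.mulSingle i A) (Pi.mulSingle i A⁻¹)) := fun A hA hA' =>
    agrees_levi_single_of_symm i hA' (Matrix.mul_nonsing_inv _ (IsUnit.mk0 _ hA))
  refine Matrix.diagonal_transvection_induction_of_det_ne_zero
    (fun A => Agrees hP (levi (Pi.mulSingle i A) (Pi.mulSingle i A⁻¹))) A hdet
    (fun D hD => hsymm _ hD (Matrix.diagonal_transpose D)) (fun t => ?_) hmul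
  let σ : Matrix (l i) (l i) K := Matrix.swap K t.i t.j
  have hσ : σ * σ = 1 := Matrix.swap_mul_self t.i t.j
  have hσdet : σ.det ≠ 0 := (Matrix.isUnit_det_of_right_inverse hσ).ne_zero
  have htdet : t.toMatrix.det ≠ 0 := by rw [t.det]; exact one_ne_zero
  have e : t.toMatrix = (t.toMatrix * σ) * σ := by rw [mul_assoc, hσ, mul_one]
  have hts : t.toMatrix * σ = σ + Matrix.single t.i t.i t.c := by
    rw [Matrix.TransvectionStruct.toMatrix, Matrix.transvection, add_mul, one_mul]
    congr 1
    ext a b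
    rcases eq_or_ne b t.i with rfl | hbi
    · rw [Matrix.mul_swap_apply_left]; simp [Matrix.single_apply]
    · rcases eq_or_ne b t.j with rfl | hbj
      · rw [Matrix.mul_swap_apply_right]; simp [t.hij, t.hij.symm]
      · rw [Matrix.mul_swap_of_ne hbi hbj]; simp [hbi.symm, hbj.symm]
  rw [e]
  refine hmul _ _ (by rw [Matrix.det_mul]; exact mul_ne_zero htdet hσdet) hσdet
    (hsymm _ (by rw [Matrix.det_mul]; exact mul_ne_zero htdet hσdet) ?_)
    (hsymm _ hσdet (Matrix.transpose_swap _ _))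
  rw [hts, Matrix.transpose_add, Matrix.transpose_swap, Matrix.transpose_single]

/-- The general case follows from the case of the generic invertible matrix, the entries of which
lie in a domain. -/
theorem agrees_levi_single (i : ι) {A A' : Matrix (l i) (l i) R} (h : A * A' = 1) :
    Agrees hP (levi (Pi.mulSingle i A) (Pi.mulSingle i A')) := by
  let X := Matrix.mvPolynomialX (l i) (l i) k
  let M := Submonoid.powers X.det
  let R₀ := Localization M
  have hM : M ≤ nonZeroDivisors (MvPolynomial (l i × l i) k) :=
    powers_le_nonZeroDivisors_of_noZeroDivisors (Matrix.det_mvPolynomialX_ne_zero (l i) k)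
  have : IsDomain R₀ := IsLocalization.isDomain_localization hM
  let X₀ : Matrix (l i) (l i) R₀ := X.map (algebraMap _ R₀)
  have hX₀ : IsUnit X₀.det := by
    have : X₀.det = algebraMap _ R₀ X.det := (RingHom.map_det _ X).symm
    rw [this]
    exact IsLocalization.map_units R₀ (⟨X.det, Submonoid.mem_powers _⟩ : M)
  let f : MvPolynomial (l i × l i) k →ₐ[k] R := MvPolynomial.aeval fun p => A p.1 p.2
  have hfX : X.map f = A := Matrix.mvPolynomialX_mapMatrix_aeval k A
  have hf : ∀ y : M, IsUnit (f y) := by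
    rintro ⟨_, r, rfl⟩
    have : f X.det = A.det := by
      rw [← hfX]; exact (f : _ →+* R).map_det X
    simp only [map_pow, this]
    exact (Matrix.isUnit_det_of_right_inverse h).pow r
  let φ : R₀ →ₐ[k] R := IsLocalization.liftAlgHom hf
  have hφX : X₀.map φ = A := by
    rw [← hfX]
    ext a b
    exact IsLocalization.lift_eq _ _
  have hinv : X₀ * X₀⁻¹ = 1 := Matrix.mul_nonsing_inv _ hX₀
  have hφX' : X₀⁻¹.map φ = A' := by
    have h1 : A * X₀⁻¹.map φ = 1 := by
      have := congrArg (fun B => B.map φ) hinv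
      rw [← hφX]
      simpa [Matrix.map_mul] using this
    calc X₀⁻¹.map φ = A' * A * X₀⁻¹.map φ := by rw [mul_eq_one_comm.mp h, one_mul]
      _ = A' := by rw [mul_assoc, h1, mul_one]
  have hG : IsGSp (levi (Pi.mulSingle i X₀) (Pi.mulSingle i X₀⁻¹) : BlockFam l R₀) :=
    isGSp_levi (by rw [← Pi.mulSingle_mul, mul_eq_one_comm.mp hinv, Pi.mulSingle_one])
  have key : Agrees hP (levi (Pi.mulSingle i X₀) (Pi.mulSingle i X₀⁻¹) : BlockFam l R₀) := by
    refine Agrees.of_injective hG ((Algebra.ofId R₀ (FractionRing R₀)).restrictScalars k)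
      (IsFractionRing.injective R₀ (FractionRing R₀)) ?_
    rw [mapFam_levi, mapFam_mulSingle, mapFam_mulSingle]
    refine agrees_levi_single_field i ?_
    rw [← Matrix.map_mul, hinv]
    simp
  have := key.mapFam hG φ
  rw [mapFam_levi, mapFam_mulSingle, mapFam_mulSingle] at this
  have e1 : X₀.map (φ : R₀ →+* R) = A := hφX
  have e2 : X₀⁻¹.map (φ : R₀ →+* R) = A' := hφX'
  rwa [e1, e2] at this

theorem agrees_levi {A A' : MatFam l R} (h : A * A' = 1) : Agrees hP (levi A A') := by
  have h' : A' * A = 1 := by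
    funext i; exact mul_eq_one_comm.mp (congrFun h i)
  have key : ∀ s : Finset ι, Agrees hP (levi (fun i => if i ∈ s then A i else 1)
      (fun i => if i ∈ s then A' i else 1)) := by
    intro s
    induction s using Finset.induction_on with
    | empty =>
      simp only [Finset.notMem_empty, if_false]
      exact agrees_levi_of_symm (S := 1) (S' := 1) (by simp) (by simp) (by simp)
    | insert i s hi ih =>
      have e : ∀ B : MatFam l R, (fun j => if j ∈ insert i s then B j else 1) =
          Pi.mulSingle i (B i) * (fun j => if j ∈ s then B j else 1) := by
        intro B
        funext j
        rcases eq_or_ne j i with rfl | hj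
        · simp [hi]
        · simp [hj]
      have e' : ∀ B : MatFam l R, (fun j => if j ∈ insert i s then B j else 1) =
          (fun j => if j ∈ s then B j else 1) * Pi.mulSingle i (B i) := by
        intro B
        funext j
        rcases eq_or_ne j i with rfl | hj
        · simp [hi]
        · simp [hj]
      rw [e, e', ← levi_mul]
      refine (agrees_levi_single i (congrFun h i)).mul ih (isGSp_levi ?_) (isGSp_levi ?_)
      · rw [← Pi.mulSingle_mul, ← Pi.mul_apply, h', Pi.one_apply, Pi.mulSingle_one]
      · funext j
        by_cases hj : j ∈ s
        · simpa [hj] using congrFun h' j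
        · simp [hj]
  simpa using key Finset.univ

/-- The big cell: a symplectic element with invertible upper left blocks. -/
theorem agrees_of_isUnit {A B C D A' : MatFam l R} (hx : IsSim (blk A B C D) 1)
    (hA : A * A' = 1) : Agrees hP (blk A B C D) := by
  have hA' : A' * A = 1 := by
    funext i; exact mul_eq_one_comm.mp (congrFun hA i)
  obtain ⟨h1, h2, h3⟩ := hx.blk
  have h1' : tr (C * A') = C * A' := by
    have : tr A' * (tr C * A) * A' = tr A' * (tr A * C) * A' := by rw [h1]
    have e : tr A' * tr A = 1 := by rw [← tr_mul, hA, tr_one]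
    rw [← mul_assoc, mul_assoc _ A, hA, mul_one, ← mul_assoc, e, one_mul, ← tr_mul] at this
    exact this
  have e : tr A' * tr A = 1 := by rw [← tr_mul, hA, tr_one]
  have e' : tr A * tr A' = 1 := by rw [← tr_mul, hA', tr_one]
  have hD : D = C * A' * B + tr A' := by
    calc D = tr A' * (tr A * D) := by rw [← mul_assoc, e, one_mul]
      _ = tr A' * tr C * B + tr A' := by rw [h3, one_smul, mul_add, mul_one, mul_assoc]
      _ = C * A' * B + tr A' := by rw [← tr_mul, h1']
  have h2' : tr (A' * B) = A' * B := by
    have : tr B * (C * A' * B + tr A') = tr (C * A' * B + tr A') * B := by rw [← hD, h2]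
    rw [tr_add, tr_tr, tr_mul (C * A'), h1', mul_add, add_mul, ← mul_assoc] at this
    rw [tr_mul]
    exact add_left_cancel this
  have hfac : blk A B C D = lower (C * A') * levi A A' * upper (A' * B) := by
    simp only [lower, levi, upper, blk_mul, mul_assoc, hA', hD]
    simp only [one_mul, mul_one, zero_mul, mul_zero, add_zero, zero_add, ← mul_assoc, hA]
  rw [hfac]
  exact ((agrees_lower h1').mul (agrees_levi hA) (isGSp_lower h1') (isGSp_levi hA')).mul
    (agrees_upper h2') ((isGSp_lower h1').mul (isGSp_levi hA')) (isGSp_upper h2')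

/-- Over a local ring, multiplication by a suitable upper unipotent element, found over the residue
field, moves an element into the big cell. -/
theorem agrees_of_isLocalRing [IsLocalRing R] {x : BlockFam l R} (hx : IsSim x 1) :
    Agrees hP x := by
  obtain ⟨A, B, C, D, rfl⟩ : ∃ A B C D, x = blk A B C D := ⟨_, _, _, _, eq_blk x⟩
  let π := IsLocalRing.residue R
  have hS : ∀ i, ∃ S : Matrix (l i) (l i) R, S.transpose = S ∧ IsUnit (A i + S * C i).det := by
    intro i
    have hx' := hx.mapFam π
    rw [mapFam_blk] at hx'
    obtain ⟨h1, -, h3⟩ := hx'.blk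
    have h1 := congrFun h1 i
    have h3 := congrArg Matrix.transpose (congrFun h3 i)
    simp only [Pi.mul_apply, tr_apply, mapFam_apply, Pi.add_apply, map_one, one_smul,
      Pi.one_apply, Matrix.transpose_mul, Matrix.transpose_add, Matrix.transpose_transpose,
      Matrix.transpose_one] at h1 h3
    obtain ⟨S, hS, hdet⟩ := exists_symm_det_ne_zero ((A i).map π) ((C i).map π) h1 (by
      intro y hay hcy
      have := congrArg (fun Z => Matrix.mulVec Z y) h3
      simp only [← Matrix.mulVec_mulVec, Matrix.add_mulVec, hay, hcy, Matrix.mulVec_zero,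
        zero_add, Matrix.one_mulVec] at this
      exact this.symm)
    let s : IsLocalRing.ResidueField R → R := Function.surjInv IsLocalRing.residue_surjective
    have hs : ∀ r, π (s r) = r := Function.surjInv_eq IsLocalRing.residue_surjective
    refine ⟨S.map s, by rw [← Matrix.transpose_map, hS], ?_⟩
    rw [← IsLocalRing.residue_ne_zero_iff_isUnit]
    have e : π (A i + S.map s * C i).det = ((A i).map π + S * (C i).map π).det := by
      have e' : π.mapMatrix (S.map s) = S := Matrix.ext fun a b => hs _
      rw [RingHom.map_det, map_add, map_mul, e']
      rfl
    rw [show IsLocalRing.residue R _ = π _ from rfl, e]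
    exact hdet
  choose S hS hdet using hS
  have hS' : tr S = S := funext hS
  have e : blk A B C D = upper (-S) * blk (A + S * C) (B + S * D) C D := by
    simp [upper, blk_mul]
  have hm : blk (A + S * C) (B + S * D) C D = upper S * blk A B C D := by
    simp [upper, blk_mul]
  have hsim : IsSim (upper S) (1 : R) := isSim_blk (by simp) (by simp [hS']) (by simp)
  have hsim' : IsSim (blk (A + S * C) (B + S * D) C D) 1 := by
    rw [hm]; simpa using hsim.mul hx
  have hn : tr (-S) = -S := by rw [tr_neg, hS']
  rw [e]
  refine (agrees_upper hn).mul (agrees_of_isUnit hsim' (A' := fun i => (A i + S i * C i)⁻¹) ?_)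
    (isGSp_upper hn) ⟨1, isUnit_one, hsim'⟩
  funext i
  exact Matrix.mul_nonsing_inv _ (hdet i)

theorem agrees_of_isSim_one {x : BlockFam l R} (hx : IsSim x 1) : Agrees hP x := by
  have hx' : IsGSp x := ⟨1, isUnit_one, hx⟩
  refine Matrix.ext fun a b => ?_
  rw [← sub_eq_zero]
  refine eq_zero_of_localization _ fun J hJ => ?_
  let φ : R →ₐ[k] Localization.AtPrime J := (Algebra.ofId R _).restrictScalars k
  have h := hx.mapFam (φ : R →+* Localization.AtPrime J)
  rw [map_one] at h
  have := agrees_of_isLocalRing (hP := hP) h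
  rw [Agrees, F.natural φ hx', ext_mapFam] at this
  rw [map_sub, sub_eq_zero]
  exact congrFun (congrFun this a) b

/-- A representation on which the cocharacter has only the weights `0` and `1` is the restriction
of a linear map. -/
theorem toFun_eq_ext {x : BlockFam l R} (hx : IsGSp x) : F.toFun R x = ext hP R x := by
  obtain ⟨μ, hμ, hx⟩ := hx
  obtain ⟨ν, hν⟩ := hμ.exists_right_inv
  have hν' : IsUnit ν := IsUnit.of_mul_eq_one _ ((mul_comm _ _).trans hν)
  have hs : IsSim (cochar ν : BlockFam l R) ν := isSim_blk (by simp) (by simp) (by simp)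
  have h1 : IsSim (cochar ν * x) 1 := by rw [← hν, mul_comm μ]; exact hs.mul hx
  have e : x = cochar μ * (cochar ν * x) := by
    rw [← mul_assoc, cochar_mul, hν, cochar_one, one_mul]
  rw [e]
  exact (agrees_cochar hμ).mul (agrees_of_isSim_one h1) (isGSp_cochar hμ) ⟨1, isUnit_one, h1⟩

end SimRep

end

section

/-! ### Symplectic bases adapted to a pair of Lagrangian subspaces -/

section Frame

variable {K d : Type} [Field K] [Fintype d] [DecidableEq d]

theorem exists_idempotent_factorisation {E : Matrix d d K} (hE : E * E = E) :
    ∃ (g : ℕ) (A : Matrix d (Fin g) K) (B : Matrix (Fin g) d K), A * B = E ∧ B * A = 1 := by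
  let f := E.mulVecLin
  let e : LinearMap.range f ≃ₗ[K] (Fin (Module.finrank K (LinearMap.range f)) → K) :=
    (Module.finBasis K (LinearMap.range f)).equivFun
  refine ⟨_, LinearMap.toMatrix' ((LinearMap.range f).subtype ∘ₗ e.symm.toLinearMap),
    LinearMap.toMatrix' (e.toLinearMap ∘ₗ f.rangeRestrict), ?_, ?_⟩
  · rw [← LinearMap.toMatrix'_comp, ← LinearMap.toMatrix'_toLin' E]
    congr 1
    refine LinearMap.ext fun v => ?_
    simp [f]
  · rw [← LinearMap.toMatrix'_comp, ← LinearMap.toMatrix'_id]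
    congr 1
    refine LinearMap.ext fun v => ?_
    obtain ⟨w, hw⟩ := (e.symm v).2
    have : f.rangeRestrict (e.symm v : d → K) = e.symm v := by
      apply Subtype.ext
      rw [LinearMap.codRestrict_apply, ← hw]
      change E.mulVec (E.mulVec w) = E.mulVec w
      rw [Matrix.mulVec_mulVec, hE]
    simp [this]

/-- Let `P` be the projection onto one of two complementary Lagrangian subspaces for the
alternating form with Gram matrix `Ω`, along the other one, and let `E` be a self-adjoint
idempotent commuting with `P`. Then the image of `E` has a symplectic basis, given by the columns
of `Q`, with one half in each of the two Lagrangian subspaces. -/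
theorem exists_symplectic_frame {Ω Ω' E P : Matrix d d K} (hΩ : Ω * Ω' = 1)
    (hskew : Ω.transpose = -Ω) (hE : E * E = E) (hP : P * P = P) (hEP : E * P = P * E)
    (hEΩ : E.transpose * Ω = Ω * E) (hPΩ : P.transpose * Ω = Ω * (1 - P)) :
    ∃ (g : ℕ) (Q : Matrix d (Fin g ⊕ Fin g) K) (Q' : Matrix (Fin g ⊕ Fin g) d K),
      Q' * Q = 1 ∧ Q * Q' = E ∧ Q.transpose * Ω * Q = Matrix.J (Fin g) K ∧
      P * Q = Q * (Matrix.fromBlocks 1 0 0 0 : Matrix (Fin g ⊕ Fin g) (Fin g ⊕ Fin g) K) := by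
  have hΩ' : Ω' * Ω = 1 := mul_eq_one_comm.mp hΩ
  have h1 : (P * E) * (P * E) = P * E := by
    rw [mul_assoc, ← mul_assoc E P, hEP, mul_assoc P E E, hE, ← mul_assoc, hP]
  obtain ⟨g, A, B, hAB, hBA⟩ := exists_idempotent_factorisation h1
  -- `(1 - P) * E` is the adjoint of `P * E`, which gives the dual half of the basis
  set A₀ : Matrix d (Fin g) K := -(Ω' * B.transpose) with hA₀
  set B₀ : Matrix (Fin g) d K := -(A.transpose * Ω) with hB₀
  have hadj : (P * E).transpose * Ω = Ω * ((1 - P) * E) := by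
    rw [Matrix.transpose_mul, mul_assoc, hPΩ, ← mul_assoc, hEΩ, mul_assoc, mul_sub, mul_one, hEP,
      sub_mul, one_mul]
  have hA₀B₀ : A₀ * B₀ = (1 - P) * E := by
    rw [hA₀, hB₀, Matrix.neg_mul, Matrix.mul_neg, neg_neg]
    calc Ω' * B.transpose * (A.transpose * Ω) = Ω' * ((A * B).transpose * Ω) := by
          simp only [Matrix.transpose_mul, Matrix.mul_assoc]
      _ = _ := by rw [hAB, hadj, ← mul_assoc, hΩ', one_mul]
  have hB₀A₀ : B₀ * A₀ = 1 := by
    rw [hA₀, hB₀, Matrix.neg_mul, Matrix.mul_neg, neg_neg]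
    calc A.transpose * Ω * (Ω' * B.transpose) = A.transpose * (Ω * Ω') * B.transpose := by
          simp only [Matrix.mul_assoc]
      _ = 1 := by rw [hΩ, Matrix.mul_one, ← Matrix.transpose_mul, hBA, Matrix.transpose_one]
  have hA : (P * E) * A = A := by rw [← hAB, Matrix.mul_assoc, hBA, Matrix.mul_one]
  have hB : B * (P * E) = B := by rw [← hAB, ← Matrix.mul_assoc, hBA, Matrix.one_mul]
  have hA₀' : ((1 - P) * E) * A₀ = A₀ := by
    rw [← hA₀B₀, Matrix.mul_assoc, hB₀A₀, Matrix.mul_one]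
  have hB₀' : B₀ * ((1 - P) * E) = B₀ := by
    rw [← hA₀B₀, ← Matrix.mul_assoc, hB₀A₀, Matrix.one_mul]
  have ho : (P * E) * ((1 - P) * E) = 0 := by
    rw [mul_assoc, ← mul_assoc E, mul_sub, mul_one, hEP, sub_mul, hE, mul_assoc P E E, hE, mul_sub,
      ← mul_assoc, hP, sub_self]
  have ho' : ((1 - P) * E) * (P * E) = 0 := by
    rw [mul_assoc, ← mul_assoc E, hEP, mul_assoc P E E, hE, ← mul_assoc, sub_mul, hP, one_mul,
      sub_self, zero_mul]
  have hBA₀ : B * A₀ = 0 := by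
    rw [← hB, ← hA₀', Matrix.mul_assoc, ← Matrix.mul_assoc (P * E), ho, Matrix.zero_mul,
      Matrix.mul_zero]
  have hB₀A : B₀ * A = 0 := by
    rw [← hB₀', ← hA, Matrix.mul_assoc, ← Matrix.mul_assoc ((1 - P) * E), ho', Matrix.zero_mul,
      Matrix.mul_zero]
  have hPA : P * A = A := by rw [← hA, ← Matrix.mul_assoc, ← mul_assoc, hP]
  have hPA₀ : P * A₀ = 0 := by
    rw [← hA₀', ← Matrix.mul_assoc, ← mul_assoc, mul_sub, mul_one, hP, sub_self, zero_mul,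
      Matrix.zero_mul]
  have hAΩ : A.transpose * Ω = -B₀ := by rw [hB₀, neg_neg]
  have hA₀Ω : A₀.transpose * Ω = B := by
    have e : Ω'.transpose * Ω = -1 := by
      have : Ω'.transpose * Ω.transpose = 1 := by
        rw [← Matrix.transpose_mul, hΩ, Matrix.transpose_one]
      rw [hskew, mul_neg] at this
      rw [← this, neg_neg]
    rw [hA₀, Matrix.transpose_neg, Matrix.transpose_mul, Matrix.transpose_transpose, Matrix.neg_mul,
      Matrix.mul_assoc, e, Matrix.mul_neg, neg_neg, Matrix.mul_one]
  clear_value A₀ B₀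
  refine ⟨g, Matrix.fromCols A A₀, Matrix.fromRows B B₀, ?_, ?_, ?_, ?_⟩
  · rw [Matrix.fromRows_mul_fromCols, hBA, hBA₀, hB₀A, hB₀A₀, Matrix.fromBlocks_one]
  · rw [Matrix.fromCols_mul_fromRows, hAB, hA₀B₀, ← add_mul, add_sub_cancel, one_mul]
  · rw [Matrix.transpose_fromCols, Matrix.fromRows_mul, hAΩ, hA₀Ω, Matrix.fromRows_mul_fromCols,
      Matrix.neg_mul, Matrix.neg_mul, hB₀A, hB₀A₀, hBA, hBA₀, neg_zero, Matrix.J]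
  · rw [Matrix.mul_fromCols, Matrix.fromCols_mul_fromBlocks, hPA, hPA₀]
    simp

end Frame

end

section

/-! ### Representations of `G` in coordinates -/

section Coordinates

variable {V W : Type*} [AddCommGroup V] [Module ℚ V] [Module.Finite ℚ V]
  [AddCommGroup W] [Module ℚ W] [Module.Finite ℚ W]

variable (W) in
/-- The index type of the chosen basis of `W`. -/
abbrev Ix : Type := Fin (Module.finrank ℚ W)

variable (W) in
/-- The chosen basis of the extension of scalars of `W` to `R`. -/
def basR (R : Type) [CommRing R] [Algebra ℚ R] : Module.Basis (Ix W) R (R ⊗[ℚ] W) :=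
  Algebra.TensorProduct.basis R (Module.finBasis ℚ W)

theorem basR_apply (R : Type) [CommRing R] [Algebra ℚ R] (a : Ix W) :
    basR W R a = 1 ⊗ₜ Module.finBasis ℚ W a :=
  Algebra.TensorProduct.basis_apply _ _

theorem basR_repr_rTensor {R S : Type} [CommRing R] [Algebra ℚ R] [CommRing S] [Algebra ℚ S]
    (φ : R →ₐ[ℚ] S) (x : R ⊗[ℚ] W) (a : Ix W) :
    (basR W S).repr (φ.toLinearMap.rTensor W x) a = φ ((basR W R).repr x a) := by
  induction x with
  | zero => simp
  | tmul r w => simp [basR]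
  | add x y hx hy => simp only [map_add, Finsupp.add_apply, hx, hy]

/-- The matrix of an endomorphism of the extension of scalars of `W` to `R`. -/
def mat (R : Type) [CommRing R] [Algebra ℚ R] :
    Module.End R (R ⊗[ℚ] W) ≃ₐ[R] Matrix (Ix W) (Ix W) R :=
  LinearMap.toMatrixAlgEquiv (basR W R)

theorem mat_apply {R : Type} [CommRing R] [Algebra ℚ R] (f : Module.End R (R ⊗[ℚ] W))
    (a b : Ix W) : mat R f a b = (basR W R).repr (f (basR W R b)) a :=
  LinearMap.toMatrixAlgEquiv_apply _ _ _ _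

theorem mat_extendFun {R S : Type} [CommRing R] [Algebra ℚ R] [CommRing S] [Algebra ℚ S]
    (φ : R →ₐ[ℚ] S) (f : Module.End R (R ⊗[ℚ] W)) :
    mat S (extendFun φ f) = (mat R f).map φ := by
  ext a b
  have e : basR W S b = φ.toLinearMap.rTensor W (basR W R b) := by simp [basR_apply]
  rw [Matrix.map_apply, mat_apply, mat_apply, e, extendFun_rTensor, basR_repr_rTensor]

theorem mat_baseChange (R : Type) [CommRing R] [Algebra ℚ R] (f : Module.End ℚ W) :
    mat R (f.baseChange R) =
      (LinearMap.toMatrixAlgEquiv (Module.finBasis ℚ W) f).map (algebraMap ℚ R) :=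
  LinearMap.toMatrix_baseChange R f _ _

end Coordinates

namespace Datum

variable {B V W : Type*} [Ring B] [Algebra ℚ B] [Module.Finite ℚ B] [IsSemisimpleRing B]
  [AddCommGroup V] [Module ℚ V] [Module B V] [IsScalarTower ℚ B V] [Module.Finite ℚ V]
  [AddCommGroup W] [Module ℚ W] [Module.Finite ℚ W]

variable (V) in
/-- The matrix of the action of `b ∈ B` on `V`. -/
def actMat (b : B) : Matrix (Ix V) (Ix V) ℚ :=
  LinearMap.toMatrixAlgEquiv (Module.finBasis ℚ V) (Algebra.lsmul ℚ ℚ V b)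

theorem mat_actB (R : Type) [CommRing R] [Algebra ℚ R] (b : B) :
    mat R (actB R b : Module.End R (R ⊗[ℚ] V)) = (actMat V b).map (algebraMap ℚ R) :=
  mat_baseChange R _

variable (D : Datum B V)

/-- The Gram matrix of the pairing of a PEL-datum. -/
def gram : Matrix (Ix V) (Ix V) ℚ := LinearMap.BilinForm.toMatrix (Module.finBasis ℚ V) D.form

theorem toMatrix_form (R : Type) [CommRing R] [Algebra ℚ R] :
    LinearMap.BilinForm.toMatrix (basR V R) (D.form.baseChange R) =
      D.gram.map (algebraMap ℚ R) := by
  ext a b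
  simp [gram, basR_apply, LinearMap.BilinForm.toMatrix_apply, Algebra.algebraMap_eq_smul_one]

theorem transpose_gram : D.gram.transpose = -D.gram := by
  ext a b
  simp [gram, LinearMap.BilinForm.toMatrix_apply, D.form_alt.neg_eq]

theorem isUnit_det_gram : IsUnit D.gram.det :=
  ((LinearMap.BilinForm.nondegenerate_iff_det_ne_zero _).1 D.form_nondegenerate).isUnit

theorem gram_mul_inv (R : Type) [CommRing R] [Algebra ℚ R] :
    D.gram.map (algebraMap ℚ R) * D.gram⁻¹.map (algebraMap ℚ R) = 1 := by
  rw [← Matrix.map_mul, Matrix.mul_nonsing_inv _ D.isUnit_det_gram]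
  simp

theorem gram_inv_mul (R : Type) [CommRing R] [Algebra ℚ R] :
    D.gram⁻¹.map (algebraMap ℚ R) * D.gram.map (algebraMap ℚ R) = 1 := by
  rw [← Matrix.map_mul, Matrix.nonsing_inv_mul _ D.isUnit_det_gram]
  simp

theorem form_eq_iff {R : Type} [CommRing R] [Algebra ℚ R] (f f' g g' : Module.End R (R ⊗[ℚ] V))
    (μ : R) : (∀ u v, D.form.baseChange R (f u) (g v) = μ * D.form.baseChange R (f' u) (g' v)) ↔
      (mat R f).transpose * D.gram.map (algebraMap ℚ R) * mat R g =
        μ • ((mat R f').transpose * D.gram.map (algebraMap ℚ R) * mat R g') := by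
  have e : ∀ f g : Module.End R (R ⊗[ℚ] V),
      (mat R f).transpose * D.gram.map (algebraMap ℚ R) * mat R g =
        LinearMap.BilinForm.toMatrix (basR V R) ((D.form.baseChange R).comp f g) := fun f g => by
    rw [← toMatrix_form, LinearMap.BilinForm.toMatrix_comp (basR V R)]
    rfl
  rw [e, e, ← map_smul, EmbeddingLike.apply_eq_iff_eq, LinearMap.BilinForm.ext_iff]
  rfl

/-- The matrices of the elements of `G(R)`. -/
def IsPoint (R : Type) [CommRing R] [Algebra ℚ R] (M : Matrix (Ix V) (Ix V) R) : Prop :=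
  (∀ b : B, Commute M ((actMat V b).map (algebraMap ℚ R))) ∧
    ∃ μ : R, IsUnit μ ∧
      M.transpose * D.gram.map (algebraMap ℚ R) * M = μ • D.gram.map (algebraMap ℚ R)

theorem isPoint_mat {R : Type} [CommRing R] [Algebra ℚ R] (g : D.points R) :
    D.IsPoint R (mat R (g : LinearMap.GeneralLinearGroup R (R ⊗[ℚ] V)).1) := by
  obtain ⟨hb, μ, hμ⟩ := g.2
  refine ⟨fun b => ?_, μ, μ.isUnit, ?_⟩
  · rw [← mat_actB]
    exact (hb b).map (mat R)
  · simpa using (D.form_eq_iff _ 1 _ 1 (μ : R)).1 hμ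

theorem exists_point {R : Type} [CommRing R] [Algebra ℚ R] {M : Matrix (Ix V) (Ix V) R}
    (hM : D.IsPoint R M) :
    ∃ g : D.points R, mat R (g : LinearMap.GeneralLinearGroup R (R ⊗[ℚ] V)).1 = M := by
  obtain ⟨hb, μ, ⟨μ, rfl⟩, hμ⟩ := hM
  have h1 : ((μ⁻¹ : Rˣ) : R) • (D.gram⁻¹.map (algebraMap ℚ R) * M.transpose *
      D.gram.map (algebraMap ℚ R)) * M = 1 := by
    rw [Matrix.smul_mul, Matrix.mul_assoc, Matrix.mul_assoc, ← Matrix.mul_assoc M.transpose, hμ,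
      Matrix.mul_smul, D.gram_inv_mul, smul_smul, Units.inv_mul, one_smul]
  have h2 := mul_eq_one_comm.1 h1
  let u : (Matrix (Ix V) (Ix V) R)ˣ := ⟨M, _, h2, h1⟩
  let g : LinearMap.GeneralLinearGroup R (R ⊗[ℚ] V) :=
    Units.map ((mat (W := V) R).symm : Matrix (Ix V) (Ix V) R →* Module.End R (R ⊗[ℚ] V)) u
  have hg : mat R g.1 = M := (mat R).apply_symm_apply M
  refine ⟨⟨g, fun b => ?_, μ, ?_⟩, hg⟩
  · have := hb b
    rw [← mat_actB, ← hg] at this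
    simpa using this.map (mat (W := V) R).symm
  · refine (D.form_eq_iff g.1 1 g.1 1 (μ : R)).2 ?_
    rw [hg, hμ, map_one]
    simp

/-- A representation of `G` in coordinates: the map on matrices with entries in `R`, with the junk
value `0` outside of `G(R)`. -/
def Rep.matRep {D : Datum B V} (ρ : D.Rep W) (R : Type) [CommRing R] [Algebra ℚ R]
    (M : Matrix (Ix V) (Ix V) R) : Matrix (Ix W) (Ix W) R :=
  open Classical in
  if h : ∃ g : D.points R, mat R (g : LinearMap.GeneralLinearGroup R (R ⊗[ℚ] V)).1 = M then
    mat R (ρ.toHom R h.choose).1 else 0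

namespace Rep

variable {D} (ρ : D.Rep W)

theorem matRep_mat {R : Type} [CommRing R] [Algebra ℚ R] (g : D.points R) :
    ρ.matRep R (mat R (g : LinearMap.GeneralLinearGroup R (R ⊗[ℚ] V)).1) =
      mat R (ρ.toHom R g).1 := by
  have h : ∃ g' : D.points R, mat R (g' : LinearMap.GeneralLinearGroup R (R ⊗[ℚ] V)).1 =
      mat R (g : LinearMap.GeneralLinearGroup R (R ⊗[ℚ] V)).1 := ⟨g, rfl⟩
  rw [matRep, dif_pos h]
  congr 3
  exact Subtype.ext (Units.ext ((mat R).injective h.choose_spec))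

theorem matRep_one (R : Type) [CommRing R] [Algebra ℚ R] : ρ.matRep R 1 = 1 := by
  have := ρ.matRep_mat (1 : D.points R)
  rw [map_one] at this
  simpa using this

theorem matRep_mul {R : Type} [CommRing R] [Algebra ℚ R] {M N : Matrix (Ix V) (Ix V) R}
    (hM : D.IsPoint R M) (hN : D.IsPoint R N) :
    ρ.matRep R (M * N) = ρ.matRep R M * ρ.matRep R N := by
  obtain ⟨g, rfl⟩ := D.exists_point hM
  obtain ⟨h, rfl⟩ := D.exists_point hN
  have := ρ.matRep_mat (g * h)
  rw [map_mul] at this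
  rw [Units.val_mul, map_mul] at this
  rw [ρ.matRep_mat, ρ.matRep_mat, ← this, ← map_mul]
  rfl

theorem matRep_natural {R S : Type} [CommRing R] [Algebra ℚ R] [CommRing S] [Algebra ℚ S]
    (φ : R →+* S) {M : Matrix (Ix V) (Ix V) R} (hM : D.IsPoint R M) :
    ρ.matRep S (M.map φ) = (ρ.matRep R M).map φ := by
  obtain ⟨g, rfl⟩ := D.exists_point hM
  have h := ρ.matRep_mat (D.pointsMap φ.toRatAlgHom g)
  rw [ρ.natural] at h
  have e₁ := mat_extendFun φ.toRatAlgHom (g : LinearMap.GeneralLinearGroup R (R ⊗[ℚ] V)).1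
  have e₂ := mat_extendFun φ.toRatAlgHom (ρ.toHom R g).1
  rw [ρ.matRep_mat]
  exact ((congrArg (ρ.matRep S) e₁).symm.trans h).trans e₂

end Rep

theorem IsPoint.map {D : Datum B V} {R S : Type} [CommRing R] [Algebra ℚ R] [CommRing S]
    [Algebra ℚ S] (φ : R →+* S) {M : Matrix (Ix V) (Ix V) R} (hM : D.IsPoint R M) :
    D.IsPoint S (M.map φ) := by
  obtain ⟨g, rfl⟩ := D.exists_point hM
  have := D.isPoint_mat (D.pointsMap φ.toRatAlgHom g)
  exact (mat_extendFun φ.toRatAlgHom (g : LinearMap.GeneralLinearGroup R (R ⊗[ℚ] V)).1) ▸ this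

end Datum

end

section

namespace Datum

variable {B V W : Type*} [Ring B] [Algebra ℚ B] [Module.Finite ℚ B] [IsSemisimpleRing B]
  [AddCommGroup V] [Module ℚ V] [Module B V] [IsScalarTower ℚ B V] [Module.Finite ℚ V]
  [AddCommGroup W] [Module ℚ W] [Module.Finite ℚ W]

/-! ### The Hodge structures on `V` and `W` -/

section Hodge

variable (D : Datum B V)

/-- The matrix of `h(i)`. -/
def cplx : Matrix (Ix V) (Ix V) ℝ := mat ℝ (D.h Complex.I)

theorem mat_h (z : ℂ) : mat ℝ (D.h z) = z.re • (1 : Matrix (Ix V) (Ix V) ℝ) + z.im • D.cplx := by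
  have h : z = algebraMap ℝ ℂ z.re + z.im • Complex.I := by
    simp
  conv_lhs => rw [h]
  rw [map_add, map_add, AlgHom.commutes, AlgEquiv.commutes, map_smul, map_smul,
    Algebra.algebraMap_eq_smul_one]
  rfl

theorem cplx_mul_cplx : D.cplx * D.cplx = -1 := by
  rw [cplx, ← map_mul, ← map_mul, Complex.I_mul_I, map_neg, map_neg, map_one, map_one]

theorem commute_cplx (b : B) : Commute D.cplx ((actMat V b).map (algebraMap ℚ ℝ)) := by
  rw [← mat_actB]
  exact (D.h_comm _ b).map (mat ℝ)

theorem transpose_cplx_mul : D.cplx.transpose * D.gram.map (algebraMap ℚ ℝ) =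
    -(D.gram.map (algebraMap ℚ ℝ) * D.cplx) := by
  have := (D.form_eq_iff (D.h Complex.I) 1 1 (D.h (conj Complex.I)) 1).1 fun u v => by
    rw [one_mul]; exact D.h_adjoint _ u v
  rw [map_one, Complex.conj_I, map_neg, map_neg] at this
  simpa [cplx] using this

/-- The points `x + y h(i)` of `G` with values in an algebra over the real numbers. -/
theorem isPoint_add_smul_cplx {R : Type} [CommRing R] [Algebra ℚ R] (ψ : ℝ →+* R) {x y : R}
    (hxy : IsUnit (x ^ 2 + y ^ 2)) :
    D.IsPoint R (x • 1 + y • D.cplx.map ψ) := by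
  have hψ : ∀ M : Matrix (Ix V) (Ix V) ℚ, (M.map (algebraMap ℚ ℝ)).map ψ =
      M.map (algebraMap ℚ R) := fun M => by
    ext a b
    exact ψ.toRatAlgHom.commutes _
  refine ⟨fun b => ?_, _, hxy, ?_⟩
  · have := (D.commute_cplx b).map ψ.mapMatrix
    rw [RingHom.mapMatrix_apply, RingHom.mapMatrix_apply, hψ] at this
    exact ((Commute.one_left _).smul_left x).add_left (this.smul_left y)
  · have h1 := congrArg ψ.mapMatrix D.transpose_cplx_mul
    rw [map_neg, map_mul, map_mul, RingHom.mapMatrix_apply, RingHom.mapMatrix_apply,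
      RingHom.mapMatrix_apply, hψ, Matrix.transpose_map] at h1
    have h2 := congrArg ψ.mapMatrix D.cplx_mul_cplx
    rw [map_neg, map_mul, map_one, RingHom.mapMatrix_apply] at h2
    rw [Matrix.transpose_add, Matrix.transpose_smul, Matrix.transpose_smul, Matrix.transpose_one,
      add_mul, Matrix.smul_mul, Matrix.smul_mul, h1]
    simp only [mul_add, add_mul, smul_mul_assoc, mul_smul_comm, mul_one, one_mul, neg_mul,
      mul_assoc, h2, mul_neg, smul_add, smul_neg, smul_smul]
    module

variable {D} {ρ : D.Rep W}

/-- If the Hodge type of `W` is contained in `{(-1, 0), (0, -1)}`, then `h(x + iy)` acts on it as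
`x + yJ` for a complex structure `J`. -/
theorem Rep.HodgeTypeIn.exists_cplx (hρ : ρ.HodgeTypeIn {(-1, 0), (0, -1)}) :
    ∃ J : Matrix (Ix W) (Ix W) ℝ, J * J = -1 ∧ ∀ z : ℂ, z ≠ 0 →
      ρ.matRep ℝ (z.re • 1 + z.im • D.cplx) = z.re • 1 + z.im • J := by
  obtain ⟨n, e, pq, he⟩ := hρ
  set T : ℂˣ → Module.End ℝ (ℝ ⊗[ℚ] W) := fun z => (ρ.toHom ℝ (D.hPoint z)).1 with hT
  set i : ℂˣ := Units.mk0 Complex.I Complex.I_ne_zero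
  have inj : ∀ f g : Module.End ℝ (ℝ ⊗[ℚ] W), f.baseChange ℂ = g.baseChange ℂ → f = g :=
    fun f g h => LinearMap.ext fun x =>
      Module.FaithfullyFlat.tensorProduct_mk_injective (A := ℝ) (B := ℂ) _
        (by simpa using LinearMap.congr_fun h (1 ⊗ₜ x))
  have hTz : ∀ z : ℂˣ, T z = (z : ℂ).re • 1 + (z : ℂ).im • T i := fun z => by
    refine inj _ _ (e.ext fun j => ?_)
    obtain ⟨hj, hz⟩ := he j
    rw [LinearMap.baseChange_add, LinearMap.baseChange_smul, LinearMap.baseChange_smul,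
      LinearMap.add_apply, LinearMap.smul_apply, LinearMap.smul_apply]
    have h1 : (1 : Module.End ℝ (ℝ ⊗[ℚ] W)).baseChange ℂ (e j) = e j := by
      rw [Module.End.one_eq_id, LinearMap.baseChange_id]; rfl
    have hz1 := hz z
    have hz2 := hz i
    rw [h1]
    change (T z).baseChange ℂ (e j) = _ at hz1
    change (T i).baseChange ℂ (e j) = _ at hz2
    rw [hz1, hz2, ← algebraMap_smul ℂ (z : ℂ).re, ← algebraMap_smul ℂ (z : ℂ).im, smul_smul,
      ← add_smul]
    congr 1
    rcases hj with hj | hj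
    · rw [hj]; simp [i]
    · rw [hj]; simp [i, Complex.ext_iff]
  have hmat : ∀ z : ℂˣ, ρ.matRep ℝ ((z : ℂ).re • 1 + (z : ℂ).im • D.cplx) =
      (z : ℂ).re • 1 + (z : ℂ).im • mat ℝ (T i) := fun z => by
    rw [← mat_h, ← map_one (mat ℝ), ← map_smul, ← map_smul, ← map_add, ← hTz]
    exact ρ.matRep_mat (D.hPoint z)
  refine ⟨mat ℝ (T i), ?_, fun z hz => hmat (Units.mk0 z hz)⟩
  have h1 : T i * T i = T (i * i) := by simp only [hT, map_mul]; rfl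
  rw [← map_mul, h1, hTz]
  simp [i]

/-- The identity `ρ(x + y h(i)) = x + y J` for real numbers `x` and `y` extends to `x` and `y` in
any algebra over the real numbers, since the real points are dense in the torus
`x² + y² ≠ 0`. -/
theorem Rep.matRep_add_smul_cplx {J : Matrix (Ix W) (Ix W) ℝ}
    (hJ : ∀ z : ℂ, z ≠ 0 → ρ.matRep ℝ (z.re • 1 + z.im • D.cplx) = z.re • 1 + z.im • J)
    {R : Type} [CommRing R] [Algebra ℚ R] (ψ : ℝ →+* R) {x y : R} (hxy : IsUnit (x ^ 2 + y ^ 2)) :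
    ρ.matRep R (x • 1 + y • D.cplx.map ψ) = x • 1 + y • J.map ψ := by
  let q : MvPolynomial (Fin 2) ℝ := MvPolynomial.X 0 ^ 2 + MvPolynomial.X 1 ^ 2
  let L := Localization.Away q
  let c : MvPolynomial (Fin 2) ℝ →+* L := algebraMap _ L
  have hq : IsUnit (c (MvPolynomial.X 0) ^ 2 + c (MvPolynomial.X 1) ^ 2) := by
    have := IsLocalization.Away.algebraMap_isUnit (S := L) q
    simpa [q] using this
  -- specialisation of the universal point
  have lift : ∀ {S : Type} [CommRing S] (θ : ℝ →+* S) (a b : S), IsUnit (a ^ 2 + b ^ 2) →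
      ∃ φ : L →+* S, (∀ p, φ (c p) = MvPolynomial.eval₂ θ ![a, b] p) := by
    intro S _ θ a b hab
    have : IsUnit (MvPolynomial.eval₂Hom θ ![a, b] q) := by simpa [q] using hab
    exact ⟨IsLocalization.Away.lift q this, fun p => IsLocalization.Away.lift_eq q this p⟩
  have spec : ∀ {S : Type} [CommRing S] {m : Type} [Fintype m] [DecidableEq m] (θ : ℝ →+* S)
      (a b : S) (φ : L →+* S), (∀ p, φ (c p) = MvPolynomial.eval₂ θ ![a, b] p) →
      ∀ K : Matrix m m ℝ, (c (MvPolynomial.X 0) • (1 : Matrix m m L) +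
        c (MvPolynomial.X 1) • K.map (c.comp MvPolynomial.C)).map φ = a • 1 + b • K.map θ := by
    intro S _ m _ _ θ a b φ hφ K
    ext s t
    simp [hφ, Matrix.one_apply, apply_ite φ]
  have hpt := D.isPoint_add_smul_cplx (c.comp MvPolynomial.C) hq
  have key : ρ.matRep L (c (MvPolynomial.X 0) • 1 +
      c (MvPolynomial.X 1) • D.cplx.map (c.comp MvPolynomial.C)) =
      c (MvPolynomial.X 0) • 1 + c (MvPolynomial.X 1) • J.map (c.comp MvPolynomial.C) := by
    ext s t
    rw [← sub_eq_zero]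
    set δ := ρ.matRep L _ s t - _ with hδ
    obtain ⟨N, p, hp⟩ := IsLocalization.Away.surj q δ
    have hp0 : p * q = 0 := by
      refine MvPolynomial.funext fun v => ?_
      rw [map_mul, map_zero]
      by_cases hv : MvPolynomial.eval v q = 0
      · rw [hv, mul_zero]
      have hv' : v 0 ^ 2 + v 1 ^ 2 ≠ 0 := by simpa [q] using hv
      obtain ⟨φ, hφ⟩ := lift (RingHom.id ℝ) (v 0) (v 1) hv'.isUnit
      have hδ0 : φ δ = 0 := by
        have h1 := ρ.matRep_natural φ hpt
        rw [spec _ _ _ φ hφ, show D.cplx.map (RingHom.id ℝ) = D.cplx from rfl] at h1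
        have h2 := hJ ⟨v 0, v 1⟩ (fun h => hv' (by
          rw [Complex.ext_iff] at h
          simp only [Complex.zero_re, Complex.zero_im] at h
          simp [h.1, h.2]))
        have h3 := spec _ _ _ φ hφ J
        rw [hδ, map_sub, sub_eq_zero]
        have h4 := congrFun (congrFun (h1.symm.trans (h2.trans h3.symm)) s) t
        exact h4
      have := congrArg φ hp
      rw [map_mul, hδ0, zero_mul, hφ] at this
      have e : MvPolynomial.eval₂ (RingHom.id ℝ) ![v 0, v 1] p = MvPolynomial.eval v p := by
        rw [MvPolynomial.eval, MvPolynomial.coe_eval₂Hom]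
        congr
        ext k; fin_cases k <;> rfl
      rw [← e, ← this, zero_mul]
    have hq0 : q ≠ 0 := fun h => by
      have := congrArg (MvPolynomial.eval ![(1 : ℝ), 0]) h
      simp [q] at this
    have hp1 : p = 0 := (mul_eq_zero.1 hp0).resolve_right hq0
    rw [hp1, map_zero] at hp
    exact ((IsLocalization.Away.algebraMap_isUnit (S := L) q).pow N).mul_left_eq_zero.1 hp
  obtain ⟨φ, hφ⟩ := lift ψ x y hxy
  have := ρ.matRep_natural φ hpt
  rwa [spec _ _ _ φ hφ, key, spec _ _ _ φ hφ] at this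

end Hodge

end Datum

end

section

/-! ### Decomposition of an alternating form into symplectic blocks -/

variable {d : Type} [Fintype d] [DecidableEq d] {ι : Type} [Fintype ι] {m l : ι → Type}
  [∀ i, Fintype (m i)] [∀ i, Fintype (l i)] [∀ i, DecidableEq (l i)]

/-- An orthogonal decomposition of the free module `R ^ d` with the alternating form `Ω` into
standard symplectic spaces, indexed by pairs `i`, `α` with `α : m i`; those with the same `i` have
the same rank. The columns of `Q i α` form the basis of the summand, and `Q' i α` is the
projection onto it. -/
structure SympFrame (R : Type) [CommRing R] (Ω : Matrix d d R) (m l : ι → Type)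
    [∀ i, Fintype (m i)] [∀ i, Fintype (l i)] [∀ i, DecidableEq (l i)] where
  Q : ∀ i, m i → Matrix d (l i ⊕ l i) R
  Q' : ∀ i, m i → Matrix (l i ⊕ l i) d R
  mul_same : ∀ i α, Q' i α * Q i α = 1
  mul_ne : ∀ i α β, α ≠ β → Q' i α * Q i β = 0
  mul_block : ∀ i j, i ≠ j → ∀ α β, Q' i α * Q j β = 0
  sum_eq : ∑ i, ∑ α, Q i α * Q' i α = 1
  transpose_mul : ∀ i α, (Q i α).transpose * Ω = Matrix.J (l i) R * Q' i α
  mul_eq : ∀ i α, Ω * Q i α = (Q' i α).transpose * Matrix.J (l i) R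

namespace SympFrame

variable {R S : Type} [CommRing R] [CommRing S] {Ω : Matrix d d R}

/-- Extension of scalars of a symplectic frame. -/
@[simps]
def map (fr : SympFrame R Ω m l) (φ : R →+* S) : SympFrame S (Ω.map φ) m l where
  Q i α := (fr.Q i α).map φ
  Q' i α := (fr.Q' i α).map φ
  mul_same i α := by rw [← Matrix.map_mul, fr.mul_same]; simp
  mul_ne i α β h := by rw [← Matrix.map_mul, fr.mul_ne i α β h]; simp
  mul_block i j h α β := by rw [← Matrix.map_mul, fr.mul_block i j h]; simp
  sum_eq := by
    simp only [← Matrix.map_mul]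
    change ∑ i, ∑ α, φ.mapMatrix (fr.Q i α * fr.Q' i α) = 1
    simp only [← map_sum, fr.sum_eq, map_one]
  transpose_mul i α := by
    have hJ : (Matrix.J (l i) R).map φ = Matrix.J (l i) S := by
      simp [Matrix.J, Matrix.fromBlocks_map, Matrix.map_neg]
    rw [← hJ, ← Matrix.map_mul, ← fr.transpose_mul, Matrix.map_mul, Matrix.transpose_map]
  mul_eq i α := by
    have hJ : (Matrix.J (l i) R).map φ = Matrix.J (l i) S := by
      simp [Matrix.J, Matrix.fromBlocks_map, Matrix.map_neg]
    rw [← hJ, ← Matrix.transpose_map, ← Matrix.map_mul, ← Matrix.map_mul, fr.mul_eq]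

variable (fr : SympFrame R Ω m l)

/-- The matrix acting on each of the summands with index `i` by the `i`-th member of a family. -/
def act (x : BlockFam l R) : Matrix d d R := ∑ i, ∑ α, fr.Q i α * x i * fr.Q' i α

theorem proj_mul_act [DecidableEq ι] (x : BlockFam l R) (i : ι) (α : m i) :
    fr.Q' i α * fr.act x = x i * fr.Q' i α := by
  rw [act, Matrix.mul_sum, Finset.sum_eq_single i, Matrix.mul_sum, Finset.sum_eq_single α]
  · rw [← Matrix.mul_assoc, ← Matrix.mul_assoc, fr.mul_same, Matrix.one_mul]
  · intro β _ hβ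
    rw [← Matrix.mul_assoc, ← Matrix.mul_assoc, fr.mul_ne i α β hβ.symm, Matrix.zero_mul,
      Matrix.zero_mul]
  · simp
  · intro j _ hj
    rw [Matrix.mul_sum]
    refine Finset.sum_eq_zero fun β _ => ?_
    rw [← Matrix.mul_assoc, ← Matrix.mul_assoc, fr.mul_block i j hj.symm, Matrix.zero_mul,
      Matrix.zero_mul]
  · simp

theorem act_mul_incl [DecidableEq ι] (x : BlockFam l R) (i : ι) (α : m i) :
    fr.act x * fr.Q i α = fr.Q i α * x i := by
  rw [act, Matrix.sum_mul, Finset.sum_eq_single i, Matrix.sum_mul, Finset.sum_eq_single α]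
  · rw [Matrix.mul_assoc, fr.mul_same, Matrix.mul_one]
  · intro β _ hβ
    rw [Matrix.mul_assoc, fr.mul_ne i β α hβ, Matrix.mul_zero]
  · simp
  · intro j _ hj
    rw [Matrix.sum_mul]
    refine Finset.sum_eq_zero fun β _ => ?_
    rw [Matrix.mul_assoc, fr.mul_block j i hj, Matrix.mul_zero]
  · simp

theorem act_one : fr.act 1 = 1 := by simp [act, fr.sum_eq]

theorem act_mul [DecidableEq ι] (x y : BlockFam l R) : fr.act (x * y) = fr.act x * fr.act y := by
  rw [act.eq_1 fr y, Matrix.mul_sum, act]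
  refine Finset.sum_congr rfl fun i _ => ?_
  rw [Matrix.mul_sum]
  refine Finset.sum_congr rfl fun α _ => ?_
  rw [← Matrix.mul_assoc, ← Matrix.mul_assoc, act_mul_incl, Pi.mul_apply, Matrix.mul_assoc _ (x i)]

theorem map_act (φ : R →+* S) (x : BlockFam l R) :
    (fr.map φ).act (mapFam φ x) = (fr.act x).map φ := by
  change _ = φ.mapMatrix (fr.act x)
  simp only [act, map_sum]
  simp [RingHom.mapMatrix_apply, Matrix.map_mul]

theorem act_smul_one (t : R) : fr.act (t • 1) = t • 1 := by
  rw [← fr.sum_eq]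
  simp [act, Finset.smul_sum]

/-- The cocharacter `t ↦ diag(t, 1)` acts through the projection onto the span of the first
halves of the bases. -/
theorem act_cochar {P : Matrix d d R} (hP : ∀ i α, P * fr.Q i α =
    fr.Q i α * (Matrix.fromBlocks 1 0 0 0 : Matrix (l i ⊕ l i) (l i ⊕ l i) R)) (t : R) :
    fr.act (cochar t) = 1 - P + t • P := by
  have h : ∀ i, (cochar t : BlockFam l R) i = 1 + (t - 1) • Matrix.fromBlocks 1 0 0 0 := by
    intro i
    rw [← Matrix.fromBlocks_one, Matrix.fromBlocks_smul, Matrix.fromBlocks_add]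
    simp only [cochar, blk, Pi.smul_apply, Pi.one_apply, Pi.zero_apply, smul_zero, add_zero]
    congr 1
    module
  have e : P = ∑ i, ∑ α, P * fr.Q i α * fr.Q' i α := by
    simp only [Matrix.mul_assoc, ← Matrix.mul_sum, fr.sum_eq, Matrix.mul_one]
  have : fr.act (cochar t) = 1 + (t - 1) • P := by
    conv_rhs => rw [e, ← fr.sum_eq]
    simp only [act, h, Finset.smul_sum, ← Finset.sum_add_distrib, hP]
    refine Finset.sum_congr rfl fun i _ => Finset.sum_congr rfl fun α _ => ?_
    rw [Matrix.mul_add, Matrix.add_mul, Matrix.mul_one, Matrix.mul_smul, Matrix.smul_mul]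
  rw [this]
  module

theorem commute_act [DecidableEq ι] (x : BlockFam l R) (i : ι) (α β : m i) :
    Commute (fr.act x) (fr.Q i α * fr.Q' i β) := by
  rw [Commute, SemiconjBy, ← Matrix.mul_assoc, act_mul_incl, Matrix.mul_assoc _ _ (fr.act x),
    proj_mul_act, Matrix.mul_assoc]

/-- Matrices commuting with all the isomorphisms between summands with the same index are
obtained from families of matrices. -/
theorem eq_act_of_commute {M : Matrix d d R} (hM : ∀ i α β, Commute M (fr.Q i α * fr.Q' i β))
    (α₀ : ∀ i, m i) : M = fr.act fun i => fr.Q' i (α₀ i) * M * fr.Q i (α₀ i) := by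
  have h : ∀ i α, fr.Q i α * (fr.Q' i (α₀ i) * M * fr.Q i (α₀ i)) * fr.Q' i α =
      M * (fr.Q i α * fr.Q' i α) := fun i α => by
    calc _ = (fr.Q i α * fr.Q' i (α₀ i)) * M * (fr.Q i (α₀ i) * fr.Q' i α) := by
          simp only [Matrix.mul_assoc]
      _ = M * fr.Q i α * (fr.Q' i (α₀ i) * fr.Q i (α₀ i)) * fr.Q' i α := by
          rw [← (hM i α (α₀ i)).eq]; simp only [Matrix.mul_assoc]
      _ = _ := by rw [fr.mul_same, Matrix.mul_one, Matrix.mul_assoc]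
  simp only [act, h, ← Matrix.mul_sum, fr.sum_eq, Matrix.mul_one]

theorem transpose_act_mul_mul [DecidableEq ι] {x : BlockFam l R} {μ : R} (hx : IsSim x μ) :
    (fr.act x).transpose * Ω * fr.act x = μ • Ω := by
  have h : ∀ i α, (fr.act x).transpose * Ω * (fr.Q i α * x i * fr.Q' i α) =
      μ • (Ω * (fr.Q i α * fr.Q' i α)) := fun i α => by
    calc _ = (fr.act x).transpose * (Ω * fr.Q i α) * x i * fr.Q' i α := by
          simp only [Matrix.mul_assoc]
      _ = (fr.Q' i α * fr.act x).transpose * Matrix.J (l i) R * x i * fr.Q' i α := by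
          rw [fr.mul_eq, Matrix.transpose_mul]; simp only [Matrix.mul_assoc]
      _ = (fr.Q' i α).transpose * ((x i).transpose * Matrix.J (l i) R * x i) * fr.Q' i α := by
          rw [proj_mul_act, Matrix.transpose_mul]; simp only [Matrix.mul_assoc]
      _ = μ • (((fr.Q' i α).transpose * Matrix.J (l i) R) * fr.Q' i α) := by
          rw [hx i]; simp
      _ = _ := by rw [← fr.mul_eq, Matrix.mul_assoc]
  generalize (fr.act x).transpose * Ω = M at h
  rw [act]
  simp only [Matrix.mul_sum, h]
  simp only [← Finset.smul_sum, ← Matrix.mul_sum, fr.sum_eq, Matrix.mul_one]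

theorem isSim_of_commute {M : Matrix d d R} (hM : ∀ i α β, Commute M (fr.Q i α * fr.Q' i β))
    {μ : R} (hμ : M.transpose * Ω * M = μ • Ω) (α₀ : ∀ i, m i) :
    IsSim (fun i => fr.Q' i (α₀ i) * M * fr.Q i (α₀ i)) μ := fun i => by
  beta_reduce
  generalize α₀ i = α
  calc _ = (fr.Q i α).transpose * M.transpose * ((fr.Q' i α).transpose * Matrix.J (l i) R) *
        (fr.Q' i α * M * fr.Q i α) := by
        simp only [Matrix.transpose_mul, Matrix.mul_assoc]
    _ = (fr.Q i α).transpose * M.transpose * Ω * ((fr.Q i α * fr.Q' i α) * M) * fr.Q i α := by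
        rw [← fr.mul_eq]; simp only [Matrix.mul_assoc]
    _ = (fr.Q i α).transpose * (M.transpose * Ω * M) * fr.Q i α * (fr.Q' i α * fr.Q i α) := by
        rw [← (hM i α α).eq]; simp only [Matrix.mul_assoc]
    _ = μ • ((fr.Q i α).transpose * Ω * fr.Q i α) := by
        rw [hμ, fr.mul_same, Matrix.mul_one]; simp
    _ = _ := by rw [fr.transpose_mul, Matrix.mul_assoc, fr.mul_same, Matrix.mul_one]

end SympFrame

/-- If matrix units act on a symplectic space over a field in such a way that the involution
given by the form is the transposition, and all of them commute with the projection `P` onto one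
of two complementary Lagrangian subspaces, then the space decomposes accordingly. -/
theorem exists_sympFrame {K : Type} [Field K] {Ω Ω' P : Matrix d d K} (hΩ : Ω * Ω' = 1)
    (hskew : Ω.transpose = -Ω) (hP : P * P = P) (hPΩ : P.transpose * Ω = Ω * (1 - P))
    {u : ∀ i, m i → m i → Matrix d d K} (hu : IsMatrixUnits u) (hu1 : ∑ i, ∑ α, u i α α = 1)
    (huΩ : ∀ i α β, (u i α β).transpose * Ω = Ω * u i β α)
    (huP : ∀ i α β, Commute (u i α β) P) (α₀ : ∀ i, m i) :
    ∃ (g : ι → ℕ) (fr : SympFrame K Ω m fun i => Fin (g i)),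
      (∀ i α β, fr.Q i α * fr.Q' i β = u i α β) ∧
      ∀ i α, P * fr.Q i α = fr.Q i α * (Matrix.fromBlocks 1 0 0 0 :
        Matrix (Fin (g i) ⊕ Fin (g i)) (Fin (g i) ⊕ Fin (g i)) K) := by
  choose g Q Q' h1 h2 h3 h4 using fun i => exists_symplectic_frame hΩ hskew
    (hu.mul_same i (α₀ i) (α₀ i) (α₀ i)) hP (huP i (α₀ i) (α₀ i)).eq (huΩ i (α₀ i) (α₀ i)) hPΩ
  have hQ : ∀ i, u i (α₀ i) (α₀ i) * Q i = Q i := fun i => by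
    rw [← h2, Matrix.mul_assoc, h1, Matrix.mul_one]
  have hQ' : ∀ i, Q' i * u i (α₀ i) (α₀ i) = Q' i := fun i => by
    rw [← h2, ← Matrix.mul_assoc, h1, Matrix.one_mul]
  have hQΩ : ∀ i, (Q i).transpose * Ω = Matrix.J (Fin (g i)) K * Q' i := fun i => by
    rw [← h3, Matrix.mul_assoc _ (Q i), h2, Matrix.mul_assoc, ← huΩ, ← Matrix.mul_assoc,
      ← Matrix.transpose_mul, hQ]
  have e : ∀ i α β, Q' i * u i (α₀ i) α * (u i α β * Q i) = Q' i * u i (α₀ i) β * Q i :=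
    fun i α β => by
      rw [Matrix.mul_assoc, ← Matrix.mul_assoc (u i _ _), hu.mul_same, ← Matrix.mul_assoc]
  have tm : ∀ i α, (u i α (α₀ i) * Q i).transpose * Ω =
      Matrix.J (Fin (g i)) K * (Q' i * u i (α₀ i) α) := fun i α => by
    rw [Matrix.transpose_mul, Matrix.mul_assoc, huΩ, ← Matrix.mul_assoc, hQΩ, Matrix.mul_assoc]
  have e' : ∀ i α β, (u i α (α₀ i) * Q i) * (Q' i * u i (α₀ i) β) = u i α β := fun i α β => by
    rw [Matrix.mul_assoc, ← Matrix.mul_assoc (Q i), h2, hu.mul_same, hu.mul_same]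
  refine ⟨g, ⟨fun i α => u i α (α₀ i) * Q i, fun i α => Q' i * u i (α₀ i) α, ?_, ?_, ?_, ?_, tm,
    ?_⟩, e', ?_⟩
  · intro i α
    rw [e, Matrix.mul_assoc, hQ, h1]
  · intro i α β h
    rw [Matrix.mul_assoc, ← Matrix.mul_assoc (u i _ _), hu.mul_ne _ _ _ _ _ h, Matrix.zero_mul,
      Matrix.mul_zero]
  · intro i j h α β
    rw [Matrix.mul_assoc, ← Matrix.mul_assoc (u i _ _), hu.mul_block _ _ h, Matrix.zero_mul,
      Matrix.mul_zero]
  · simp only [e', hu1]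
  · intro i α
    have := congrArg Matrix.transpose (tm i α)
    rw [Matrix.transpose_mul, Matrix.transpose_transpose, hskew, Matrix.transpose_mul,
      Matrix.J_transpose, Matrix.neg_mul, Matrix.mul_neg] at this
    exact neg_injective this
  · intro i α
    rw [← Matrix.mul_assoc, ← (huP i α (α₀ i)).eq, Matrix.mul_assoc, h4, Matrix.mul_assoc]

end

section

/-! ### The action of `B_ℝ` in coordinates -/

namespace Datum

variable {B V W : Type*} [Ring B] [Algebra ℚ B] [Module.Finite ℚ B] [IsSemisimpleRing B]
  [AddCommGroup V] [Module ℚ V] [Module B V] [IsScalarTower ℚ B V] [Module.Finite ℚ V]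
  [AddCommGroup W] [Module ℚ W] [Module.Finite ℚ W]

variable (B V) in
/-- The action of `B_ℝ` on `V_ℝ`, in coordinates. -/
def actReal : ℝ ⊗[ℚ] B →ₐ[ℝ] Matrix (Ix V) (Ix V) ℝ :=
  Algebra.TensorProduct.lift (Algebra.ofId ℝ _)
    (((mat (W := V) ℝ).toAlgHom.restrictScalars ℚ).comp
      ((Module.End.baseChangeHom ℚ ℝ V).comp (Algebra.lsmul ℚ ℚ V)))
    fun r _ => by rw [Algebra.ofId_apply]; exact Algebra.commute_algebraMap_left r _

theorem actReal_tmul (r : ℝ) (b : B) :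
    actReal B V (r ⊗ₜ b) = r • (actMat V b).map (algebraMap ℚ ℝ) := by
  rw [actReal, Algebra.TensorProduct.lift_tmul, Algebra.ofId_apply, ← Algebra.smul_def, ← mat_actB]
  rfl

variable (D : Datum B V)

theorem transpose_actMat_mul (b : B) :
    (actMat V b).transpose * D.gram = D.gram * actMat V (D.invol b) := by
  have h : ∀ f g : Module.End ℚ V, LinearMap.BilinForm.toMatrix (Module.finBasis ℚ V)
      (D.form.comp f g) = (LinearMap.toMatrixAlgEquiv (Module.finBasis ℚ V) f).transpose *
        D.gram * LinearMap.toMatrixAlgEquiv (Module.finBasis ℚ V) g := fun f g =>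
    LinearMap.BilinForm.toMatrix_comp _ _ _ _ _
  have h1 := h (Algebra.lsmul ℚ ℚ V b) 1
  have h2 := h 1 (Algebra.lsmul ℚ ℚ V (D.invol b))
  rw [map_one, Matrix.mul_one] at h1
  rw [map_one, Matrix.transpose_one, Matrix.one_mul] at h2
  rw [actMat, actMat, ← h1, ← h2]
  congr 1
  exact LinearMap.BilinForm.ext fun u v => D.form_smul b u v

theorem transpose_actReal_mul (b : ℝ ⊗[ℚ] B) :
    (actReal B V b).transpose * D.gram.map (algebraMap ℚ ℝ) =
      D.gram.map (algebraMap ℚ ℝ) * actReal B V (D.invol.baseChange ℝ b) := by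
  induction b with
  | zero => simp
  | add x y hx hy => simp only [map_add, Matrix.transpose_add, add_mul, mul_add, hx, hy]
  | tmul r b =>
    rw [LinearMap.baseChange_tmul, actReal_tmul, actReal_tmul, Matrix.transpose_smul,
      Matrix.smul_mul, Matrix.mul_smul, ← Matrix.transpose_map, ← Matrix.map_mul,
      transpose_actMat_mul, Matrix.map_mul]

theorem commute_map_actReal {R : Type} [CommRing R] [Algebra ℚ R] (ψ : ℝ →+* R)
    {M : Matrix (Ix V) (Ix V) R} (hM : ∀ b : B, Commute M ((actMat V b).map (algebraMap ℚ R)))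
    (b : ℝ ⊗[ℚ] B) : Commute M ((actReal B V b).map ψ) := by
  change Commute M (ψ.mapMatrix _)
  induction b with
  | zero => simp
  | add x y hx hy => rw [map_add, map_add]; exact hx.add_right hy
  | tmul r b =>
    have e : ψ.mapMatrix (actReal B V (r ⊗ₜ b)) =
        ψ r • (actMat V b).map (algebraMap ℚ R) := by
      rw [actReal_tmul]
      ext s t
      have : ψ (algebraMap ℚ ℝ (actMat V b s t)) = algebraMap ℚ R (actMat V b s t) :=
        ψ.toRatAlgHom.commutes _
      rw [RingHom.mapMatrix_apply, Matrix.map_apply, Matrix.smul_apply, smul_eq_mul, map_mul,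
        Matrix.map_apply, this, Matrix.smul_apply, Matrix.map_apply, smul_eq_mul]
    rw [e]
    exact (hM b).smul_right _

/-- If `(B_ℝ, *)` is a product of real matrix algebras with transposition, then its matrix units
act on `V_ℝ` in such a way that the involution given by the pairing is transposition. -/
theorem OnlySymplecticFactors.exists_units {D : Datum B V} (hD : D.OnlySymplecticFactors) :
    ∃ (r : ℕ) (n : Fin r → ℕ) (u : ∀ i, Fin (n i) → Fin (n i) → Matrix (Ix V) (Ix V) ℝ),
      (∀ i, 0 < n i) ∧ IsMatrixUnits u ∧ (∑ i, ∑ α, u i α α = 1) ∧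
      (∀ i α β, (u i α β).transpose * D.gram.map (algebraMap ℚ ℝ) =
        D.gram.map (algebraMap ℚ ℝ) * u i β α) ∧
      (∀ i α β, Commute (u i α β) D.cplx) ∧
      (∀ {R : Type} [CommRing R] [Algebra ℚ R] (ψ : ℝ →+* R) {M : Matrix (Ix V) (Ix V) R},
        (∀ b : B, Commute M ((actMat V b).map (algebraMap ℚ R))) ↔
          ∀ i α β, Commute M ((u i α β).map ψ)) := by
  obtain ⟨r, n, e, hn, he⟩ := hD
  let Θ : MatFam (fun i => Fin (n i)) ℝ →ₐ[ℝ] Matrix (Ix V) (Ix V) ℝ :=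
    (actReal B V).comp e.symm.toAlgHom
  have hΘ : ∀ b, Θ (e b) = actReal B V b := fun b => by simp [Θ]
  have hΘt : ∀ y, (Θ y).transpose * D.gram.map (algebraMap ℚ ℝ) =
      D.gram.map (algebraMap ℚ ℝ) * Θ (tr y) := fun y => by
    obtain ⟨b, rfl⟩ := e.surjective y
    have : tr (e b) = e (D.invol.baseChange ℝ b) := funext fun i => (he b i).symm
    rw [this, hΘ, hΘ, transpose_actReal_mul]
  have hΘ1 : Θ.toLinearMap = unitsLin ℝ fun i α β => Θ (unitFam ℝ i α β) :=
    linearMap_ext_unitFam fun i α β => by rw [unitsLin_unitFam]; rfl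
  refine ⟨r, n, fun i α β => Θ (unitFam ℝ i α β), hn, ⟨?_, ?_, ?_⟩, ?_, ?_, ?_, ?_⟩
  · intro i a b c
    rw [← map_mul, unitFam_same_mul, if_pos rfl]
  · intro i a b c c' h
    rw [← map_mul, unitFam_same_mul, if_neg h, map_zero]
  · intro i j h a b c c'
    have := unitFam_mul_block (R := ℝ) (m := fun i => Fin (n i)) h a b c c' 1
    rw [mul_one] at this
    rw [← map_mul, this, map_zero]
  · simp only [← map_sum, sum_unitFam, map_one]
  · intro i α β
    rw [hΘt, tr_unitFam]
  · intro i α β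
    exact (commute_map_actReal (RingHom.id ℝ) D.commute_cplx _).symm
  · intro R _ _ ψ M
    refine ⟨fun h i α β => commute_map_actReal ψ h _, fun h b => ?_⟩
    have e1 : (actMat V b).map (algebraMap ℚ R) = ψ.mapMatrix (actReal B V (1 ⊗ₜ b)) := by
      rw [actReal_tmul, one_smul]
      ext s t
      exact (ψ.toRatAlgHom.commutes _).symm
    have e2 : actReal B V (1 ⊗ₜ b) = unitsLin ℝ (fun i α β => Θ (unitFam ℝ i α β))
        (e (1 ⊗ₜ b)) := by
      rw [← hΘ1, ← hΘ]; rfl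
    rw [e1, e2, unitsLin_apply]
    simp only [map_sum]
    refine Commute.sum_right _ _ _ fun i _ => Commute.sum_right _ _ _ fun α _ =>
      Commute.sum_right _ _ _ fun β _ => ?_
    rw [SimRep.mapMatrix_smul]
    exact (h i α β).smul_right _

end Datum

end

section

/-! ### The Hodge cocharacter -/

section HodgeProj

variable {n : Type} [Fintype n] [DecidableEq n]

/-- For a complex structure `J` on a real vector space, the projection of its complexification
onto the eigenspace of `J` for the eigenvalue `i`. -/
def hodgeProj (J : Matrix n n ℝ) : Matrix n n ℂ :=
  (2⁻¹ : ℂ) • (1 - Complex.I • J.map Complex.ofRealHom)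

theorem hodgeProj_mul_self {J : Matrix n n ℝ} (hJ : J * J = -1) :
    hodgeProj J * hodgeProj J = hodgeProj J := by
  have h := congrArg Complex.ofRealHom.mapMatrix hJ
  rw [map_mul, map_neg, map_one, RingHom.mapMatrix_apply] at h
  simp only [hodgeProj, smul_mul_smul_comm, sub_mul, mul_sub, one_mul, mul_one, h,
    Complex.I_mul_I]
  module

/-- The complex point `(1 - P) + t P` of the torus of the `x + y J` has `x = 1 + (t - 1) / 2` and
`y = (t - 1) / 2i`. -/
theorem one_sub_hodgeProj_add (J : Matrix n n ℝ) {R : Type} [CommRing R] [Algebra ℂ R] (t : R) :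
    1 - scal R (hodgeProj J) + t • scal R (hodgeProj J) =
      (1 + (t - 1) * algebraMap ℂ R 2⁻¹) • 1 +
        (-((t - 1) * algebraMap ℂ R 2⁻¹ * algebraMap ℂ R Complex.I)) •
          J.map ((algebraMap ℂ R).comp Complex.ofRealHom) := by
  have e : scal R (hodgeProj J) = algebraMap ℂ R 2⁻¹ • (1 - algebraMap ℂ R Complex.I •
      J.map ((algebraMap ℂ R).comp Complex.ofRealHom)) := by
    rw [hodgeProj, SimRep.mapMatrix_smul, map_sub, map_one, SimRep.mapMatrix_smul]
    rfl
  rw [e]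
  module

theorem isUnit_hodge {R : Type} [CommRing R] [Algebra ℂ R] {t : R} (ht : IsUnit t) :
    IsUnit ((1 + (t - 1) * algebraMap ℂ R 2⁻¹) ^ 2 +
      (-((t - 1) * algebraMap ℂ R 2⁻¹ * algebraMap ℂ R Complex.I)) ^ 2) := by
  have h1 : 2 * algebraMap ℂ R 2⁻¹ = 1 := by
    rw [← map_ofNat (algebraMap ℂ R) 2, ← map_mul]; simp
  have h2 : algebraMap ℂ R Complex.I ^ 2 = -1 := by
    rw [← map_pow, Complex.I_sq, map_neg, map_one]
  convert ht using 1
  linear_combination (t - 1) * h1 + ((t - 1) * algebraMap ℂ R 2⁻¹) ^ 2 * h2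

end HodgeProj

namespace Datum

variable {B V W : Type*} [Ring B] [Algebra ℚ B] [Module.Finite ℚ B] [IsSemisimpleRing B]
  [AddCommGroup V] [Module ℚ V] [Module B V] [IsScalarTower ℚ B V] [Module.Finite ℚ V]
  [AddCommGroup W] [Module ℚ W] [Module.Finite ℚ W]

section

variable {D : Datum B V} {ρ : D.Rep W}

theorem Rep.matRep_cochar {J : Matrix (Ix W) (Ix W) ℝ}
    (hJ : ∀ z : ℂ, z ≠ 0 → ρ.matRep ℝ (z.re • 1 + z.im • D.cplx) = z.re • 1 + z.im • J)
    {R : Type} [CommRing R] [Algebra ℚ R] [Algebra ℂ R] {t : R} (ht : IsUnit t) :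
    ρ.matRep R (1 - scal R (hodgeProj D.cplx) + t • scal R (hodgeProj D.cplx)) =
      1 - scal R (hodgeProj J) + t • scal R (hodgeProj J) := by
  rw [one_sub_hodgeProj_add, one_sub_hodgeProj_add]
  exact matRep_add_smul_cplx hJ _ (isUnit_hodge ht)

theorem Rep.matRep_smul_one {J : Matrix (Ix W) (Ix W) ℝ}
    (hJ : ∀ z : ℂ, z ≠ 0 → ρ.matRep ℝ (z.re • 1 + z.im • D.cplx) = z.re • 1 + z.im • J)
    {R : Type} [CommRing R] [Algebra ℚ R] [Algebra ℂ R] {t : R} (ht : IsUnit t) :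
    ρ.matRep R (t • 1) = t • 1 := by
  have := matRep_add_smul_cplx hJ ((algebraMap ℂ R).comp Complex.ofRealHom) (x := t) (y := 0)
    (by simpa using ht.pow 2)
  simpa using this

theorem transpose_hodgeProj_mul : (hodgeProj D.cplx).transpose * D.gram.map (algebraMap ℚ ℂ) =
    D.gram.map (algebraMap ℚ ℂ) * (1 - hodgeProj D.cplx) := by
  have h := congrArg Complex.ofRealHom.mapMatrix D.transpose_cplx_mul
  have e : Complex.ofRealHom.mapMatrix (D.gram.map (algebraMap ℚ ℝ)) =
      D.gram.map (algebraMap ℚ ℂ) := by ext a b; simp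
  rw [map_neg, map_mul, map_mul, e, RingHom.mapMatrix_apply, RingHom.mapMatrix_apply,
    Matrix.transpose_map] at h
  rw [hodgeProj, Matrix.transpose_smul, Matrix.transpose_sub, Matrix.transpose_smul,
    Matrix.transpose_one, Matrix.smul_mul, Matrix.sub_mul, Matrix.smul_mul, h, Matrix.one_mul,
    Matrix.mul_sub, Matrix.mul_smul, Matrix.mul_sub, Matrix.mul_smul, Matrix.mul_one]
  module

end

/-! ### The group `G` over the complex numbers -/

/-- A decomposition of `V_ℂ` into standard symplectic spaces such that the action of `B_ℂ` on it
is that of all matrices which permute and combine isomorphic summands, and such that the first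
half of each basis lies in the eigenspace of `h(i)` for the eigenvalue `i` and the second half in
the other eigenspace. -/
structure HodgeFrame (D : Datum B V) {ι : Type} [Fintype ι] (m l : ι → Type)
    [∀ i, Fintype (m i)] [∀ i, Fintype (l i)] [∀ i, DecidableEq (l i)] extends
    SympFrame ℂ (D.gram.map (algebraMap ℚ ℂ)) m l where
  commute_iff : ∀ {R : Type} [CommRing R] [Algebra ℚ R] (φ : ℂ →+* R)
    {M : Matrix (Ix V) (Ix V) R}, (∀ b : B, Commute M ((actMat V b).map (algebraMap ℚ R))) ↔
      ∀ i α β, Commute M ((Q i α * Q' i β).map φ)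
  proj_mul : ∀ i α, hodgeProj D.cplx * Q i α =
    Q i α * (Matrix.fromBlocks 1 0 0 0 : Matrix (l i ⊕ l i) (l i ⊕ l i) ℂ)

theorem OnlySymplecticFactors.exists_hodgeFrame {D : Datum B V} (hD : D.OnlySymplecticFactors) :
    ∃ (r : ℕ) (n g : Fin r → ℕ), (∀ i, 0 < n i) ∧
      Nonempty (D.HodgeFrame (fun i => Fin (n i)) (fun i => Fin (g i))) := by
  obtain ⟨r, n, u, hn, hu, hu1, huΩ, huJ, hcomm⟩ := hD.exists_units
  have e : Complex.ofRealHom.mapMatrix (D.gram.map (algebraMap ℚ ℝ)) =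
      D.gram.map (algebraMap ℚ ℂ) := by ext a b; simp
  let u' : ∀ i, Fin (n i) → Fin (n i) → Matrix (Ix V) (Ix V) ℂ :=
    fun i α β => Complex.ofRealHom.mapMatrix (u i α β)
  obtain ⟨g, fr, hfr, hP⟩ := exists_sympFrame (Ω := D.gram.map (algebraMap ℚ ℂ))
    (P := hodgeProj D.cplx) (u := u') (D.gram_mul_inv ℂ)
    (by rw [← Matrix.transpose_map, transpose_gram]; ext a b; simp)
    (hodgeProj_mul_self D.cplx_mul_cplx) transpose_hodgeProj_mul
    ⟨fun i a b c => by rw [← map_mul, hu.mul_same],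
      fun i a b c c' h => by rw [← map_mul, hu.mul_ne i a b c c' h, map_zero],
      fun i j h a b c c' => by rw [← map_mul, hu.mul_block i j h, map_zero]⟩
    (by simp only [u', ← map_sum, hu1, map_one])
    (fun i α β => by
      have := congrArg Complex.ofRealHom.mapMatrix (huΩ i α β)
      rwa [map_mul, map_mul, e, RingHom.mapMatrix_apply, Matrix.transpose_map] at this)
    (fun i α β => ((Commute.one_right _).sub_right
      (((huJ i α β).map Complex.ofRealHom.mapMatrix).smul_right _)).smul_right _)
    (fun i => ⟨0, hn i⟩)
  refine ⟨r, n, g, hn, ⟨⟨fr, fun {R} _ _ φ M => ?_, hP⟩⟩⟩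
  rw [hcomm (φ.comp Complex.ofRealHom)]
  simp only [hfr]
  rfl

namespace HodgeFrame

variable {D : Datum B V} {ι : Type} [Fintype ι] [DecidableEq ι] {m l : ι → Type}
  [∀ i, Fintype (m i)] [∀ i, Fintype (l i)] [∀ i, DecidableEq (l i)] (fr : D.HodgeFrame m l)

theorem gram_map {R : Type} [CommRing R] [Algebra ℚ R] (φ : ℂ →+* R) :
    (D.gram.map (algebraMap ℚ ℂ)).map φ = D.gram.map (algebraMap ℚ R) := by
  ext a b
  exact φ.toRatAlgHom.commutes _

theorem isPoint_act {R : Type} [CommRing R] [Algebra ℚ R] (φ : ℂ →+* R) {x : BlockFam l R}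
    (hx : IsGSp x) : D.IsPoint R ((fr.map φ).act x) := by
  obtain ⟨μ, hμ, hx⟩ := hx
  refine ⟨(fr.commute_iff φ).2 fun i α β => ?_, μ, hμ, ?_⟩
  · rw [Matrix.map_mul]
    exact (fr.map φ).commute_act x i α β
  · have := (fr.map φ).transpose_act_mul_mul hx
    generalize (fr.map φ).act x = M at this ⊢
    rwa [gram_map φ] at this

/-- Over the complex numbers, `G` is the group of families of symplectic similitudes with a common
multiplier. -/
theorem exists_act {R : Type} [CommRing R] [Algebra ℚ R] (φ : ℂ →+* R) (α₀ : ∀ i, m i)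
    {M : Matrix (Ix V) (Ix V) R} (hM : D.IsPoint R M) :
    ∃ x : BlockFam l R, IsGSp x ∧ (fr.map φ).act x = M := by
  obtain ⟨hb, μ, hμ, h⟩ := hM
  have hb' := (fr.commute_iff φ).1 hb
  simp only [Matrix.map_mul] at hb'
  refine ⟨_, ⟨μ, hμ, (fr.map φ).isSim_of_commute hb' ?_ α₀⟩,
    ((fr.map φ).eq_act_of_commute hb' α₀).symm⟩
  rwa [gram_map φ]

/-- The representation over the complex numbers of the group of families of similitudes that
corresponds to a representation of `G`. -/
def simRep (ρ : D.Rep W) : SimRep ℂ l (Ix W) where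
  toFun R _ _ x :=
    letI : Algebra ℚ R := Algebra.compHom R (algebraMap ℚ ℂ)
    ρ.matRep R ((fr.map (algebraMap ℂ R)).act x)
  one R _ _ := by
    let _ : Algebra ℚ R := Algebra.compHom R (algebraMap ℚ ℂ)
    rw [SympFrame.act_one, ρ.matRep_one]
  mul {R _ _ x y} hx hy := by
    let _ : Algebra ℚ R := Algebra.compHom R (algebraMap ℚ ℂ)
    rw [SympFrame.act_mul, ρ.matRep_mul (fr.isPoint_act _ hx) (fr.isPoint_act _ hy)]
  natural {R S _ _ _ _} φ x hx := by
    let _ : Algebra ℚ R := Algebra.compHom R (algebraMap ℚ ℂ)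
    let _ : Algebra ℚ S := Algebra.compHom S (algebraMap ℚ ℂ)
    have := ρ.matRep_natural (φ : R →+* S) (fr.isPoint_act (algebraMap ℂ R) hx)
    rw [← SympFrame.map_act] at this
    have e : ∀ {a b : Type} (A : Matrix a b ℂ),
        (A.map (algebraMap ℂ R)).map (φ : R →+* S) = A.map (algebraMap ℂ S) := fun A => by
      ext i j
      exact φ.commutes _
    rw [show (φ : R → S) = ((φ : R →+* S) : R → S) from rfl, ← this]
    congr 1
    simp only [SympFrame.act, SympFrame.map_Q, SympFrame.map_Q', e]

theorem simRep_toFun (ρ : D.Rep W) {R : Type} [CommRing R] [Algebra ℂ R] [Algebra ℚ R]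
    (x : BlockFam l R) :
    (fr.simRep ρ).toFun R x = ρ.matRep R ((fr.map (algebraMap ℂ R)).act x) := by
  rw [simRep]
  congr!
  exact Subsingleton.elim _ _

theorem hasWeights {ρ : D.Rep W} {J : Matrix (Ix W) (Ix W) ℝ} (hJJ : J * J = -1)
    (hJ : ∀ z : ℂ, z ≠ 0 → ρ.matRep ℝ (z.re • 1 + z.im • D.cplx) = z.re • 1 + z.im • J) :
    (fr.simRep ρ).HasWeights (hodgeProj J) where
  idem := hodgeProj_mul_self hJJ
  cochar {R _ _ t} ht := by
    let _ : Algebra ℚ R := Algebra.compHom R (algebraMap ℚ ℂ)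
    rw [simRep_toFun, (fr.map (algebraMap ℂ R)).act_cochar (P := scal R (hodgeProj D.cplx)),
      Rep.matRep_cochar hJ ht]
    intro i α
    have := congrArg (fun A => A.map (algebraMap ℂ R)) (fr.proj_mul i α)
    simp only [Matrix.map_mul] at this
    rw [Matrix.fromBlocks_map] at this
    simpa using this
  scalar {R _ _ t} ht := by
    let _ : Algebra ℚ R := Algebra.compHom R (algebraMap ℚ ℂ)
    rw [simRep_toFun, SympFrame.act_smul_one, Rep.matRep_smul_one hJ ht]

end HodgeFrame

end Datum

end

section

/-! ### Descent of intertwining operators -/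

namespace Datum

variable {B V W W' : Type*} [Ring B] [Algebra ℚ B] [Module.Finite ℚ B] [IsSemisimpleRing B]
  [AddCommGroup V] [Module ℚ V] [Module B V] [IsScalarTower ℚ B V] [Module.Finite ℚ V]
  [AddCommGroup W] [Module ℚ W] [Module.Finite ℚ W]
  [AddCommGroup W'] [Module ℚ W'] [Module.Finite ℚ W'] {D : Datum B V}

namespace Rep

/-- The matrix `p` with entries in `K` intertwines the two representations of `G` over `K`. -/
def Intertwines (ρ : D.Rep W) (σ : D.Rep W') {K : Type} [CommRing K]
    (p : Matrix (Ix W') (Ix W) K) : Prop :=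
  ∀ {R : Type} [CommRing R] [Algebra ℚ R] (φ : K →+* R) {M : Matrix (Ix V) (Ix V) R},
    D.IsPoint R M → σ.matRep R M * p.map φ = p.map φ * ρ.matRep R M

variable {ρ : D.Rep W} {σ : D.Rep W'}

theorem Intertwines.smul {K : Type} [CommRing K] {p : Matrix (Ix W') (Ix W) K}
    (hp : ρ.Intertwines σ p) (c : K) : ρ.Intertwines σ (c • p) := fun φ M hM => by
  have h : (c • p).map φ = φ c • p.map φ := by ext; simp
  rw [h, Matrix.mul_smul, Matrix.smul_mul, hp φ hM]

/-- Applying a `ℚ`-linear form to the entries of an operator that intertwines two representations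
of `G` over an extension of `ℚ` gives an operator that intertwines them over `ℚ`. -/
theorem Intertwines.map_linear {K : Type} [CommRing K] [Algebra ℚ K]
    {p : Matrix (Ix W') (Ix W) K} (hp : ρ.Intertwines σ p) (f : K →ₗ[ℚ] ℚ) :
    ρ.Intertwines σ (p.map f) := fun {R _ _} φ M hM => by
  let ψ : R →+* K ⊗[ℚ] R := (Algebra.TensorProduct.includeRight : R →ₐ[ℚ] K ⊗[ℚ] R)
  let χ : K →+* K ⊗[ℚ] R := (Algebra.TensorProduct.includeLeft : K →ₐ[ℚ] K ⊗[ℚ] R)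
  let F : K ⊗[ℚ] R →ₗ[ℚ] R := (TensorProduct.lid ℚ R).toLinearMap ∘ₗ f.rTensor R
  have hF : ∀ (c : K) (r : R), F (χ c * ψ r) = φ (f c) * r := fun c r => by
    have : φ (f c) = algebraMap ℚ R (f c) := RingHom.congr_fun (Subsingleton.elim _ _) _
    simp [F, χ, ψ, this, Algebra.smul_def]
  have h := hp χ (hM.map ψ)
  rw [σ.matRep_natural ψ hM, ρ.matRep_natural ψ hM] at h
  ext a b
  have := congrArg F (congrFun (congrFun h a) b)
  simp only [Matrix.mul_apply, Matrix.map_apply, map_sum] at this ⊢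
  simp only [mul_comm (ψ _), hF] at this
  simpa only [mul_comm] using this

theorem Intertwines.isMorphism {p : Matrix (Ix W') (Ix W) ℚ} (hp : ρ.Intertwines σ p) :
    IsMorphism ρ σ (Matrix.toLin (Module.finBasis ℚ W) (Module.finBasis ℚ W') p) := by
  intro R _ _ g x
  set f := Matrix.toLin (Module.finBasis ℚ W) (Module.finBasis ℚ W') p with hf
  have e : LinearMap.toMatrix (basR W R) (basR W' R) (f.baseChange R) = p.map (algebraMap ℚ R) := by
    have := LinearMap.toMatrix_baseChange R f (Module.finBasis ℚ W) (Module.finBasis ℚ W')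
    rwa [hf, LinearMap.toMatrix_toLin] at this
  have h := hp (algebraMap ℚ R) (D.isPoint_mat g)
  rw [σ.matRep_mat, ρ.matRep_mat, ← e] at h
  have h' : LinearMap.toMatrix (basR W R) (basR W' R) ((σ.toHom R g).1 ∘ₗ f.baseChange R) =
      LinearMap.toMatrix (basR W R) (basR W' R) (f.baseChange R ∘ₗ (ρ.toHom R g).1) := by
    rw [LinearMap.toMatrix_comp _ (basR W' R) _, LinearMap.toMatrix_comp _ (basR W R) _]
    exact h
  exact (LinearMap.congr_fun ((LinearMap.toMatrix _ _).injective h') x).symm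

theorem matRep_std {R : Type} [CommRing R] [Algebra ℚ R] {M : Matrix (Ix V) (Ix V) R}
    (hM : D.IsPoint R M) : D.std.matRep R M = M := by
  obtain ⟨g, rfl⟩ := D.exists_point hM
  exact D.std.matRep_mat g

/-- If the identity of `W_K` is a sum of endomorphisms that factor through a representation over
an extension field `K` of `ℚ`, then the same holds over `ℚ`. -/
theorem exists_sum_eq_one_rat {K : Type} [Field K] [Algebra ℚ K] {N : Type} [Fintype N]
    {p : N → Matrix (Ix W) (Ix W') K} {q : N → Matrix (Ix W') (Ix W) K}
    (hp : ∀ j, σ.Intertwines ρ (p j)) (hq : ∀ j, ρ.Intertwines σ (q j))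
    (h : ∑ j, p j * q j = 1) :
    ∃ (N' : Type) (_ : Fintype N') (p' : N' → Matrix (Ix W) (Ix W') ℚ)
      (q' : N' → Matrix (Ix W') (Ix W) ℚ), (∀ j, σ.Intertwines ρ (p' j)) ∧
      (∀ j, ρ.Intertwines σ (q' j)) ∧ ∑ j, p' j * q' j = 1 := by
  classical
  let b := Module.Basis.ofVectorSpace ℚ K
  obtain ⟨f, hf⟩ : ∃ f : K →ₗ[ℚ] ℚ, f 1 = 1 := by
    obtain ⟨f, hf⟩ := LinearMap.exists_leftInverse_of_injective (Algebra.linearMap ℚ K)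
      (LinearMap.ker_eq_bot.2 (algebraMap ℚ K).injective)
    exact ⟨f, by simpa using LinearMap.congr_fun hf 1⟩
  -- the finitely many basis elements that occur in the entries of the `q j`
  let s : Finset (Module.Basis.ofVectorSpaceIndex ℚ K) :=
    Finset.univ.biUnion fun j => Finset.univ.biUnion fun v => Finset.univ.biUnion fun w =>
      (b.repr (q j v w)).support
  have hs : ∀ j v w, ∑ t ∈ s, b.repr (q j v w) t • b t = q j v w := fun j v w => by
    conv_rhs => rw [← b.linearCombination_repr (q j v w), Finsupp.linearCombination_apply]
    refine (Finsupp.sum_of_support_subset _ (fun t ht => ?_) (fun t c => c • b t)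
      fun t _ => zero_smul ℚ (b t)).symm
    simp only [s, Finset.mem_biUnion, Finset.mem_univ, true_and]
    exact ⟨j, v, w, ht⟩
  refine ⟨N × s, inferInstance, fun j => (p j.1).map (f ∘ₗ LinearMap.mulRight ℚ (b j.2)),
    fun j => (q j.1).map (b.coord j.2), fun j => Intertwines.map_linear (hp j.1) _,
    fun j => Intertwines.map_linear (hq j.1) _, ?_⟩
  ext w w'
  have h1 := congrArg f (congrFun (congrFun h w) w')
  have h2 : f ((1 : Matrix (Ix W) (Ix W) K) w w') = (1 : Matrix (Ix W) (Ix W) ℚ) w w' := by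
    rw [Matrix.one_apply, Matrix.one_apply]
    split_ifs
    · exact hf
    · exact map_zero f
  rw [h2] at h1
  rw [← h1, Matrix.sum_apply, Matrix.sum_apply, Fintype.sum_prod_type, map_sum]
  refine Finset.sum_congr rfl fun j _ => ?_
  simp only [Matrix.mul_apply, Matrix.map_apply, LinearMap.comp_apply, LinearMap.mulRight_apply,
    Module.Basis.coord_apply, map_sum]
  rw [Finset.sum_comm]
  refine Finset.sum_congr rfl fun v _ => ?_
  conv_rhs => rw [← hs j v w', Finset.mul_sum, map_sum]
  rw [Finset.sum_coe_sort s fun t => f (p j w v * b t) * b.repr (q j v w') t]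
  refine Finset.sum_congr rfl fun t _ => ?_
  rw [mul_smul_comm, map_smul, smul_eq_mul, mul_comm]

/-- A representation is a direct summand of copies of another one if its identity is a sum of
endomorphisms that factor through the latter. -/
theorem isDirectSummand_copies {k : ℕ} {p : Fin k → W' →ₗ[ℚ] W} {q : Fin k → W →ₗ[ℚ] W'}
    (hp : ∀ j, IsMorphism σ ρ (p j)) (hq : ∀ j, IsMorphism ρ σ (q j))
    (h : ∑ j, p j ∘ₗ q j = LinearMap.id) : ρ.IsDirectSummand (σ.copies k) := by
  refine ⟨LinearMap.pi q, ∑ j, p j ∘ₗ LinearMap.proj j, ?_, ?_, ?_⟩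
  · intro R _ _ g x
    have hpi : ∀ (x : R ⊗[ℚ] W) (j : Fin k), TensorProduct.piRight ℚ R R (fun _ : Fin k => W')
        ((LinearMap.pi q).baseChange R x) j = (q j).baseChange R x := fun x j => by
      induction x with
      | zero => simp
      | tmul r w => simp
      | add x y hx hy => simp only [map_add, Pi.add_apply, hx, hy]
    apply (TensorProduct.piRight ℚ R R (fun _ : Fin k => W')).injective
    funext j
    rw [hpi, hq j R g x, ← hpi]
    change _ = TensorProduct.piRight ℚ R R (fun _ : Fin k => W') (diagEnd k R (σ.toHom R g).1
      ((LinearMap.pi q).baseChange R x)) j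
    simp [diagEnd]
  · intro R _ _ g x
    have hpr : ∀ x : R ⊗[ℚ] (Fin k → W'), (∑ j, p j ∘ₗ LinearMap.proj j).baseChange R x =
        ∑ j, (p j).baseChange R (TensorProduct.piRight ℚ R R (fun _ : Fin k => W') x j) :=
      fun x => by
      induction x with
      | zero => simp
      | tmul r w => simp [TensorProduct.tmul_sum]
      | add x y hx hy => simp only [map_add, Pi.add_apply, hx, hy, Finset.sum_add_distrib]
    rw [hpr, hpr, map_sum]
    refine Finset.sum_congr rfl fun j _ => ?_
    rw [← hp j R g]
    congr 1
    change TensorProduct.piRight ℚ R R (fun _ : Fin k => W') (diagEnd k R (σ.toHom R g).1 x) j = _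
    simp [diagEnd]
  · rw [← h]
    ext w
    simp

end Rep

/-! ### Intertwining operators over the complex numbers -/

namespace HodgeFrame

variable {ι : Type} [Fintype ι] [DecidableEq ι] {m l : ι → Type}
  [∀ i, Fintype (m i)] [∀ i, Fintype (l i)] [∀ i, DecidableEq (l i)] (fr : D.HodgeFrame m l)
  {ρ : D.Rep W} {P : Matrix (Ix W) (Ix W) ℂ} (hP : (fr.simRep ρ).HasWeights P)

/-- The columns of index `c` of the matrix units in the `b`-th column of the `i`-th block. They are
the images of the standard basis under a homomorphism to `W_ℂ` from the `i`-th standard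
representation. -/
def colMat (i : ι) (b : l i ⊕ l i) (c : Ix W) : Matrix (Ix W) (l i ⊕ l i) ℂ :=
  Matrix.of fun w a => SimRep.units hP i a b w c

/-- The rows of index `c` of the matrix units in the `b`-th row of the `i`-th block. They are the
components of a homomorphism from `W_ℂ` to the `i`-th standard representation. -/
def rowMat (i : ι) (b : l i ⊕ l i) (c : Ix W) : Matrix (l i ⊕ l i) (Ix W) ℂ :=
  Matrix.of fun a w => SimRep.units hP i b a c w

theorem sum_colMat_mul_rowMat (i : ι) (b : l i ⊕ l i) :
    ∑ c, colMat fr hP i b c * rowMat fr hP i b c = ∑ a, SimRep.units hP i a a := by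
  have h : ∀ a, SimRep.units hP i a a = SimRep.units hP i a b * SimRep.units hP i b a := fun a =>
    ((SimRep.isMatrixUnits_units hP).mul_same i a b a).symm
  simp only [h]
  ext w w'
  simp only [Matrix.sum_apply, Matrix.mul_apply, colMat, rowMat, Matrix.of_apply]
  exact Finset.sum_comm

variable {R : Type} [CommRing R] [Algebra ℂ R]

theorem ext_mul_colMat (x : BlockFam l R) (i : ι) (b : l i ⊕ l i) (c : Ix W) :
    SimRep.ext hP R x * (colMat fr hP i b c).map (algebraMap ℂ R) =
      (colMat fr hP i b c).map (algebraMap ℂ R) * x i := by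
  ext w a
  have h1 := congrArg (SimRep.ext hP R) (mul_unitFam x i a b)
  rw [SimRep.ext_mul, map_sum] at h1
  simp only [map_smul] at h1
  simp only [SimRep.ext, unitsLin_unitFam] at h1
  have h2 := congrFun (congrFun h1 w) c
  rw [Matrix.mul_apply, Matrix.sum_apply] at h2
  rw [Matrix.mul_apply, Matrix.mul_apply]
  refine h2.trans (Finset.sum_congr rfl fun a' _ => ?_)
  rw [Matrix.smul_apply, smul_eq_mul, mul_comm]
  rfl

theorem rowMat_mul_ext (x : BlockFam l R) (i : ι) (b : l i ⊕ l i) (c : Ix W) :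
    (rowMat fr hP i b c).map (algebraMap ℂ R) * SimRep.ext hP R x =
      x i * (rowMat fr hP i b c).map (algebraMap ℂ R) := by
  ext a w
  have h1 := congrArg (SimRep.ext hP R) (unitFam_mul x i b a)
  rw [SimRep.ext_mul, map_sum] at h1
  simp only [map_smul] at h1
  simp only [SimRep.ext, unitsLin_unitFam] at h1
  have h2 := congrFun (congrFun h1 c) w
  rw [Matrix.mul_apply, Matrix.sum_apply] at h2
  rw [Matrix.mul_apply, Matrix.mul_apply]
  exact h2

theorem matRep_eq_ext [Algebra ℚ R] {x : BlockFam l R} (hx : IsGSp x) :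
    ρ.matRep R ((fr.map (algebraMap ℂ R)).act x) = SimRep.ext hP R x := by
  rw [← simRep_toFun, SimRep.toFun_eq_ext hx]

theorem intertwines_colMat_mul (α₀ : ∀ i, m i) (i : ι) (b : l i ⊕ l i) (c : Ix W) :
    D.std.Intertwines ρ (colMat fr hP i b c * fr.Q' i (α₀ i)) := fun {R _ _} φ M hM => by
  let _ : Algebra ℂ R := φ.toAlgebra
  obtain ⟨x, hx, rfl⟩ := fr.exists_act φ α₀ hM
  have h1 := (fr.map φ).proj_mul_act x i (α₀ i)
  rw [Rep.matRep_std hM, Matrix.map_mul, Matrix.mul_assoc]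
  rw [SympFrame.map_Q'] at h1
  rw [h1]
  have h2 := matRep_eq_ext fr hP hx
  change ρ.matRep R ((fr.map φ).act x) = _ at h2
  rw [h2, ← Matrix.mul_assoc]
  have h3 := ext_mul_colMat fr hP x i b c
  change _ * (colMat fr hP i b c).map φ = (colMat fr hP i b c).map φ * _ at h3
  rw [h3, Matrix.mul_assoc]

theorem intertwines_mul_rowMat (α₀ : ∀ i, m i) (i : ι) (b : l i ⊕ l i) (c : Ix W) :
    ρ.Intertwines D.std (fr.Q i (α₀ i) * rowMat fr hP i b c) := fun {R _ _} φ M hM => by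
  let _ : Algebra ℂ R := φ.toAlgebra
  obtain ⟨x, hx, rfl⟩ := fr.exists_act φ α₀ hM
  have h1 := (fr.map φ).act_mul_incl x i (α₀ i)
  rw [Rep.matRep_std hM, Matrix.map_mul, ← Matrix.mul_assoc]
  rw [SympFrame.map_Q] at h1
  rw [h1]
  have h2 := matRep_eq_ext fr hP hx
  change ρ.matRep R ((fr.map φ).act x) = _ at h2
  rw [h2, Matrix.mul_assoc]
  have h3 := rowMat_mul_ext fr hP x i b c
  change (rowMat fr hP i b c).map φ * _ = _ * (rowMat fr hP i b c).map φ at h3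
  rw [← h3, Matrix.mul_assoc]

/-- Over the complex numbers, the identity of `W` is a sum of endomorphisms that factor through
`V`. -/
theorem exists_sum_eq_one (fr : D.HodgeFrame m l) {ρ : D.Rep W} {P : Matrix (Ix W) (Ix W) ℂ}
    (hP : (fr.simRep ρ).HasWeights P) (α₀ : ∀ i, m i) :
    ∃ (N : Type) (_ : Fintype N) (p : N → Matrix (Ix W) (Ix V) ℂ)
      (q : N → Matrix (Ix V) (Ix W) ℂ), (∀ j, D.std.Intertwines ρ (p j)) ∧
      (∀ j, ρ.Intertwines D.std (q j)) ∧ ∑ j, p j * q j = 1 := by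
  -- averaging over `b` avoids a case distinction for blocks of rank `0`
  refine ⟨(Σ i, l i ⊕ l i) × Ix W, inferInstance,
    fun j => ((Fintype.card (l j.1.1 ⊕ l j.1.1) : ℂ)⁻¹) •
      (colMat fr hP j.1.1 j.1.2 j.2 * fr.Q' j.1.1 (α₀ j.1.1)),
    fun j => fr.Q j.1.1 (α₀ j.1.1) * rowMat fr hP j.1.1 j.1.2 j.2,
    fun j => Rep.Intertwines.smul (intertwines_colMat_mul fr hP α₀ _ _ _) _,
    fun j => intertwines_mul_rowMat fr hP α₀ _ _ _, ?_⟩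
  have h : ∀ (i : ι) (b : l i ⊕ l i) (c : Ix W),
      (colMat fr hP i b c * fr.Q' i (α₀ i)) * (fr.Q i (α₀ i) * rowMat fr hP i b c) =
        colMat fr hP i b c * rowMat fr hP i b c := fun i b c => by
    rw [Matrix.mul_assoc, ← Matrix.mul_assoc (fr.Q' i _), fr.mul_same, Matrix.one_mul]
  rw [Fintype.sum_prod_type, Fintype.sum_sigma]
  simp only [Matrix.smul_mul, h]
  have h1 := SimRep.ext_one hP (R := ℂ)
  rw [SimRep.ext, unitsLin_one] at h1
  rw [← h1]
  refine Finset.sum_congr rfl fun i _ => ?_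
  have h2 : ∀ b, ∑ c, (Fintype.card (l i ⊕ l i) : ℂ)⁻¹ •
      (colMat fr hP i b c * rowMat fr hP i b c) =
      (Fintype.card (l i ⊕ l i) : ℂ)⁻¹ • ∑ a, SimRep.units hP i a a := fun b => by
    rw [← Finset.smul_sum, sum_colMat_mul_rowMat]
  rw [Finset.sum_congr rfl fun b _ => h2 b, Finset.sum_const, Finset.card_univ,
    ← Nat.cast_smul_eq_nsmul ℂ, smul_smul]
  rcases Nat.eq_zero_or_pos (Fintype.card (l i ⊕ l i)) with h0 | h0
  · have := Fintype.card_eq_zero_iff.1 h0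
    simp
  · rw [mul_inv_cancel₀ (by exact_mod_cast h0.ne'), one_smul]
    rfl

end HodgeFrame

end Datum

end

end PEL

end

theorem lemma11p2 {B V W : Type*} [Ring B] [Algebra ℚ B] [Module.Finite ℚ B]
    [IsSemisimpleRing B] [AddCommGroup V] [Module ℚ V] [Module B V] [IsScalarTower ℚ B V]
    [Module.Finite ℚ V] (D : PEL.Datum B V) (hD : D.OnlySymplecticFactors)
    [AddCommGroup W] [Module ℚ W] [Module.Finite ℚ W] (ρ : D.Rep W)
    (hρ : ρ.HodgeTypeIn {(-1, 0), (0, -1)}) :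
    ∃ k : ℕ, ρ.IsDirectSummand (D.std.copies k) := by
  obtain ⟨r, n, g, hn, ⟨fr⟩⟩ := hD.exists_hodgeFrame
  obtain ⟨J, hJJ, hJ⟩ := hρ.exists_cplx
  obtain ⟨N, _, p, q, hp, hq, hpq⟩ :=
    fr.exists_sum_eq_one (fr.hasWeights hJJ hJ) fun i => ⟨0, hn i⟩
  obtain ⟨N', _, p', q', hp', hq', hpq'⟩ := PEL.Datum.Rep.exists_sum_eq_one_rat hp hq hpq
  let e := (Fintype.equivFin N').symm
  refine ⟨Fintype.card N', PEL.Datum.Rep.isDirectSummand_copies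
    (fun j => PEL.Datum.Rep.Intertwines.isMorphism (hp' (e j)))
    (fun j => PEL.Datum.Rep.Intertwines.isMorphism (hq' (e j))) ?_⟩
  simp only [← Matrix.toLin_mul]
  rw [← map_sum, Equiv.sum_comp e fun j => p' j * q' j, hpq', Matrix.toLin_one]
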